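/- Let $d\ge 1$, let $\mathcal H=[-\tfrac12,\tfrac12)^d$, and let $f_x$ be any probability density (with respect to Lebesgue measure) on $\mathcal H$. For $n,m\ge 1$ let $\mathbf x_1,\dots,\mathbf x_m$ be i.i.d. random vectors with density $f_x$, and let $\mathbf V$ be the $n^d\times m$ $d$-fold Vandermonde matrix with rows indexed by $\boldsymbol\ell\in\{0,\dots,n-1\}^d$ and entries \[ \mathbf V_{\boldsymbol\ell,q}=m^{-1/2}\exp\left(-2\pi \mathrm i\,\boldsymbol\ell^{\mathsf T}\mathbf x_q\right). \] For $\beta>0$, the limiting spectral distribution (LSD) of $\mathbf V\mathbf V^{\mathsf H}$ with ratio $\beta$ is the probability measure $\Lambda_{x,\beta}$ on $\mathbb R$ such that, whenever $n,m\to\infty$ with $n^d/m\to\beta$, the average empirical cumulative distribution of the eigenvalues, $z\mapsto \mathbb E\left[n^{-d}\sum_{i=1}^{n^d}1\{\lambda_i\le z\}\right]$, converges to the cumulative distribution function of $\Lambda_{x,\beta}$ at each of its continuity points. Let $\mathcal A=\{\mathbf z\in\mathcal H : f_x(\mathbf z)>0\}$, let $|\cdot|$ denote Lebesgue measure, and let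 $g_x$ be the probability measure on $(0,\infty)$ with cumulative distribution function $G_x(y)=|\{\mathbf z\in\mathcal A : f_x(\mathbf z)\le y\}|/|\mathcal A|$. Then the LSD $\Lambda_{x,\beta}$ exists for every $\beta>0$ and, as $\beta\to 0^+$, it converges weakly to \[ \left(1-|\mathcal A|\right)\delta_0+|\mathcal A|\,g_x, \] which is the distribution of the values of $f_x$, i.e. the law of $f_x(\mathbf z)$ for $\mathbf z$ uniformly distributed on $\mathcal H$. In particular, for uniformly distributed phases ($f_x\equiv 1$ on $\mathcal H$) the LSD exists for every $\beta>0$ and converges weakly to $\delta_1$ as $\beta\to 0^+$. -/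

import Mathlib

open MeasureTheory ProbabilityTheory Filter Topology

noncomputable section

namespace FoldVandermonde

/-- The hypercube `[-1/2, 1/2)^d` over which the sampling points fall. -/
def cube (d : ℕ) : Set (Fin d → ℝ) :=
  Set.univ.pi fun _ => Set.Ico (-(1 / 2 : ℝ)) (1 / 2)

/-- `f` is a probability density (with respect to Lebesgue measure) on the hypercube.
Only the values of `f` on the hypercube matter. -/
structure IsPhaseDensity (d : ℕ) (f : (Fin d → ℝ) → ℝ) : Prop where
  measurable : Measurable f
  nonneg : ∀ z ∈ cube d, 0 ≤ f z
  lintegral_eq_one : ∫⁻ z in cube d, ENNReal.ofReal (f z) = 1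

/-- The law on the hypercube with density `f`. -/
def pointLaw (d : ℕ) (f : (Fin d → ℝ) → ℝ) : Measure (Fin d → ℝ) :=
  (volume.restrict (cube d)).withDensity fun z => ENNReal.ofReal (f z)

/-- The joint law of `m` independent sampling points with common density `f`. -/
def sampleLaw (d : ℕ) (f : (Fin d → ℝ) → ℝ) (m : ℕ) : Measure (Fin m → Fin d → ℝ) :=
  Measure.pi fun _ => pointLaw d f

/-- The `d`-fold `n^d × m` Vandermonde matrix with entries `m^{-1/2} exp(-2πi ℓᵀ x_q)`. Its rows
are indexed by the multi-indices `ℓ ∈ {0, …, n-1}^d` themselves. -/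
def vandermonde {d m : ℕ} (n : ℕ) (x : Fin m → Fin d → ℝ) :
    Matrix (Fin d → Fin n) (Fin m) ℂ :=
  Matrix.of fun ℓ q =>
    (((Real.sqrt m)⁻¹ : ℝ) : ℂ) *
      Complex.exp (-2 * Real.pi * Complex.I * ∑ j, ((ℓ j : ℕ) : ℂ) * (x q j : ℂ))

/-- The eigenvalues (with multiplicity) of `V Vᴴ`. -/
def gramEigenvalues {d m : ℕ} (n : ℕ) (x : Fin m → Fin d → ℝ) : (Fin d → Fin n) → ℝ :=
  (Matrix.isHermitian_mul_conjTranspose_self (vandermonde n x)).eigenvalues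

/-- The average empirical cumulative distribution of the eigenvalues of `V Vᴴ`, namely
`E [ n^{-d} ∑_ℓ 1{λ_ℓ ≤ z} ]`, when the `m` sampling points are i.i.d. with density `f`. -/
def meanESD (d : ℕ) (f : (Fin d → ℝ) → ℝ) (n m : ℕ) (z : ℝ) : ℝ :=
  ∫ x, ((n : ℝ) ^ d)⁻¹ * ∑ ℓ, (Set.Iic z).indicator (fun _ => (1 : ℝ)) (gramEigenvalues n x ℓ)
    ∂(sampleLaw d f m)

/-- `μ` is the limiting spectral distribution of `V Vᴴ` for `n, m → ∞` with `n^d / m → β`: the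
average empirical cumulative distributions converge to the cumulative distribution function of
`μ` at each of its continuity points. -/
def IsLSD (d : ℕ) (f : (Fin d → ℝ) → ℝ) (β : ℝ) (μ : ProbabilityMeasure ℝ) : Prop :=
  ∀ n m : ℕ → ℕ, Tendsto n atTop atTop → Tendsto m atTop atTop →
    Tendsto (fun k => (n k : ℝ) ^ d / (m k : ℝ)) atTop (𝓝 β) →
    ∀ z : ℝ, (μ : Measure ℝ) {z} = 0 →
      Tendsto (fun k => meanESD d f (n k) (m k) z) atTop (𝓝 ((μ : Measure ℝ).real (Set.Iic z)))

/-- The part of the hypercube on which the density is strictly positive. -/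
def positivitySet (d : ℕ) (f : (Fin d → ℝ) → ℝ) : Set (Fin d → ℝ) :=
  {z ∈ cube d | 0 < f z}

/-- The law of `f(z)` for `z` uniformly distributed on the positivity set of `f`. -/
def valueLaw (d : ℕ) (f : (Fin d → ℝ) → ℝ) : Measure ℝ :=
  (ProbabilityTheory.cond volume (positivitySet d f)).map f

/-- The cumulative distribution function of `valueLaw`: `|{z ∈ A | f z ≤ y}| / |A|`. -/
theorem valueLaw_Iic (d : ℕ) (f : (Fin d → ℝ) → ℝ) (hf : Measurable f) (y : ℝ) :
    valueLaw d f (Set.Iic y) =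
      (volume (positivitySet d f))⁻¹ * volume {z ∈ positivitySet d f | f z ≤ y} := by
  have hA : MeasurableSet (positivitySet d f) :=
    (MeasurableSet.univ_pi fun _ => measurableSet_Ico).inter
      (measurableSet_lt measurable_const hf)
  rw [valueLaw, Measure.map_apply hf measurableSet_Iic, ProbabilityTheory.cond_apply hA]
  rfl

end FoldVandermonde

end

/-! Everything is done with characteristic functions. The average over the sample of `n^{-d} ∑ exp(i
t λ)`, the sum running over the eigenvalues of `V Vᴴ`, is the characteristic function of the mean
spectral distribution. It has to converge for each `t`, and its limit has to tend to `∫ exp(i t f)`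
over the cube as the ratio vanishes; Lévy's theorem turns both into weak convergence.

The method of moments cannot be applied to `f` itself, which may have infinite moments, so `f` is
first replaced by a trigonometric polynomial. Each sampling point contributes to `V Vᴴ` a positive
semidefinite summand of trace `n^d/m`, and adding a positive semidefinite `P` moves `∑ exp(i t λ)`
by at most `|t| tr P` (`norm_sum_exp_sub_le`). One point thus moves the normalised statistic by at
most `|t|/m` away from a centre which does not depend on that point. Changing the law of the `m`
points one at a time (`norm_integral_pi_sub_le`) shows that the characteristic function is
`|t|`-Lipschitz in the density for the `L¹` distance, uniformly in `n` and `m`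
(`norm_charFun_meanMeasure_sub_le`). Trigonometric densities are `L¹`-dense
(`exists_isTrigDensity_near`).

For a trigonometric density, the trace of a power is a sum over closed walks in the grid whose steps
are labelled by sampling points. By independence, each point contributes the Fourier coefficient at
the net increment of the walk over its own steps, and only finitely many increments have a nonzero
coefficient. Closed walks with prescribed increments are counted coordinatewise as lattice points,
asymptotically the volume of a polytope times a power of `n` (`tendsto_latticeCount_div`). A
partition of the steps with `f` free vertices has weight of order `(n^d/m)^(f-1)`, so all mean
moments converge. There are few enough partitions for the exponential series to converge absolutely
(`summable_labelCount`), and the limit passes through it (`tendsto_charFun_of_isTrigDensity`).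

As `β → 0` only the partition into singletons survives. Its weight is the zeroth Fourier coefficient
of a power of the density, that is `∫ g^p`, and the series sums to `∫ exp(i t g)`
(`tendsto_limitChar_zero`). The uniform Lipschitz bound carries both limits over to `f`. The
eigenvalues have mean one, so the limit `Φ` satisfies `|Φ(t) - 1| ≤ |t|`; this gives continuity at
the origin, hence tightness and an actual limiting measure (`exists_lsd`). -/

noncomputable section

namespace FoldVandermonde

/-! ### Perturbation of linear spectral statistics of Hermitian matrices -/

section Spectral

open Matrix
open scoped ComplexOrder

variable {ι : Type*} [Fintype ι]

/-- The squared Frobenius norm of a complex matrix. -/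
def frobSq (M : Matrix ι ι ℂ) : ℝ := ∑ i, ∑ j, ‖M i j‖ ^ 2

lemma frobSq_eq_trace (M : Matrix ι ι ℂ) : ((frobSq M : ℝ) : ℂ) = (Mᴴ * M).trace := by
  simp only [frobSq, Matrix.trace, Matrix.diag, Matrix.mul_apply, conjTranspose_apply]
  push_cast
  rw [Finset.sum_comm]
  refine Finset.sum_congr rfl fun i _ => Finset.sum_congr rfl fun j _ => ?_
  rw [← Complex.ofReal_pow, ← Complex.normSq_eq_norm_sq, Complex.star_def,
    Complex.normSq_eq_conj_mul_self]

variable [DecidableEq ι]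

lemma frobSq_unitary_mul_mul (M : Matrix ι ι ℂ) (U V : Matrix ι ι ℂ) (hU : U * Uᴴ = 1)
    (hV : V * Vᴴ = 1) : frobSq (Uᴴ * M * V) = frobSq M := by
  have : ((frobSq (Uᴴ * M * V) : ℝ) : ℂ) = (frobSq M : ℝ) := by
    rw [frobSq_eq_trace, frobSq_eq_trace]
    have h1 : (Uᴴ * M * V)ᴴ * (Uᴴ * M * V) = Vᴴ * (Mᴴ * M * V) := by
      simp only [conjTranspose_mul, conjTranspose_conjTranspose]
      calc Vᴴ * (Mᴴ * U) * (Uᴴ * M * V) = Vᴴ * (Mᴴ * (U * Uᴴ) * M * V) := by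
            simp only [Matrix.mul_assoc]
        _ = _ := by rw [hU, Matrix.mul_one]
    rw [h1, trace_mul_comm, Matrix.mul_assoc, hV, Matrix.mul_one]
  exact_mod_cast this

lemma _root_.Matrix.IsHermitian.exists_unitary_diagonal {A : Matrix ι ι ℂ} (hA : A.IsHermitian) :
    ∃ U : Matrix ι ι ℂ, U * Uᴴ = 1 ∧ Uᴴ * U = 1 ∧
      A = U * diagonal (fun i => (hA.eigenvalues i : ℂ)) * Uᴴ := by
  refine ⟨hA.eigenvectorUnitary, Unitary.coe_mul_star_self hA.eigenvectorUnitary,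
    Unitary.coe_star_mul_self hA.eigenvectorUnitary, ?_⟩
  have := hA.spectral_theorem
  rw [Unitary.conjStarAlgAut_apply] at this
  exact this

/-- The overlaps of two eigenbases form a doubly stochastic matrix intertwining the spectra. -/
theorem exists_overlap {A B : Matrix ι ι ℂ} (hA : A.IsHermitian) (hB : B.IsHermitian) :
    ∃ (w : ι → ι → ℝ) (V : Matrix ι ι ℂ), (∀ i j, 0 ≤ w i j) ∧ (∀ i, ∑ j, w i j = 1) ∧
      (∀ j, ∑ i, w i j = 1) ∧
      (∑ i, ∑ j, w i j * (hA.eigenvalues i - hB.eigenvalues j) ^ 2 = frobSq (A - B)) ∧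
      V * Vᴴ = 1 ∧
      ∀ j, ((∑ i, w i j * (hA.eigenvalues i - hB.eigenvalues j) : ℝ) : ℂ) =
        (Vᴴ * (A - B) * V) j j := by
  obtain ⟨U, hU1, hU2, hAs⟩ := hA.exists_unitary_diagonal
  obtain ⟨V, hV1, hV2, hBs⟩ := hB.exists_unitary_diagonal
  set W := Uᴴ * V with hW
  have hWW : W * Wᴴ = 1 := by
    rw [hW, conjTranspose_mul, conjTranspose_conjTranspose]
    calc Uᴴ * V * (Vᴴ * U) = Uᴴ * (V * Vᴴ) * U := by simp only [Matrix.mul_assoc]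
      _ = 1 := by rw [hV1, Matrix.mul_one, hU2]
  have hWW' : Wᴴ * W = 1 := by
    rw [hW, conjTranspose_mul, conjTranspose_conjTranspose]
    calc Vᴴ * U * (Uᴴ * V) = Vᴴ * (U * Uᴴ) * V := by simp only [Matrix.mul_assoc]
      _ = 1 := by rw [hU1, Matrix.mul_one, hV2]
  have hD : Uᴴ * (A - B) * V =
      diagonal (fun i => (hA.eigenvalues i : ℂ)) * W -
        W * diagonal (fun i => (hB.eigenvalues i : ℂ)) := by
    rw [Matrix.mul_sub, Matrix.sub_mul]
    congr 1
    · calc Uᴴ * A * V = Uᴴ * (U * diagonal (fun i => (hA.eigenvalues i : ℂ)) * Uᴴ) * V := by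
            rw [← hAs]
        _ = (Uᴴ * U) * diagonal (fun i => (hA.eigenvalues i : ℂ)) * (Uᴴ * V) := by
            simp only [Matrix.mul_assoc]
        _ = _ := by rw [hU2, Matrix.one_mul]
    · calc Uᴴ * B * V = Uᴴ * (V * diagonal (fun i => (hB.eigenvalues i : ℂ)) * Vᴴ) * V := by
            rw [← hBs]
        _ = (Uᴴ * V) * diagonal (fun i => (hB.eigenvalues i : ℂ)) * (Vᴴ * V) := by
            simp only [Matrix.mul_assoc]
        _ = _ := by rw [hV2, Matrix.mul_one]
  -- Written in the two eigenbases, `A - B` is the overlap matrix `W` with entries weighted by the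
  -- gaps `a i - b j`. With weights `‖W i j‖ ^ 2`, its Frobenius norm is the quadratic cost of a
  -- coupling of the two spectra.
  have hDij : ∀ i j, (Uᴴ * (A - B) * V) i j =
      ((hA.eigenvalues i - hB.eigenvalues j : ℝ) : ℂ) * W i j := by
    intro i j
    rw [hD, Matrix.sub_apply, diagonal_mul, mul_diagonal]
    push_cast; ring
  have hn : ∀ i j, ((‖W i j‖ ^ 2 : ℝ) : ℂ) = star (W i j) * W i j := by
    intro i j
    rw [← Complex.normSq_eq_norm_sq, Complex.star_def, Complex.normSq_eq_conj_mul_self]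
  refine ⟨fun i j => ‖W i j‖ ^ 2, V, fun i j => by positivity, fun i => ?_, fun j => ?_, ?_, hV1,
    fun j => ?_⟩
  · have h : (W * Wᴴ) i i = 1 := by rw [hWW, one_apply_eq]
    have h2 : ((∑ j, ‖W i j‖ ^ 2 : ℝ) : ℂ) = 1 := by
      rw [← h, mul_apply]
      push_cast
      refine Finset.sum_congr rfl fun j _ => ?_
      rw [conjTranspose_apply, mul_comm, ← hn]; push_cast; rfl
    exact_mod_cast h2
  · have h : (Wᴴ * W) j j = 1 := by rw [hWW', one_apply_eq]
    have h2 : ((∑ i, ‖W i j‖ ^ 2 : ℝ) : ℂ) = 1 := by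
      rw [← h, mul_apply]
      push_cast
      refine Finset.sum_congr rfl fun i _ => ?_
      rw [conjTranspose_apply, ← hn]; push_cast; rfl
    exact_mod_cast h2
  · rw [← frobSq_unitary_mul_mul (A - B) U V hU1 hV1, frobSq]
    refine Finset.sum_congr rfl fun i _ => Finset.sum_congr rfl fun j _ => ?_
    rw [hDij, norm_mul, mul_pow, Complex.norm_real, Real.norm_eq_abs, sq_abs, mul_comm]
  · have h : Vᴴ * (A - B) * V = Wᴴ * (Uᴴ * (A - B) * V) := by
      rw [hW, conjTranspose_mul, conjTranspose_conjTranspose]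
      calc Vᴴ * (A - B) * V = Vᴴ * (1 * (A - B)) * V := by rw [Matrix.one_mul]
        _ = Vᴴ * ((U * Uᴴ) * (A - B)) * V := by rw [hU1]
        _ = _ := by simp only [Matrix.mul_assoc]
    rw [h, mul_apply]
    push_cast
    refine Finset.sum_congr rfl fun i _ => ?_
    rw [hDij, conjTranspose_apply]
    have := hn i j
    push_cast at this ⊢
    rw [this]; ring

/-- Linear spectral statistics of Lipschitz functions are Frobenius-Lipschitz. -/
theorem norm_sum_eigenvalues_sub_le {A B : Matrix ι ι ℂ} (hA : A.IsHermitian)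
    (hB : B.IsHermitian) (g : ℝ → ℝ) (L : ℝ) (hL : 0 ≤ L) (hg : ∀ a b, |g a - g b| ≤ L * |a - b|) :
    |∑ i, g (hA.eigenvalues i) - ∑ i, g (hB.eigenvalues i)| ≤
      L * Real.sqrt (Fintype.card ι) * Real.sqrt (frobSq (A - B)) := by
  obtain ⟨w, V, hw, hr, hc, hF, -, -⟩ := exists_overlap hA hB
  -- The doubly stochastic weights couple the two spectra, so the difference of sums becomes one
  -- weighted double sum, to which Cauchy–Schwarz applies.
  have h1 : ∑ i, g (hA.eigenvalues i) - ∑ i, g (hB.eigenvalues i) =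
      ∑ i, ∑ j, w i j * (g (hA.eigenvalues i) - g (hB.eigenvalues j)) := by
    simp only [mul_sub, Finset.sum_sub_distrib]
    congr 1
    · exact Finset.sum_congr rfl fun i _ => by rw [← Finset.sum_mul, hr, one_mul]
    · rw [Finset.sum_comm]
      exact Finset.sum_congr rfl fun i _ => by rw [← Finset.sum_mul, hc, one_mul]
  have h2 : |∑ i, ∑ j, w i j * (g (hA.eigenvalues i) - g (hB.eigenvalues j))| ≤
      L * ∑ x : ι × ι, Real.sqrt (w x.1 x.2) *
        (Real.sqrt (w x.1 x.2) * |hA.eigenvalues x.1 - hB.eigenvalues x.2|) := by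
    rw [Fintype.sum_prod_type, Finset.mul_sum]
    refine (Finset.abs_sum_le_sum_abs _ _).trans (Finset.sum_le_sum fun i _ => ?_)
    rw [Finset.mul_sum]
    refine (Finset.abs_sum_le_sum_abs _ _).trans (Finset.sum_le_sum fun j _ => ?_)
    rw [abs_mul, abs_of_nonneg (hw i j), ← mul_assoc (Real.sqrt _), Real.mul_self_sqrt (hw i j)]
    nlinarith [hg (hA.eigenvalues i) (hB.eigenvalues j), hw i j]
  have h3 := Real.sum_mul_le_sqrt_mul_sqrt (Finset.univ : Finset (ι × ι))
    (fun x => Real.sqrt (w x.1 x.2))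
    (fun x => Real.sqrt (w x.1 x.2) * |hA.eigenvalues x.1 - hB.eigenvalues x.2|)
  have h4 : ∑ x : ι × ι, Real.sqrt (w x.1 x.2) ^ 2 = Fintype.card ι := by
    rw [Fintype.sum_prod_type]
    simp [Real.sq_sqrt (hw _ _), hr]
  have h5 : ∑ x : ι × ι,
      (Real.sqrt (w x.1 x.2) * |hA.eigenvalues x.1 - hB.eigenvalues x.2|) ^ 2 =
      frobSq (A - B) := by
    rw [Fintype.sum_prod_type, ← hF]
    simp [mul_pow, Real.sq_sqrt (hw _ _), sq_abs]
  rw [h4, h5] at h3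
  rw [h1]
  refine h2.trans ?_
  rw [mul_assoc]
  exact mul_le_mul_of_nonneg_left h3 hL

lemma norm_exp_I_sub_one_le (s : ℝ) : ‖Complex.exp (s * Complex.I) - 1‖ ≤ |s| := by
  have := Real.norm_exp_I_mul_ofReal_sub_one_le (x := s)
  rwa [mul_comm, Real.norm_eq_abs] at this

/-- Taylor gives `s ^ 2` for `|s| ≤ 1`; otherwise the triangle inequality gives `2 * |s| ≤ 2 * s ^
2`. The constant 2 makes the bound valid for every `s`. -/
lemma norm_exp_I_sub_sub_le (s : ℝ) :
    ‖Complex.exp (s * Complex.I) - 1 - s * Complex.I‖ ≤ 2 * s ^ 2 := by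
  have hn : ‖(s : ℂ) * Complex.I‖ = |s| := by simp
  rcases le_total |s| 1 with h | h
  · have := Complex.norm_exp_sub_one_sub_id_le (x := (s : ℂ) * Complex.I) (by rw [hn]; exact h)
    rw [hn, sq_abs] at this
    nlinarith [sq_nonneg s]
  · have h1 := norm_sub_le (Complex.exp (s * Complex.I) - 1) (s * Complex.I)
    rw [hn] at h1
    have h2 := norm_exp_I_sub_one_le s
    nlinarith [sq_abs s]

/-- First order comparison of the exponential statistics of two ordered Hermitian matrices. -/
lemma norm_sum_exp_sub_le_step {A B : Matrix ι ι ℂ} (hA : A.IsHermitian) (hB : B.IsHermitian)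
    (hAB : (A - B).PosSemidef) (t : ℝ) :
    ‖∑ i, Complex.exp (t * hA.eigenvalues i * Complex.I) -
      ∑ i, Complex.exp (t * hB.eigenvalues i * Complex.I)‖ ≤
      |t| * (A - B).trace.re + 2 * t ^ 2 * frobSq (A - B) := by
  obtain ⟨w, V, hw, hr, hc, hF, hV, hd⟩ := exists_overlap hA hB
  set a := hA.eigenvalues
  set b := hB.eigenvalues
  -- Expansion to first order around `b j`. For fixed `j` the linear terms in `i` are summed before
  -- taking absolute values: only their sum is a diagonal entry of `Vᴴ * (A - B) * V`.
  have h1 : ∑ i, Complex.exp (t * a i * Complex.I) - ∑ i, Complex.exp (t * b i * Complex.I) =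
      ∑ j, Complex.exp (t * b j * Complex.I) * (t * Complex.I) *
        ((∑ i, w i j * (a i - b j) : ℝ) : ℂ) +
      ∑ i, ∑ j, (w i j : ℂ) * (Complex.exp (t * b j * Complex.I) *
        (Complex.exp ((t * (a i - b j) : ℝ) * Complex.I) - 1 -
          (t * (a i - b j) : ℝ) * Complex.I)) := by
    have e1 : ∑ i, Complex.exp (t * a i * Complex.I) =
        ∑ j, ∑ i, (w i j : ℂ) * Complex.exp (t * a i * Complex.I) := by
      rw [Finset.sum_comm]
      refine Finset.sum_congr rfl fun i _ => ?_
      rw [← Finset.sum_mul, ← Complex.ofReal_sum, hr, Complex.ofReal_one, one_mul]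
    have e2 : ∑ j, Complex.exp (t * b j * Complex.I) =
        ∑ j, ∑ i, (w i j : ℂ) * Complex.exp (t * b j * Complex.I) := by
      refine Finset.sum_congr rfl fun i _ => ?_
      rw [← Finset.sum_mul, ← Complex.ofReal_sum, hc, Complex.ofReal_one, one_mul]
    rw [e1, e2, Finset.sum_comm (f := fun i j => (w i j : ℂ) * (Complex.exp (t * b j * Complex.I) *
        (Complex.exp ((t * (a i - b j) : ℝ) * Complex.I) - 1 -
          (t * (a i - b j) : ℝ) * Complex.I))), ← Finset.sum_sub_distrib, ← Finset.sum_add_distrib]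
    refine Finset.sum_congr rfl fun j _ => ?_
    rw [← Finset.sum_sub_distrib, Complex.ofReal_sum, Finset.mul_sum, ← Finset.sum_add_distrib]
    refine Finset.sum_congr rfl fun i _ => ?_
    have e3 : Complex.exp (t * a i * Complex.I) = Complex.exp (t * b j * Complex.I) *
        Complex.exp ((t * (a i - b j) : ℝ) * Complex.I) := by
      rw [← Complex.exp_add]; congr 1; push_cast; ring
    rw [e3]; push_cast; ring
  have hnorm : ∀ x : ℝ, ‖Complex.exp (t * x * Complex.I)‖ = 1 := fun x => by
    rw [← Complex.ofReal_mul, Complex.norm_exp_ofReal_mul_I]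
  -- Positivity makes the first-order coefficients nonnegative, so their absolute values add up to
  -- the trace exactly.
  have hpos : ∀ j, (0 : ℂ) ≤ (Vᴴ * (A - B) * V) j j := fun j =>
    (hAB.conjTranspose_mul_mul_same V).diag_nonneg
  have htr : (∑ j, ∑ i, w i j * (a i - b j) : ℝ) = (A - B).trace.re := by
    have : ((∑ j, ∑ i, w i j * (a i - b j) : ℝ) : ℂ) = (A - B).trace := by
      rw [Complex.ofReal_sum]
      calc ∑ j, ((∑ i, w i j * (a i - b j) : ℝ) : ℂ) = (Vᴴ * (A - B) * V).trace :=
            Finset.sum_congr rfl fun j _ => hd j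
        _ = _ := by rw [Matrix.mul_assoc, trace_mul_comm, Matrix.mul_assoc, hV, Matrix.mul_one]
    rw [← this, Complex.ofReal_re]
  have hS : ∀ j, 0 ≤ ∑ i, w i j * (a i - b j) := fun j => by
    have := hpos j
    rw [← hd j] at this
    exact_mod_cast this
  rw [h1]
  refine (norm_add_le _ _).trans (add_le_add ?_ ?_)
  · refine (norm_sum_le _ _).trans ?_
    rw [← htr, Finset.mul_sum]
    refine Finset.sum_le_sum fun j _ => ?_
    rw [norm_mul, norm_mul, hnorm, one_mul, norm_mul, Complex.norm_I, mul_one, Complex.norm_real,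
      Complex.norm_real, Real.norm_eq_abs, Real.norm_eq_abs, abs_of_nonneg (hS j)]
  · rw [← hF, Finset.mul_sum]
    refine (norm_sum_le _ _).trans (Finset.sum_le_sum fun i _ => ?_)
    rw [Finset.mul_sum]
    refine (norm_sum_le _ _).trans (Finset.sum_le_sum fun j _ => ?_)
    rw [norm_mul, norm_mul, hnorm, one_mul, Complex.norm_real, Real.norm_eq_abs,
      abs_of_nonneg (hw i j)]
    have := mul_le_mul_of_nonneg_left (norm_exp_I_sub_sub_le (t * (a i - b j))) (hw i j)
    linarith [this, mul_pow t (a i - b j) 2]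

/-- Adding a positive semidefinite matrix changes exponential statistics by at most its trace. -/
theorem norm_sum_exp_sub_le {A B : Matrix ι ι ℂ} (hA : A.IsHermitian) (hB : B.IsHermitian)
    (hAB : (A - B).PosSemidef) (t : ℝ) :
    ‖∑ i, Complex.exp (t * hA.eigenvalues i * Complex.I) -
      ∑ i, Complex.exp (t * hB.eigenvalues i * Complex.I)‖ ≤ |t| * (A - B).trace.re := by
  set P := A - B with hP
  have hH : ∀ s : ℝ, (B + (s : ℂ) • P).IsHermitian := fun s => by
    refine hB.add ?_
    unfold Matrix.IsHermitian
    rw [conjTranspose_smul, hAB.isHermitian.eq, Complex.star_def, Complex.conj_ofReal]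
  -- Interpolation along `B + s P`. A step of length `1/K` costs `|t| tr P / K` plus an error of
  -- order `1/K²`; over `K` steps the errors total order `1/K` and vanish. No differentiability of
  -- eigenvalues is used.
  let F : ℝ → ℂ := fun s => ∑ i, Complex.exp (t * (hH s).eigenvalues i * Complex.I)
  have hstep : ∀ s u : ℝ, 0 ≤ u →
      ‖F (s + u) - F s‖ ≤ |t| * P.trace.re * u + 2 * t ^ 2 * frobSq P * u ^ 2 := by
    intro s u hu
    have hd : B + ((s + u : ℝ) : ℂ) • P - (B + (s : ℂ) • P) = (u : ℂ) • P := by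
      push_cast; rw [add_smul]; abel
    have := norm_sum_exp_sub_le_step (hH (s + u)) (hH s)
      (by rw [hd]; exact hAB.smul (by exact_mod_cast hu)) t
    rw [hd] at this
    refine this.trans (le_of_eq ?_)
    have e1 : ((u : ℂ) • P).trace.re = P.trace.re * u := by
      rw [trace_smul, smul_eq_mul, Complex.re_ofReal_mul, mul_comm]
    have e2 : frobSq ((u : ℂ) • P) = frobSq P * u ^ 2 := by
      simp only [frobSq, Matrix.smul_apply, smul_eq_mul, norm_mul, mul_pow, Complex.norm_real,
        Real.norm_eq_abs, sq_abs, Finset.sum_mul]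
      exact Finset.sum_congr rfl fun i _ => Finset.sum_congr rfl fun j _ => mul_comm _ _
    rw [e1, e2]; ring
  have hK : ∀ K : ℕ, 0 < K →
      ‖F 1 - F 0‖ ≤ |t| * P.trace.re + 2 * t ^ 2 * frobSq P * (1 / (K : ℝ)) := by
    intro K hK
    have hK' : (K : ℝ) ≠ 0 := by positivity
    have ht : F 1 - F 0 = ∑ k ∈ Finset.range K,
        (F ((k : ℝ) / K + 1 / K) - F ((k : ℝ) / K)) := by
      have := Finset.sum_range_sub (fun k : ℕ => F ((k : ℝ) / K)) K
      simp only [Nat.cast_add, Nat.cast_one, Nat.cast_zero, zero_div, div_self hK'] at this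
      rw [← this]
      exact Finset.sum_congr rfl fun k _ => by rw [add_div]
    rw [ht]
    refine (norm_sum_le _ _).trans ((Finset.sum_le_sum fun k _ =>
      hstep ((k : ℕ) / (K : ℝ)) (1 / K) (by positivity)).trans (le_of_eq ?_))
    rw [Finset.sum_const, Finset.card_range, nsmul_eq_mul]
    field_simp
  have hlim : Tendsto (fun K : ℕ => |t| * P.trace.re + 2 * t ^ 2 * frobSq P * (1 / (K : ℝ)))
      atTop (𝓝 (|t| * P.trace.re + 2 * t ^ 2 * frobSq P * 0)) :=
    (tendsto_one_div_atTop_nhds_zero_nat.const_mul _).const_add _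
  have hfin := ge_of_tendsto hlim ((eventually_gt_atTop 0).mono hK)
  have h1 : F 1 = ∑ i, Complex.exp (t * hA.eigenvalues i * Complex.I) := by
    have : B + ((1 : ℝ) : ℂ) • P = A := by rw [hP]; simp
    simp only [F]
    congr! 6
  have h0 : F 0 = ∑ i, Complex.exp (t * hB.eigenvalues i * Complex.I) := by
    have : B + ((0 : ℝ) : ℂ) • P = B := by simp
    simp only [F]
    congr! 6
  rw [← h1, ← h0]
  simpa using hfin

/-- Power sums of the eigenvalues are traces of powers. -/
theorem sum_eigenvalues_pow {A : Matrix ι ι ℂ} (hA : A.IsHermitian) (p : ℕ) :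
    ((∑ i, hA.eigenvalues i ^ p : ℝ) : ℂ) = (A ^ p).trace := by
  obtain ⟨U, hU1, hU2, h⟩ := hA.exists_unitary_diagonal
  have hp : A ^ p = U * diagonal (fun i => (hA.eigenvalues i : ℂ) ^ p) * Uᴴ := by
    induction p with
    | zero => simp [hU1]
    | succ p ih =>
      calc A ^ (p + 1) = A ^ p * A := pow_succ _ _
        _ = U * diagonal (fun i => (hA.eigenvalues i : ℂ) ^ p) * Uᴴ *
            (U * diagonal (fun i => (hA.eigenvalues i : ℂ)) * Uᴴ) := by rw [ih, ← h]
        _ = U * (diagonal (fun i => (hA.eigenvalues i : ℂ) ^ p) * (Uᴴ * U) *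
            diagonal (fun i => (hA.eigenvalues i : ℂ))) * Uᴴ := by simp only [Matrix.mul_assoc]
        _ = _ := by rw [hU2, Matrix.mul_one, diagonal_mul_diagonal]; simp only [pow_succ]
  rw [hp, Matrix.mul_assoc, trace_mul_comm, Matrix.mul_assoc, hU2, Matrix.mul_one, trace_diagonal]
  push_cast; rfl

end Spectral

end FoldVandermonde
end

noncomputable section

namespace FoldVandermonde

open Matrix

/-! ### The Gram matrix, its spectral statistics and the mean spectral measure -/

section Gram

variable {d m : ℕ}

/-- The character `x ↦ exp(-2πi cᵀ x)`. -/
def phase (c : Fin d → ℤ) (x : Fin d → ℝ) : ℂ :=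
  Complex.exp (((-2 * Real.pi * ∑ j, (c j : ℝ) * x j : ℝ) : ℂ) * Complex.I)

lemma norm_phase (c : Fin d → ℤ) (x : Fin d → ℝ) : ‖phase c x‖ = 1 :=
  Complex.norm_exp_ofReal_mul_I _

lemma phase_zero (x : Fin d → ℝ) : phase 0 x = 1 := by simp [phase]

lemma phase_add (c c' : Fin d → ℤ) (x : Fin d → ℝ) :
    phase (c + c') x = phase c x * phase c' x := by
  rw [phase, phase, phase, ← Complex.exp_add]
  congr 1
  simp only [Pi.add_apply, Int.cast_add, add_mul, Finset.sum_add_distrib]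
  push_cast; ring

lemma phase_sum {κ : Type*} (s : Finset κ) (c : κ → Fin d → ℤ) (x : Fin d → ℝ) :
    phase (∑ i ∈ s, c i) x = ∏ i ∈ s, phase (c i) x := by
  classical
  induction s using Finset.induction_on with
  | empty => simp [phase_zero]
  | insert a s ha ih => rw [Finset.sum_insert ha, phase_add, ih, Finset.prod_insert ha]

lemma star_phase (c : Fin d → ℤ) (x : Fin d → ℝ) : star (phase c x) = phase (-c) x := by
  rw [phase, phase, Complex.star_def, ← Complex.exp_conj, map_mul, Complex.conj_ofReal,
    Complex.conj_I]
  congr 1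
  simp

@[fun_prop]
lemma continuous_phase (c : Fin d → ℤ) : Continuous (phase c) := by
  unfold phase; fun_prop

/-- The multi-index of a row as an integer vector. -/
def rowIndex {n : ℕ} (ℓ : Fin d → Fin n) : Fin d → ℤ := fun i => ((ℓ i : ℕ) : ℤ)

/-- The Gram matrix `V Vᴴ`. -/
def gram (n : ℕ) (x : Fin m → Fin d → ℝ) : Matrix (Fin d → Fin n) (Fin d → Fin n) ℂ :=
  vandermonde n x * (vandermonde n x)ᴴ

lemma vandermonde_apply (n : ℕ) (x : Fin m → Fin d → ℝ) (ℓ : Fin d → Fin n) (q : Fin m) :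
    vandermonde n x ℓ q = (((Real.sqrt m)⁻¹ : ℝ) : ℂ) * phase (rowIndex ℓ) (x q) := by
  simp only [vandermonde, of_apply, phase, rowIndex]
  congr 2
  push_cast; ring

/-- The contribution of one sampling point to the Gram matrix. -/
def rankOne (n m : ℕ) (y : Fin d → ℝ) : Matrix (Fin d → Fin n) (Fin d → Fin n) ℂ :=
  Matrix.of fun ℓ ℓ' => (m : ℂ)⁻¹ * phase (rowIndex ℓ - rowIndex ℓ') y

/-- Separates the dependence on the individual points. Both the replacement argument and the moment
expansion start from this decomposition. -/
lemma gram_eq_sum (n : ℕ) (x : Fin m → Fin d → ℝ) : gram n x = ∑ q, rankOne n m (x q) := by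
  ext ℓ ℓ'
  rw [gram, mul_apply, Matrix.sum_apply]
  refine Finset.sum_congr rfl fun q _ => ?_
  rw [conjTranspose_apply, vandermonde_apply, vandermonde_apply, rankOne, of_apply, star_mul',
    star_phase, sub_eq_add_neg, phase_add]
  have : ((((Real.sqrt m)⁻¹ : ℝ) : ℂ)) * star ((((Real.sqrt m)⁻¹ : ℝ) : ℂ)) = (m : ℂ)⁻¹ := by
    rw [Complex.star_def, Complex.conj_ofReal, ← Complex.ofReal_mul, ← mul_inv,
      Real.mul_self_sqrt (Nat.cast_nonneg m)]
    push_cast; rfl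
  rw [← this]; ring

open scoped ComplexOrder in
lemma rankOne_posSemidef (n m : ℕ) (y : Fin d → ℝ) : (rankOne n m y).PosSemidef := by
  have : rankOne n m y = ((m : ℂ)⁻¹) •
      vecMulVec (fun ℓ : Fin d → Fin n => phase (rowIndex ℓ) y)
        (star fun ℓ : Fin d → Fin n => phase (rowIndex ℓ) y) := by
    ext ℓ ℓ'
    rw [rankOne, of_apply, Matrix.smul_apply, vecMulVec_apply, Pi.star_apply, star_phase, smul_eq_mul,
      sub_eq_add_neg, phase_add]
  rw [this]
  exact (posSemidef_vecMulVec_self_star _).smul (by positivity)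

lemma rankOne_trace (n m : ℕ) (y : Fin d → ℝ) :
    (rankOne n m y).trace.re = (n : ℝ) ^ d / m := by
  have : (rankOne n m y).trace = (((n : ℝ) ^ d / m : ℝ) : ℂ) := by
    simp [Matrix.trace, rankOne, phase_zero, div_eq_mul_inv]
  rw [this, Complex.ofReal_re]

lemma gram_isHermitian (n : ℕ) (x : Fin m → Fin d → ℝ) : (gram n x).IsHermitian :=
  isHermitian_mul_conjTranspose_self _

lemma gramEigenvalues_eq (n : ℕ) (x : Fin m → Fin d → ℝ) :
    gramEigenvalues n x = (gram_isHermitian n x).eigenvalues := rfl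

open scoped ComplexOrder in
lemma gramEigenvalues_nonneg (n : ℕ) (x : Fin m → Fin d → ℝ) (ℓ : Fin d → Fin n) :
    0 ≤ gramEigenvalues n x ℓ :=
  (posSemidef_self_mul_conjTranspose (vandermonde n x)).eigenvalues_nonneg ℓ

/-- Every diagonal entry of the Gram matrix is 1, so the eigenvalues average to one. This first
moment is all that tightness will need. -/
lemma sum_gramEigenvalues (hm : 0 < m) (n : ℕ) (x : Fin m → Fin d → ℝ) :
    ∑ ℓ, gramEigenvalues n x ℓ = (n : ℝ) ^ d := by
  have h := sum_eigenvalues_pow (gram_isHermitian n x) 1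
  simp only [pow_one] at h
  have hm' : (m : ℂ) ≠ 0 := by exact_mod_cast hm.ne'
  have h2 : (gram n x).trace = (((n : ℝ) ^ d : ℝ) : ℂ) := by
    rw [gram_eq_sum, trace_sum]
    simp [Matrix.trace, rankOne, phase_zero]
    field_simp
  rw [h2] at h
  exact_mod_cast h

lemma gramEigenvalues_le (hm : 0 < m) (n : ℕ) (x : Fin m → Fin d → ℝ) (ℓ : Fin d → Fin n) :
    gramEigenvalues n x ℓ ≤ (n : ℝ) ^ d := by
  rw [← sum_gramEigenvalues hm n x]
  exact Finset.single_le_sum (fun i _ => gramEigenvalues_nonneg n x i) (Finset.mem_univ ℓ)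

lemma continuous_gram (n : ℕ) : Continuous fun x : Fin m → Fin d → ℝ => gram n x := by
  simp_rw [gram_eq_sum]
  refine continuous_finsetSum _ fun q _ => ?_
  refine continuous_matrix fun i j => ?_
  simp only [rankOne, of_apply]
  fun_prop

/-- Lipschitz linear spectral statistics depend continuously on the sampling points. -/
lemma continuous_sum_gramEigenvalues (n : ℕ) (g : ℝ → ℝ) (L : ℝ) (hL : 0 ≤ L)
    (hg : ∀ a b, |g a - g b| ≤ L * |a - b|) :
    Continuous fun x : Fin m → Fin d → ℝ => ∑ ℓ, g (gramEigenvalues n x ℓ) := by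
  rw [continuous_iff_continuousAt]
  intro y
  rw [ContinuousAt, tendsto_iff_norm_sub_tendsto_zero]
  have hF : Continuous fun x : Fin m → Fin d → ℝ =>
      L * Real.sqrt (Fintype.card (Fin d → Fin n)) * Real.sqrt (frobSq (gram n x - gram n y)) := by
    have := continuous_gram (d := d) (m := m) n
    unfold frobSq
    have h2 : ∀ i j, Continuous fun x : Fin m → Fin d → ℝ => (gram n x - gram n y) i j :=
      fun i j => ((this.sub continuous_const).matrix_elem i j)
    fun_prop
  refine squeeze_zero (fun _ => norm_nonneg _) (fun x => ?_) (hF.tendsto' y 0 ?_)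
  · exact norm_sum_eigenvalues_sub_le (gram_isHermitian n x) (gram_isHermitian n y) g L hL hg
  · simp [frobSq]

/-- Individual eigenvalues need not be shown measurable: the indicator is the pointwise limit of
ramps falling from 1 at `z` to 0 at `z + 1/k`, and statistics of Lipschitz functions are continuous
in the points. -/
lemma measurable_sum_indicator (n : ℕ) (z : ℝ) :
    Measurable fun x : Fin m → Fin d → ℝ =>
      ∑ ℓ, (Set.Iic z).indicator (fun _ => (1 : ℝ)) (gramEigenvalues n x ℓ) := by
  let g : ℕ → ℝ → ℝ := fun k a => max (min 1 (1 - k * (a - z))) 0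
  refine measurable_of_tendsto_metrizable
    (f := fun (k : ℕ) (x : Fin m → Fin d → ℝ) => ∑ ℓ, g k (gramEigenvalues n x ℓ))
    (fun k => (continuous_sum_gramEigenvalues n (g k) k (Nat.cast_nonneg k) ?_).measurable) ?_
  · intro a b
    calc |g k a - g k b| ≤ |min 1 (1 - k * (a - z)) - min 1 (1 - k * (b - z))| :=
          abs_max_sub_max_le_abs _ _ _
      _ ≤ |(1 - k * (a - z)) - (1 - k * (b - z))| := by
          have := abs_min_sub_min_le_max (1 : ℝ) (1 - k * (a - z)) 1 (1 - k * (b - z))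
          simpa using this
      _ = k * |a - b| := by
          rw [show (1 - k * (a - z)) - (1 - k * (b - z)) = k * (b - a) by ring, abs_mul,
            abs_of_nonneg (Nat.cast_nonneg k), abs_sub_comm]
  · rw [tendsto_pi_nhds]
    intro x
    refine tendsto_finsetSum _ fun ℓ _ => ?_
    set a := gramEigenvalues n x ℓ
    by_cases ha : a ≤ z
    · rw [Set.indicator_of_mem (Set.mem_Iic.2 ha)]
      refine tendsto_const_nhds.congr fun k => ?_
      have : (0 : ℝ) ≤ k * (z - a) := mul_nonneg (Nat.cast_nonneg k) (by linarith)
      simp only [g]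
      rw [min_eq_left (by linarith), max_eq_left zero_le_one]
    · rw [Set.indicator_of_notMem (by simpa using ha)]
      push Not at ha
      obtain ⟨K, hK⟩ := exists_nat_gt (1 / (a - z))
      refine tendsto_const_nhds.congr' ?_
      filter_upwards [eventually_ge_atTop K] with k hk
      have h1 : 1 / (a - z) < k := hK.trans_le (by exact_mod_cast hk)
      rw [div_lt_iff₀ (by linarith)] at h1
      simp only [g]
      rw [max_eq_right]
      exact (min_le_right _ _).trans (by linarith)

/-- The empirical mean of `exp(i t λ)` over the eigenvalues of the Gram matrix. -/
def expStat (n : ℕ) (t : ℝ) (x : Fin m → Fin d → ℝ) : ℂ :=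
  ((n : ℂ) ^ d)⁻¹ * ∑ ℓ, Complex.exp (t * gramEigenvalues n x ℓ * Complex.I)

lemma continuous_expStat (n : ℕ) (t : ℝ) :
    Continuous (expStat n t : (Fin m → Fin d → ℝ) → ℂ) := by
  have h : (expStat n t : (Fin m → Fin d → ℝ) → ℂ) = fun x => ((n : ℂ) ^ d)⁻¹ *
      (((∑ ℓ, Real.cos (t * gramEigenvalues n x ℓ) : ℝ) : ℂ) +
        ((∑ ℓ, Real.sin (t * gramEigenvalues n x ℓ) : ℝ) : ℂ) * Complex.I) := by
    funext x
    rw [expStat]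
    congr 1
    push_cast
    rw [Finset.sum_mul, ← Finset.sum_add_distrib]
    exact Finset.sum_congr rfl fun ℓ _ => Complex.exp_mul_I _
  rw [h]
  have hc := continuous_sum_gramEigenvalues (d := d) (m := m) n (fun a => Real.cos (t * a)) |t|
    (abs_nonneg t) fun a b => by
      rw [← abs_mul, mul_sub]; simpa using Real.abs_cos_sub_cos_le (t * a) (t * b)
  have hs := continuous_sum_gramEigenvalues (d := d) (m := m) n (fun a => Real.sin (t * a)) |t|
    (abs_nonneg t) fun a b => by
      rw [← abs_mul, mul_sub]; simpa using Real.abs_sin_sub_sin_le (t * a) (t * b)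
  exact continuous_const.mul ((Complex.continuous_ofReal.comp hc).add
    ((Complex.continuous_ofReal.comp hs).mul continuous_const))

lemma norm_expStat_le (n : ℕ) (t : ℝ) (x : Fin m → Fin d → ℝ) : ‖expStat n t x‖ ≤ 1 := by
  rw [expStat, norm_mul, norm_inv, norm_pow, Complex.norm_natCast]
  have h : ‖∑ ℓ, Complex.exp (t * gramEigenvalues n x ℓ * Complex.I)‖ ≤ (n : ℝ) ^ d := by
    refine (norm_sum_le _ _).trans (le_of_eq ?_)
    rw [Finset.sum_congr rfl (g := fun _ => (1 : ℝ)) fun ℓ _ => by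
      rw [← Complex.ofReal_mul, Complex.norm_exp_ofReal_mul_I]]
    simp
  exact inv_mul_le_one_of_le₀ h (by positivity)

/-- Follows from `|exp(is) - 1| ≤ |s|`, nonnegativity of the eigenvalues and their mean being one.
It yields continuity at the origin of the limiting characteristic function. -/
lemma norm_expStat_sub_one_le {n : ℕ} (hn : 0 < n) (hm : 0 < m) (t : ℝ)
    (x : Fin m → Fin d → ℝ) : ‖expStat n t x - 1‖ ≤ |t| := by
  have hN : (0 : ℝ) < (n : ℝ) ^ d := by positivity
  have h1 : expStat n t x - 1 = ((n : ℂ) ^ d)⁻¹ *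
      ∑ ℓ, (Complex.exp ((t * gramEigenvalues n x ℓ : ℝ) * Complex.I) - 1) := by
    have hN' : (n : ℂ) ^ d ≠ 0 := by exact_mod_cast hN.ne'
    rw [expStat, Finset.sum_sub_distrib, mul_sub]
    congr 1
    · simp
    · simp [hN']
  rw [h1, norm_mul, norm_inv, norm_pow, Complex.norm_natCast, inv_mul_le_iff₀ hN]
  refine (norm_sum_le _ _).trans ((Finset.sum_le_sum fun ℓ _ => norm_exp_I_sub_one_le _).trans ?_)
  rw [← sum_gramEigenvalues hm n x, mul_comm, Finset.mul_sum]
  refine Finset.sum_le_sum fun ℓ _ => ?_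
  rw [abs_mul, abs_of_nonneg (gramEigenvalues_nonneg n x ℓ)]

/-- The empirical spectral distribution of the Gram matrix. -/
def esd (n : ℕ) (x : Fin m → Fin d → ℝ) : Measure ℝ :=
  ((n : ENNReal) ^ d)⁻¹ • ∑ ℓ, Measure.dirac (gramEigenvalues n x ℓ)

lemma esd_Iic (n : ℕ) (x : Fin m → Fin d → ℝ) (z : ℝ) :
    esd n x (Set.Iic z) = ((n : ENNReal) ^ d)⁻¹ *
      ENNReal.ofReal (∑ ℓ, (Set.Iic z).indicator (fun _ => (1 : ℝ)) (gramEigenvalues n x ℓ)) := by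
  rw [esd, Measure.smul_apply, smul_eq_mul, Measure.finsetSum_apply,
    ENNReal.ofReal_sum_of_nonneg fun ℓ _ => Set.indicator_nonneg (fun _ _ => zero_le_one) _]
  congr 1
  refine Finset.sum_congr rfl fun ℓ _ => ?_
  rw [Measure.dirac_apply' _ measurableSet_Iic]
  by_cases h : gramEigenvalues n x ℓ ∈ Set.Iic z <;> simp [h]

lemma isProbabilityMeasure_esd {n : ℕ} (hn : 0 < n) (x : Fin m → Fin d → ℝ) :
    IsProbabilityMeasure (esd n x) := by
  constructor
  have h0 : (n : ENNReal) ^ d ≠ 0 := pow_ne_zero _ (by exact_mod_cast hn.ne')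
  have ht : (n : ENNReal) ^ d ≠ ⊤ := ENNReal.pow_ne_top (ENNReal.natCast_ne_top n)
  rw [esd, Measure.smul_apply, smul_eq_mul, Measure.finsetSum_apply]
  simp [ENNReal.inv_mul_cancel h0 ht]

lemma measurable_esd {n : ℕ} (hn : 0 < n) :
    Measurable (esd n : (Fin m → Fin d → ℝ) → Measure ℝ) := by
  have := fun x : Fin m → Fin d → ℝ => isProbabilityMeasure_esd hn x
  refine .measure_of_isPiSystem_of_isProbabilityMeasure (borel_eq_generateFrom_Iic ℝ)
    isPiSystem_Iic ?_
  rintro _ ⟨z, rfl⟩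
  simp_rw [esd_Iic]
  exact ((measurable_sum_indicator n z).ennreal_ofReal).const_mul _

/-- The mean empirical spectral distribution when the sampling points have joint law `P`. -/
def meanMeasure (n : ℕ) (P : Measure (Fin m → Fin d → ℝ)) : Measure ℝ := P.bind (esd n)

lemma isProbabilityMeasure_meanMeasure {n : ℕ} (hn : 0 < n) (P : Measure (Fin m → Fin d → ℝ))
    [IsProbabilityMeasure P] : IsProbabilityMeasure (meanMeasure n P) := by
  have := fun x : Fin m → Fin d → ℝ => isProbabilityMeasure_esd hn x
  constructor
  rw [meanMeasure, Measure.bind_apply MeasurableSet.univ (measurable_esd hn).aemeasurable]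
  simp

lemma meanMeasure_real_Iic {n : ℕ} (hn : 0 < n) (P : Measure (Fin m → Fin d → ℝ))
    [IsProbabilityMeasure P] (z : ℝ) :
    (meanMeasure n P).real (Set.Iic z) = ∫ x, ((n : ℝ) ^ d)⁻¹ *
      ∑ ℓ, (Set.Iic z).indicator (fun _ => (1 : ℝ)) (gramEigenvalues n x ℓ) ∂P := by
  rw [Measure.real, meanMeasure,
    Measure.bind_apply measurableSet_Iic (measurable_esd hn).aemeasurable,
    integral_eq_lintegral_of_nonneg_ae]
  · congr 1
    refine lintegral_congr fun x => ?_
    rw [esd_Iic, ENNReal.ofReal_mul (by positivity),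
      ENNReal.ofReal_inv_of_pos (by positivity), ENNReal.ofReal_pow (by positivity),
      ENNReal.ofReal_natCast]
  · exact ae_of_all _ fun x => mul_nonneg (by positivity)
      (Finset.sum_nonneg fun ℓ _ => Set.indicator_nonneg (fun _ _ => zero_le_one) _)
  · exact ((measurable_sum_indicator n z).const_mul _).aestronglyMeasurable

lemma charFun_esd {n : ℕ} (t : ℝ) (x : Fin m → Fin d → ℝ) :
    charFun (esd n x) t = expStat n t x := by
  rw [charFun_apply_real, esd, integral_smul_measure, integral_finsetSum_measure]
  · simp only [integral_dirac, expStat]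
    simp [Complex.real_smul]
  · exact fun ℓ _ => integrable_dirac (by simp)

lemma charFun_meanMeasure {n : ℕ} (hn : 0 < n) (P : Measure (Fin m → Fin d → ℝ))
    [IsProbabilityMeasure P] (t : ℝ) :
    charFun (meanMeasure n P) t = ∫ x, expStat n t x ∂P := by
  let κ : Kernel (Fin m → Fin d → ℝ) ℝ := ⟨esd n, measurable_esd hn⟩
  have h : meanMeasure n P = (κ ∘ₖ Kernel.const Unit P) () := by
    rw [Kernel.comp_apply]; rfl
  have := isProbabilityMeasure_meanMeasure hn P
  rw [charFun_apply_real, h, Kernel.integral_comp]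
  · simp only [Kernel.const_apply]
    refine integral_congr_ae (ae_of_all _ fun x => ?_)
    have := charFun_esd (n := n) t x
    rw [charFun_apply_real] at this
    exact this
  · rw [← h]
    refine Integrable.of_bound (C := 1) (by fun_prop) (ae_of_all _ fun y => ?_)
    rw [← Complex.ofReal_mul, Complex.norm_exp_ofReal_mul_I]

end Gram

end FoldVandermonde
end

noncomputable section

namespace FoldVandermonde

open Matrix

/-! ### Replacing the law of independent coordinates one at a time -/

section Replacement

variable {X : Type*} [MeasurableSpace X]

/-- Lindeberg-type replacement: if resampling any single coordinate changes the expectation by at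
most `ε`, then changing the law of all `m` coordinates changes it by at most `m ε`. -/
theorem norm_integral_pi_sub_le (μ ν : Measure X) [IsProbabilityMeasure μ]
    [IsProbabilityMeasure ν] {ε : ℝ} (m : ℕ) (φ : (Fin m → X) → ℂ) (hφ : StronglyMeasurable φ)
    (hb : ∀ x, ‖φ x‖ ≤ 1)
    (hε : ∀ (q : Fin m) (y : Fin m → X), ‖∫ x, φ (Function.update y q x) ∂μ -
      ∫ x, φ (Function.update y q x) ∂ν‖ ≤ ε) :
    ‖∫ x, φ x ∂(Measure.pi fun _ : Fin m => μ) - ∫ x, φ x ∂(Measure.pi fun _ : Fin m => ν)‖ ≤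
      m * ε := by
  induction m with
  | zero => simp [Measure.pi_of_empty (fun _ : Fin 0 => μ), Measure.pi_of_empty (fun _ : Fin 0 => ν)]
  | succ m ih =>
    let Φ : X × (Fin m → X) → ℂ := fun z => φ (Fin.cons z.1 z.2)
    have hcons : Measurable fun z : X × (Fin m → X) => (Fin.cons z.1 z.2 : Fin (m + 1) → X) := by
      refine measurable_pi_iff.2 fun i => ?_
      refine Fin.cases ?_ (fun j => ?_) i
      · simpa using measurable_fst
      · simpa using measurable_pi_iff.1 measurable_snd j
    have hΦ : StronglyMeasurable Φ := hφ.comp_measurable hcons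
    have hΦb : ∀ z, ‖Φ z‖ ≤ 1 := fun z => hb _
    have hsplit : ∀ (ρ : Measure X) [IsProbabilityMeasure ρ],
        ∫ x, φ x ∂(Measure.pi fun _ : Fin (m + 1) => ρ) =
          ∫ y, ∫ x, Φ (x, y) ∂ρ ∂(Measure.pi fun _ : Fin m => ρ) := by
      intro ρ _
      have hp := (measurePreserving_piFinSuccAbove (fun _ : Fin (m + 1) => ρ) 0).symm
      rw [← hp.integral_comp', ← integral_prod_symm _ (Integrable.of_bound
        hΦ.aestronglyMeasurable 1 (ae_of_all _ hΦb))]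
      refine integral_congr_ae (ae_of_all _ fun z => ?_)
      simp [Φ, MeasurableEquiv.piFinSuccAbove]
      rfl
    rw [hsplit μ, hsplit ν]
    -- Integrating out coordinate 0 under `ν` gives the hybrid: first the law of coordinate 0 is
    -- changed while the others stay under `μ`, then the induction hypothesis applied to `ψ` changes
    -- the rest.
    let ψ : (Fin m → X) → ℂ := fun y => ∫ x, Φ (x, y) ∂ν
    have hψ : StronglyMeasurable ψ :=
      (hΦ.comp_measurable measurable_swap).integral_prod_right (f := fun y x => Φ (x, y))
    have hψb : ∀ y, ‖ψ y‖ ≤ 1 := fun y => by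
      have := norm_integral_le_of_norm_le_const (μ := ν) (f := fun x => Φ (x, y)) (C := 1)
        (ae_of_all _ fun x => hΦb (x, y))
      simpa using this
    have hψμ : StronglyMeasurable fun y => ∫ x, Φ (x, y) ∂μ :=
      (hΦ.comp_measurable measurable_swap).integral_prod_right (f := fun y x => Φ (x, y))
    have hψμb : ∀ y, ‖∫ x, Φ (x, y) ∂μ‖ ≤ 1 := fun y => by
      have := norm_integral_le_of_norm_le_const (μ := μ) (f := fun x => Φ (x, y)) (C := 1)
        (ae_of_all _ fun x => hΦb (x, y))
      simpa using this
    have h1 : ‖∫ y, ∫ x, Φ (x, y) ∂μ ∂(Measure.pi fun _ : Fin m => μ) -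
        ∫ y, ψ y ∂(Measure.pi fun _ : Fin m => μ)‖ ≤ ε := by
      rw [← integral_sub (Integrable.of_bound hψμ.aestronglyMeasurable 1 (ae_of_all _ hψμb))
        (Integrable.of_bound hψ.aestronglyMeasurable 1 (ae_of_all _ hψb))]
      have := norm_integral_le_of_norm_le_const (μ := Measure.pi fun _ : Fin m => μ)
        (f := fun y => ∫ x, Φ (x, y) ∂μ - ψ y) (C := ε) (ae_of_all _ fun y => ?_)
      · simpa using this
      · obtain ⟨x0⟩ : Nonempty X := nonempty_of_isProbabilityMeasure μ
        have := hε 0 (Fin.cons x0 y)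
        simpa only [Fin.update_cons_zero] using this
    have h2 := ih ψ hψ hψb fun q y => by
      have hF : ∀ ρ : Measure X, IsProbabilityMeasure ρ → ∫ x', ψ (Function.update y q x') ∂ρ =
          ∫ x, ∫ x', φ (Function.update (Fin.cons x y : Fin (m + 1) → X) q.succ x') ∂ρ ∂ν := by
        intro ρ _
        simp only [ψ, Φ]
        rw [integral_integral_swap]
        · simp only [Fin.cons_update]
        · refine Integrable.of_bound (C := 1) (StronglyMeasurable.aestronglyMeasurable ?_)
            (ae_of_all _ fun z => hb _)
          refine hφ.comp_measurable (hcons.comp (measurable_snd.prodMk ?_))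
          exact (measurable_update y (a := q)).comp measurable_fst
      rw [hF μ inferInstance, hF ν inferInstance]
      have hm : ∀ ρ : Measure X, IsProbabilityMeasure ρ → Integrable (fun x =>
          ∫ x', φ (Function.update (Fin.cons x y : Fin (m + 1) → X) q.succ x') ∂ρ) ν := by
        intro ρ _
        refine Integrable.of_bound (C := 1) (StronglyMeasurable.aestronglyMeasurable ?_)
          (ae_of_all _ fun x => ?_)
        · refine StronglyMeasurable.integral_prod_right (f := fun x x' =>
            φ (Function.update (Fin.cons x y : Fin (m + 1) → X) q.succ x')) ?_
          simp only [← Fin.cons_update]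
          refine hφ.comp_measurable (hcons.comp (measurable_fst.prodMk ?_))
          exact (measurable_update y (a := q)).comp measurable_snd
        · have := norm_integral_le_of_norm_le_const (μ := ρ) (C := 1)
            (f := fun x' => φ (Function.update (Fin.cons x y : Fin (m + 1) → X) q.succ x'))
            (ae_of_all _ fun x => hb _)
          simpa using this
      rw [← integral_sub (hm μ inferInstance) (hm ν inferInstance)]
      have := norm_integral_le_of_norm_le_const (μ := ν) (C := ε)
        (f := fun x => ∫ x', φ (Function.update (Fin.cons x y : Fin (m + 1) → X) q.succ x') ∂μ -
          ∫ x', φ (Function.update (Fin.cons x y : Fin (m + 1) → X) q.succ x') ∂ν)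
        (ae_of_all _ fun x => hε q.succ _)
      simpa using this
    calc _ ≤ ‖∫ y, ∫ x, Φ (x, y) ∂μ ∂(Measure.pi fun _ : Fin m => μ) -
          ∫ y, ψ y ∂(Measure.pi fun _ : Fin m => μ)‖ +
          ‖∫ y, ψ y ∂(Measure.pi fun _ : Fin m => μ) -
          ∫ y, ψ y ∂(Measure.pi fun _ : Fin m => ν)‖ := norm_sub_le_norm_sub_add_norm_sub _ _ _
      _ ≤ ε + m * ε := add_le_add h1 h2
      _ = _ := by push_cast; ring

end Replacement

/-! ### Dependence of the mean spectral measure on the density -/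

section Density

variable {d : ℕ}

lemma measurableSet_cube (d : ℕ) : MeasurableSet (cube d) :=
  MeasurableSet.univ_pi fun _ => measurableSet_Ico

lemma volume_cube (d : ℕ) : volume (cube d) = 1 := by
  rw [cube, Real.volume_pi_Ico]
  norm_num

instance isProbabilityMeasure_restrict_cube (d : ℕ) :
    IsProbabilityMeasure ((volume : Measure (Fin d → ℝ)).restrict (cube d)) :=
  ⟨by rw [Measure.restrict_apply_univ, volume_cube]⟩

lemma IsPhaseDensity.isProbabilityMeasure_pointLaw {f : (Fin d → ℝ) → ℝ}
    (hf : IsPhaseDensity d f) : IsProbabilityMeasure (pointLaw d f) :=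
  ⟨by rw [pointLaw, withDensity_apply _ MeasurableSet.univ, Measure.restrict_univ]
      exact hf.lintegral_eq_one⟩

lemma IsPhaseDensity.isProbabilityMeasure_sampleLaw {f : (Fin d → ℝ) → ℝ}
    (hf : IsPhaseDensity d f) (m : ℕ) : IsProbabilityMeasure (sampleLaw d f m) := by
  have := hf.isProbabilityMeasure_pointLaw
  unfold sampleLaw; infer_instance

lemma IsPhaseDensity.ae_nonneg {f : (Fin d → ℝ) → ℝ} (hf : IsPhaseDensity d f) :
    0 ≤ᵐ[volume.restrict (cube d)] f :=
  (ae_restrict_iff' (measurableSet_cube d)).2 (ae_of_all _ hf.nonneg)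

lemma IsPhaseDensity.integrable {f : (Fin d → ℝ) → ℝ} (hf : IsPhaseDensity d f) :
    Integrable f (volume.restrict (cube d)) := by
  refine ⟨hf.measurable.aestronglyMeasurable, ?_⟩
  rw [hasFiniteIntegral_iff_ofReal hf.ae_nonneg, hf.lintegral_eq_one]
  exact ENNReal.one_lt_top

lemma IsPhaseDensity.integral_eq_one {f : (Fin d → ℝ) → ℝ} (hf : IsPhaseDensity d f) :
    ∫ z in cube d, f z = 1 := by
  rw [integral_eq_lintegral_of_nonneg_ae hf.ae_nonneg hf.measurable.aestronglyMeasurable,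
    hf.lintegral_eq_one, ENNReal.toReal_one]

lemma integral_pointLaw {f : (Fin d → ℝ) → ℝ} (hf : IsPhaseDensity d f)
    (h : (Fin d → ℝ) → ℂ) : ∫ x, h x ∂(pointLaw d f) = ∫ x in cube d, (f x : ℂ) * h x := by
  rw [pointLaw, integral_withDensity_eq_integral_toReal_smul hf.measurable.ennreal_ofReal
    (ae_of_all _ fun _ => ENNReal.ofReal_lt_top)]
  refine integral_congr_ae ?_
  filter_upwards [hf.ae_nonneg] with x hx
  rw [ENNReal.toReal_ofReal hx, Complex.real_smul]

/-- The integrals of a function of small oscillation against two nearby densities are close. -/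
lemma norm_integral_pointLaw_sub_le {f g : (Fin d → ℝ) → ℝ} (hf : IsPhaseDensity d f)
    (hg : IsPhaseDensity d g) (h : (Fin d → ℝ) → ℂ) (hm : Measurable h) (c : ℂ) (δ : ℝ)
    (hδ : ∀ x, ‖h x - c‖ ≤ δ) :
    ‖∫ x, h x ∂(pointLaw d f) - ∫ x, h x ∂(pointLaw d g)‖ ≤ δ * ∫ x in cube d, |f x - g x| := by
  have hif : Integrable (fun x => (f x : ℂ)) (volume.restrict (cube d)) := hf.integrable.ofReal
  have hig : Integrable (fun x => (g x : ℂ)) (volume.restrict (cube d)) := hg.integrable.ofReal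
  have hbd : ∀ x, ‖h x‖ ≤ ‖c‖ + δ := fun x => by
    have := norm_add_le c (h x - c)
    rw [add_sub_cancel] at this
    linarith [hδ x]
  have hfh : Integrable (fun x => (f x : ℂ) * h x) (volume.restrict (cube d)) :=
    hif.mul_bdd hm.aestronglyMeasurable (ae_of_all _ hbd)
  have hgh : Integrable (fun x => (g x : ℂ) * h x) (volume.restrict (cube d)) :=
    hig.mul_bdd hm.aestronglyMeasurable (ae_of_all _ hbd)
  have h1 : ∫ x in cube d, (f x : ℂ) = 1 := by
    rw [integral_complex_ofReal, hf.integral_eq_one, Complex.ofReal_one]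
  have h2 : ∫ x in cube d, (g x : ℂ) = 1 := by
    rw [integral_complex_ofReal, hg.integral_eq_one, Complex.ofReal_one]
  -- Both densities have total mass one, so constants integrate to the same value and `c` can be
  -- subtracted from `h` at no cost.
  have key : ∫ x, h x ∂(pointLaw d f) - ∫ x, h x ∂(pointLaw d g) =
      ∫ x in cube d, ((f x - g x : ℝ) : ℂ) * (h x - c) := by
    have e : ∀ x, ((f x - g x : ℝ) : ℂ) * (h x - c) =
        ((f x : ℂ) * h x - (g x : ℂ) * h x) - ((f x : ℂ) - (g x : ℂ)) * c := fun x => by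
      push_cast; ring
    simp_rw [e]
    have h3 := integral_sub (hfh.sub hgh) ((hif.sub hig).mul_const c)
    simp only [Pi.sub_apply] at h3
    rw [h3, integral_sub hfh hgh, integral_mul_const, integral_sub hif hig, h1, h2,
      integral_pointLaw hf, integral_pointLaw hg]
    simp
  rw [key, ← integral_const_mul]
  refine norm_integral_le_of_norm_le ((hf.integrable.sub hg.integrable).abs.const_mul δ)
    (ae_of_all _ fun x => ?_)
  rw [norm_mul, Complex.norm_real, Real.norm_eq_abs, mul_comm]
  exact mul_le_mul_of_nonneg_right (hδ x) (abs_nonneg _)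

-- The centre is the statistic of the Gram matrix without the contribution of point `q`. Restoring
-- that point adds a positive semidefinite matrix of trace `n^d/m`, and the normalisation `n^{-d}`
-- leaves `1/m`.
open scoped ComplexOrder in
lemma norm_expStat_update_sub_le {n m : ℕ} (hn : 0 < n) (t : ℝ) (q : Fin m)
    (y : Fin m → Fin d → ℝ) : ∃ c : ℂ, ∀ x : Fin d → ℝ,
      ‖expStat n t (Function.update y q x) - c‖ ≤ |t| / m := by
  let C : Matrix (Fin d → Fin n) (Fin d → Fin n) ℂ :=
    ∑ i ∈ Finset.univ.erase q, rankOne n m (y i)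
  have hC : C.IsHermitian := by
    refine isSelfAdjoint_sum _ fun i _ => ?_
    exact (rankOne_posSemidef n m (y i)).isHermitian
  refine ⟨((n : ℂ) ^ d)⁻¹ * ∑ i, Complex.exp (t * hC.eigenvalues i * Complex.I), fun x => ?_⟩
  have hN : (0 : ℝ) < (n : ℝ) ^ d := by positivity
  have hg : gram n (Function.update y q x) - C = rankOne n m x := by
    rw [gram_eq_sum, ← Finset.add_sum_erase _ _ (Finset.mem_univ q), Function.update_self,
      add_sub_assoc]
    have : ∑ i ∈ Finset.univ.erase q, rankOne n m (Function.update y q x i) = C :=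
      Finset.sum_congr rfl fun i hi => by rw [Function.update_of_ne (Finset.ne_of_mem_erase hi)]
    rw [this, sub_self, add_zero]
  have := norm_sum_exp_sub_le (gram_isHermitian n (Function.update y q x)) hC
    (by rw [hg]; exact rankOne_posSemidef n m x) t
  rw [hg, rankOne_trace] at this
  rw [expStat, ← mul_sub, norm_mul, norm_inv, norm_pow, Complex.norm_natCast, inv_mul_le_iff₀ hN]
  refine this.trans (le_of_eq ?_)
  ring

/-- The characteristic function of the mean spectral measure is Lipschitz in the density for the
`L¹` distance, uniformly in the size of the matrix. -/
theorem norm_charFun_meanMeasure_sub_le {f g : (Fin d → ℝ) → ℝ} (hf : IsPhaseDensity d f)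
    (hg : IsPhaseDensity d g) {n m : ℕ} (hn : 0 < n) (hm : 0 < m) (t : ℝ) :
    ‖charFun (meanMeasure n (sampleLaw d f m)) t - charFun (meanMeasure n (sampleLaw d g m)) t‖ ≤
      |t| * ∫ x in cube d, |f x - g x| := by
  have := hf.isProbabilityMeasure_sampleLaw m
  have := hg.isProbabilityMeasure_sampleLaw m
  have := hf.isProbabilityMeasure_pointLaw
  have := hg.isProbabilityMeasure_pointLaw
  rw [charFun_meanMeasure hn, charFun_meanMeasure hn]
  refine (norm_integral_pi_sub_le (pointLaw d f) (pointLaw d g)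
    (ε := |t| / m * ∫ x in cube d, |f x - g x|) m (expStat n t)
    (continuous_expStat n t).stronglyMeasurable (norm_expStat_le n t) fun q y => ?_).trans
    (le_of_eq ?_)
  · obtain ⟨c, hc⟩ := norm_expStat_update_sub_le (d := d) hn t q y
    refine norm_integral_pointLaw_sub_le hf hg _ ?_ c _ hc
    exact (continuous_expStat n t).measurable.comp (measurable_update y)
  · have : (m : ℝ) ≠ 0 := by positivity
    field_simp

lemma meanESD_eq {f : (Fin d → ℝ) → ℝ} (hf : IsPhaseDensity d f) {n m : ℕ} (hn : 0 < n) (z : ℝ) :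
    meanESD d f n m z = (meanMeasure n (sampleLaw d f m)).real (Set.Iic z) := by
  have := hf.isProbabilityMeasure_sampleLaw m
  rw [meanMeasure_real_Iic hn, meanESD]

end Density

end FoldVandermonde
end

noncomputable section

namespace FoldVandermonde

/-! ### Trigonometric densities and their `L¹` density -/

section Trigonometric

variable {d : ℕ}

lemma phase_eq_prod (c : Fin d → ℤ) (x : Fin d → ℝ) :
    phase c x = ∏ j, Complex.exp (((-2 * Real.pi * (c j) : ℝ) : ℂ) * Complex.I * (x j : ℂ)) := by
  rw [phase, ← Complex.exp_sum]
  congr 1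
  push_cast
  rw [Finset.mul_sum, Finset.sum_mul]
  exact Finset.sum_congr rfl fun j _ => by ring

lemma integral_exp_Ico (k : ℤ) :
    ∫ y in Set.Ico (-(1 / 2 : ℝ)) (1 / 2),
      Complex.exp (((-2 * Real.pi * k : ℝ) : ℂ) * Complex.I * (y : ℂ)) = if k = 0 then 1 else 0 := by
  rw [integral_Ico_eq_integral_Ioc, ← intervalIntegral.integral_of_le (by norm_num)]
  split_ifs with hk
  · subst hk; norm_num
  · have hc : ((-2 * Real.pi * k : ℝ) : ℂ) * Complex.I ≠ 0 := by
      refine mul_ne_zero ?_ Complex.I_ne_zero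
      have : (-2 * Real.pi * k : ℝ) ≠ 0 := by
        refine mul_ne_zero (mul_ne_zero (by norm_num) Real.pi_ne_zero) (by exact_mod_cast hk)
      exact_mod_cast this
    rw [integral_exp_mul_complex hc]
    have : Complex.exp (((-2 * Real.pi * k : ℝ) : ℂ) * Complex.I * ((1 / 2 : ℝ) : ℂ)) =
        Complex.exp (((-2 * Real.pi * k : ℝ) : ℂ) * Complex.I * ((-(1 / 2) : ℝ) : ℂ)) := by
      rw [Complex.exp_eq_exp_iff_exists_int]
      refine ⟨-k, ?_⟩
      push_cast; ring
    rw [this, sub_self, zero_div]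

lemma integral_phase (c : Fin d → ℤ) :
    ∫ x in cube d, phase c x = if c = 0 then 1 else 0 := by
  have h1 : (volume : Measure (Fin d → ℝ)).restrict (cube d) =
      Measure.pi fun _ => (volume : Measure ℝ).restrict (Set.Ico (-(1 / 2 : ℝ)) (1 / 2)) := by
    rw [volume_pi, cube, Measure.restrict_pi_pi]
  simp_rw [phase_eq_prod]
  rw [h1, integral_fintype_prod_eq_prod (f := fun j (y : ℝ) =>
    Complex.exp (((-2 * Real.pi * (c j) : ℝ) : ℂ) * Complex.I * (y : ℂ)))]
  simp_rw [integral_exp_Ico]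
  split_ifs with hc
  · subst hc; simp
  · obtain ⟨j, hj⟩ := Function.ne_iff.1 hc
    exact Finset.prod_eq_zero (Finset.mem_univ j) (if_neg hj)

lemma integrable_phase (c : Fin d → ℤ) : Integrable (phase c) (volume.restrict (cube d)) :=
  Integrable.of_bound (continuous_phase c).aestronglyMeasurable 1
    (ae_of_all _ fun x => (norm_phase c x).le)

/-- A probability density on the cube which is a trigonometric polynomial, with frequencies in `S`
and coefficients `a`. -/
structure IsTrigDensity (d : ℕ) (g : (Fin d → ℝ) → ℝ) (S : Finset (Fin d → ℤ))
    (a : (Fin d → ℤ) → ℂ) : Prop where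
  density : IsPhaseDensity d g
  expansion : ∀ x, (g x : ℂ) = ∑ c ∈ S, a c * phase (-c) x
  support : ∀ c, c ∉ S → a c = 0

/-- By orthogonality of characters. The expansion uses `phase (-c)` precisely so that `a c` is the
expectation of the character with frequency `c`. -/
lemma IsTrigDensity.integral_phase_pointLaw {g : (Fin d → ℝ) → ℝ} {S : Finset (Fin d → ℤ)}
    {a : (Fin d → ℤ) → ℂ} (hg : IsTrigDensity d g S a) (c : Fin d → ℤ) :
    ∫ x, phase c x ∂(pointLaw d g) = a c := by
  rw [integral_pointLaw hg.density]
  have : ∀ x, (g x : ℂ) * phase c x = ∑ c' ∈ S, a c' * phase (c - c') x := fun x => by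
    rw [hg.expansion, Finset.sum_mul]
    exact Finset.sum_congr rfl fun c' _ => by rw [sub_eq_neg_add, phase_add, mul_assoc]
  simp_rw [this]
  rw [integral_finsetSum _ fun c' _ => (integrable_phase _).const_mul _]
  simp_rw [integral_const_mul, integral_phase, sub_eq_zero]
  simp only [mul_ite, mul_one, mul_zero, Finset.sum_ite_eq]
  split_ifs with h
  · rfl
  · exact (hg.support c h).symm

lemma IsTrigDensity.coeff_zero {g : (Fin d → ℝ) → ℝ} {S : Finset (Fin d → ℤ)}
    {a : (Fin d → ℤ) → ℂ} (hg : IsTrigDensity d g S a) : a 0 = 1 := by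
  have := hg.density.isProbabilityMeasure_pointLaw
  rw [← hg.integral_phase_pointLaw]
  simp [phase_zero]

lemma IsTrigDensity.norm_coeff_le {g : (Fin d → ℝ) → ℝ} {S : Finset (Fin d → ℤ)}
    {a : (Fin d → ℤ) → ℂ} (hg : IsTrigDensity d g S a) (c : Fin d → ℤ) : ‖a c‖ ≤ 1 := by
  have := hg.density.isProbabilityMeasure_pointLaw
  rw [← hg.integral_phase_pointLaw]
  have := norm_integral_le_of_norm_le_const (μ := pointLaw d g) (f := phase c) (C := 1)
    (ae_of_all _ fun x => (norm_phase c x).le)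
  simpa using this

/-- The normalised squared modulus of a trigonometric polynomial is a trigonometric density. -/
lemma exists_isTrigDensity_normSq (s : Finset (Fin d → ℤ)) (b : (Fin d → ℤ) → ℂ)
    (hZ : 0 < ∫ x in cube d, ‖∑ c ∈ s, b c * phase c x‖ ^ 2) :
    ∃ S a, IsTrigDensity d (fun x => ‖∑ c ∈ s, b c * phase c x‖ ^ 2 /
      ∫ x in cube d, ‖∑ c ∈ s, b c * phase c x‖ ^ 2) S a := by
  classical
  set Z := ∫ x in cube d, ‖∑ c ∈ s, b c * phase c x‖ ^ 2 with hZdef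
  have hcont : Continuous fun x : Fin d → ℝ => ‖∑ c ∈ s, b c * phase c x‖ ^ 2 / Z := by fun_prop
  have hint : Integrable (fun x => ‖∑ c ∈ s, b c * phase c x‖ ^ 2 / Z)
      (volume.restrict (cube d)) := by
    refine Integrable.of_bound hcont.aestronglyMeasurable ((∑ c ∈ s, ‖b c‖) ^ 2 / Z)
      (ae_of_all _ fun x => ?_)
    rw [Real.norm_of_nonneg (by positivity)]
    gcongr
    refine (norm_sum_le _ _).trans (Finset.sum_le_sum fun c _ => ?_)
    rw [norm_mul, norm_phase, mul_one]
  let S : Finset (Fin d → ℤ) := (s ×ˢ s).image fun p => p.2 - p.1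
  -- The product of term `p.1` with the conjugate of term `p.2` has phase `p.1 - p.2`. Terms are
  -- gathered by the opposite difference because expansions are in `phase (-k)`.
  let a : (Fin d → ℤ) → ℂ := fun k =>
    ∑ p ∈ (s ×ˢ s) with p.2 - p.1 = k, b p.1 * star (b p.2) / (Z : ℂ)
  refine ⟨S, a, ⟨hcont.measurable, fun z _ => by positivity, ?_⟩, fun x => ?_, fun c hc => ?_⟩
  · rw [← ofReal_integral_eq_lintegral_ofReal hint (ae_of_all _ fun x => by positivity),
      integral_div, ← hZdef, div_self hZ.ne', ENNReal.ofReal_one]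
  · have h1 : ((‖∑ c ∈ s, b c * phase c x‖ ^ 2 / Z : ℝ) : ℂ) =
        ∑ p ∈ s ×ˢ s, b p.1 * star (b p.2) / (Z : ℂ) * phase (-(p.2 - p.1)) x := by
      rw [Complex.ofReal_div, ← Complex.normSq_eq_norm_sq, ← Complex.mul_conj, map_sum,
        Finset.sum_mul_sum, ← Finset.sum_product', Finset.sum_div]
      refine Finset.sum_congr rfl fun p _ => ?_
      rw [map_mul, ← Complex.star_def, star_phase, neg_sub, sub_eq_add_neg, phase_add]
      ring
    rw [h1, ← Finset.sum_fiberwise_of_maps_to (t := S) (g := fun p => p.2 - p.1)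
      fun p hp => Finset.mem_image_of_mem _ hp]
    refine Finset.sum_congr rfl fun k _ => ?_
    rw [Finset.sum_mul]
    refine Finset.sum_congr rfl fun p hp => ?_
    rw [(Finset.mem_filter.1 hp).2]
  · refine Finset.sum_eq_zero fun p hp => absurd ?_ hc
    rw [Finset.mem_filter] at hp
    exact Finset.mem_image.2 ⟨p, hp.1, hp.2⟩

/-- Trigonometric polynomials are dense in `L²` of the cube. -/
lemma exists_trig_sq_sub_le {u : (Fin d → ℝ) → ℝ} (hu : MemLp u 2 (volume.restrict (cube d)))
    (hum : Measurable u) {ε : ℝ} (hε : 0 < ε) : ∃ (s : Finset (Fin d → ℤ)) (b : (Fin d → ℤ) → ℂ),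
      ∫ x in cube d, ‖(u x : ℂ) - ∑ c ∈ s, b c * phase c x‖ ^ 2 ≤ ε ^ 2 := by
  let π : (Fin d → ℝ) → UnitAddTorus (Fin d) := fun x i => (x i : UnitAddCircle)
  have hπc : Continuous π := continuous_pi fun i =>
    (AddCircle.continuous_mk' 1).comp (continuous_apply i)
  -- A measurable section of the projection onto the torus, identifying functions on the cube with
  -- functions on the torus, where Fourier density is available.
  let σ : UnitAddTorus (Fin d) → (Fin d → ℝ) :=
    fun y i => (AddCircle.measurableEquivIco 1 (-(1 / 2 : ℝ)) (y i) : ℝ)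
  have hσ : Measurable σ := measurable_pi_iff.2 fun i =>
    measurable_subtype_coe.comp ((AddCircle.measurableEquivIco 1 (-(1 / 2 : ℝ))).measurable.comp
      (measurable_pi_apply i))
  have hσπ : ∀ x ∈ cube d, σ (π x) = x := by
    intro x hx
    funext i
    have hxi : x i ∈ Set.Ico (-(1 / 2 : ℝ)) (-(1 / 2) + 1) := by
      have := hx i (Set.mem_univ i)
      norm_num at this ⊢
      exact this
    exact AddCircle.equivIco_coe_of_mem hxi
  let ρ : Measure (UnitAddTorus (Fin d)) := (volume.restrict (cube d)).map π
  have : IsProbabilityMeasure ρ := Measure.isProbabilityMeasure_map hπc.aemeasurable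
  let F : UnitAddTorus (Fin d) → ℂ := fun y => (u (σ y) : ℂ)
  have hFm : Measurable F := Complex.measurable_ofReal.comp (hum.comp hσ)
  have hFπ : (fun x => F (π x)) =ᵐ[volume.restrict (cube d)] fun x => (u x : ℂ) := by
    filter_upwards [ae_restrict_mem (measurableSet_cube d)] with x hx
    simp only [F, hσπ x hx]
  have hF : MemLp F 2 ρ := by
    rw [memLp_map_measure_iff hFm.aestronglyMeasurable hπc.aemeasurable]
    exact (memLp_congr_ae hFπ).2 hu.ofReal
  have hF2 : MemLp F (ENNReal.ofReal 2) ρ := by simpa using hF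
  -- Two approximations: `F` by a continuous function within `ε / 2` in `L²`, then that function
  -- uniformly within `ε / 2` by a trigonometric polynomial. By `(x + y)² ≤ 2x² + 2y²` the total
  -- squared error is at most `ε²`.
  obtain ⟨g, hg, hgL⟩ := hF2.exists_boundedContinuous_integral_rpow_sub_le (by norm_num)
    (ε := (ε / 2) ^ 2) (by positivity)
  have hdense : (⟨g, g.continuous⟩ : C(UnitAddTorus (Fin d), ℂ)) ∈
      (Submodule.span ℂ (Set.range (UnitAddTorus.mFourier (d := Fin d)))).topologicalClosure := by
    rw [UnitAddTorus.span_mFourier_closure_eq_top]; trivial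
  obtain ⟨P, hP, hPd⟩ := Metric.mem_closure_iff.1 hdense (ε / 2) (by positivity)
  obtain ⟨b, rfl⟩ := Finsupp.mem_span_range_iff_exists_finsupp.1 hP
  have hfour : ∀ (c : Fin d → ℤ) (x : Fin d → ℝ), UnitAddTorus.mFourier c (π x) = phase (-c) x := by
    intro c x
    rw [phase_eq_prod]
    simp only [UnitAddTorus.mFourier, ContinuousMap.coe_mk, π]
    refine Finset.prod_congr rfl fun i _ => ?_
    rw [fourier_coe_apply]
    congr 1
    push_cast [Pi.neg_apply]; ring
  have hPπ : ∀ x, (b.sum fun i r => r • UnitAddTorus.mFourier i) (π x) =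
      ∑ c ∈ b.support.map (Equiv.neg (Fin d → ℤ)).toEmbedding, b (-c) * phase c x := by
    intro x
    rw [Finset.sum_map, Finsupp.sum, ContinuousMap.sum_apply]
    refine Finset.sum_congr rfl fun c _ => ?_
    rw [ContinuousMap.smul_apply, smul_eq_mul, hfour]
    simp
  refine ⟨b.support.map (Equiv.neg (Fin d → ℤ)).toEmbedding, fun c => b (-c), ?_⟩
  simp_rw [← hPπ]
  set P := b.sum fun i r => r • UnitAddTorus.mFourier i
  have hPg : ∀ y, ‖g y - P y‖ ≤ ε / 2 := fun y => by
    have := (ContinuousMap.dist_apply_le_dist (f := (⟨g, g.continuous⟩ : C(UnitAddTorus (Fin d), ℂ)))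
      (g := P) y).trans hPd.le
    rwa [dist_eq_norm] at this
  have hgi : Integrable (fun y => ‖F y - g y‖ ^ 2) ρ := by
    have hgL' : MemLp g 2 ρ := by simpa using hgL
    exact (memLp_two_iff_integrable_sq_norm (hF.1.sub hgL'.1)).1 (hF.sub hgL')
  have hg' : ∫ y, ‖F y - g y‖ ^ 2 ∂ρ ≤ (ε / 2) ^ 2 := by
    simpa using hg
  have hle : ∀ y, ‖F y - P y‖ ^ 2 ≤ 2 * ‖F y - g y‖ ^ 2 + 2 * (ε / 2) ^ 2 := fun y => by
    have h1 : ‖F y - P y‖ ≤ ‖F y - g y‖ + ε / 2 := by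
      refine (norm_sub_le_norm_sub_add_norm_sub (F y) (g y) (P y)).trans ?_
      linarith [hPg y]
    calc ‖F y - P y‖ ^ 2 ≤ (‖F y - g y‖ + ε / 2) ^ 2 := by gcongr
      _ ≤ _ := by nlinarith [sq_nonneg (‖F y - g y‖ - ε / 2)]
  calc ∫ x in cube d, ‖(u x : ℂ) - P (π x)‖ ^ 2
      = ∫ x in cube d, ‖F (π x) - P (π x)‖ ^ 2 := by
        refine integral_congr_ae ?_
        filter_upwards [hFπ] with x hx
        rw [hx]
    _ = ∫ y, ‖F y - P y‖ ^ 2 ∂ρ := by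
        refine (integral_map (f := fun y => ‖F y - P y‖ ^ 2) hπc.aemeasurable ?_).symm
        exact ((hFm.sub P.continuous.measurable).norm.pow_const 2).aestronglyMeasurable
    _ ≤ ∫ y, (2 * ‖F y - g y‖ ^ 2 + 2 * (ε / 2) ^ 2) ∂ρ := by
        refine integral_mono_of_nonneg (ae_of_all _ fun y => by positivity)
          ((hgi.const_mul 2).add (integrable_const _)) (ae_of_all _ hle)
    _ ≤ ε ^ 2 := by
        rw [integral_add (hgi.const_mul 2) (integrable_const _), integral_const_mul]
        simp only [integral_const, probReal_univ, one_smul]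
        nlinarith

/-- Trigonometric densities are dense among all densities for the `L¹` distance. -/
theorem exists_isTrigDensity_near {f : (Fin d → ℝ) → ℝ} (hf : IsPhaseDensity d f) {ε : ℝ}
    (hε : 0 < ε) : ∃ g S a, IsTrigDensity d g S a ∧ ∫ x in cube d, |f x - g x| ≤ ε := by
  -- The squared approximant costs `3δ` in `L¹` and its normalisation another `3δ`. The bound `δ ≤ 1
  -- / 6` keeps the normalising constant at least 1/2.
  obtain ⟨δ, hδ, hδ1, hδε⟩ : ∃ δ : ℝ, 0 < δ ∧ δ ≤ 1 / 6 ∧ 6 * δ ≤ ε :=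
    ⟨min (1 / 6) (ε / 6), by positivity, min_le_left _ _, by
      linarith [min_le_right (1 / 6) (ε / 6)]⟩
  -- Approximating the square root in `L²` and then squaring the modulus keeps the approximant
  -- nonnegative.
  let u : (Fin d → ℝ) → ℝ := fun x => Real.sqrt (f x)
  have hum : Measurable u := hf.measurable.sqrt
  have hu2 : ∀ᵐ x ∂(volume.restrict (cube d)), u x ^ 2 = f x := by
    filter_upwards [hf.ae_nonneg] with x hx
    exact Real.sq_sqrt hx
  have hui : Integrable (fun x => u x ^ 2) (volume.restrict (cube d)) :=
    hf.integrable.congr (hu2.mono fun x hx => hx.symm)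
  have hu : MemLp u 2 (volume.restrict (cube d)) :=
    (memLp_two_iff_integrable_sq hum.aestronglyMeasurable).2 hui
  obtain ⟨s, b, hsb⟩ := exists_trig_sq_sub_le hu hum hδ
  set h : (Fin d → ℝ) → ℂ := fun x => ∑ c ∈ s, b c * phase c x with hh
  have hhc : Continuous h := by fun_prop
  have hhb : ∀ x, ‖h x‖ ≤ ∑ c ∈ s, ‖b c‖ := fun x => by
    refine (norm_sum_le _ _).trans (Finset.sum_le_sum fun c _ => ?_)
    rw [norm_mul, norm_phase, mul_one]
  have hh2 : MemLp h 2 (volume.restrict (cube d)) :=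
    MemLp.of_bound hhc.aestronglyMeasurable _ (ae_of_all _ hhb)
  have hhi : Integrable (fun x => ‖h x‖ ^ 2) (volume.restrict (cube d)) :=
    (memLp_two_iff_integrable_sq_norm hh2.1).1 hh2
  have huC : MemLp (fun x => (u x : ℂ)) 2 (volume.restrict (cube d)) := hu.ofReal
  have hwi : Integrable (fun x => ‖(u x : ℂ) - h x‖ ^ 2) (volume.restrict (cube d)) :=
    (memLp_two_iff_integrable_sq_norm (huC.1.sub hh2.1)).1 (huC.sub hh2)
  have hpt : ∀ᵐ x ∂(volume.restrict (cube d)), |f x - ‖h x‖ ^ 2| ≤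
      δ * f x + (1 / δ + 1) * ‖(u x : ℂ) - h x‖ ^ 2 := by
    filter_upwards [hu2] with x hx
    have hu0 : 0 ≤ u x := Real.sqrt_nonneg _
    set w := ‖(u x : ℂ) - h x‖
    have hw : |u x - ‖h x‖| ≤ w := by
      have := abs_norm_sub_norm_le (u x : ℂ) (h x)
      rwa [Complex.norm_real, Real.norm_of_nonneg hu0] at this
    have hw0 : 0 ≤ w := norm_nonneg _
    have h1 : |u x + ‖h x‖| ≤ 2 * u x + w := by
      rw [abs_of_nonneg (by positivity)]
      linarith [(abs_le.1 hw).1]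
    rw [← hx, sq_sub_sq, abs_mul]
    -- Weighted arithmetic-geometric inequality: the first term integrates to `δ`, and the second is
    -- affordable because `w` has squared `L²` norm at most `δ²`.
    have h2 : 2 * u x * w ≤ δ * u x ^ 2 + 1 / δ * w ^ 2 := by
      have e : δ * u x ^ 2 + 1 / δ * w ^ 2 - 2 * u x * w = 1 / δ * (δ * u x - w) ^ 2 := by
        field_simp; ring
      have : 0 ≤ 1 / δ * (δ * u x - w) ^ 2 := by positivity
      linarith
    calc |u x + ‖h x‖| * |u x - ‖h x‖| ≤ (2 * u x + w) * w :=
          mul_le_mul h1 hw (abs_nonneg _) (by positivity)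
      _ ≤ _ := by linarith
  have hbase : ∫ x in cube d, |f x - ‖h x‖ ^ 2| ≤ 3 * δ := by
    calc ∫ x in cube d, |f x - ‖h x‖ ^ 2|
        ≤ ∫ x in cube d, (δ * f x + (1 / δ + 1) * ‖(u x : ℂ) - h x‖ ^ 2) :=
          integral_mono_ae (hf.integrable.sub hhi).abs
            ((hf.integrable.const_mul δ).add (hwi.const_mul _)) hpt
      _ = δ + (1 / δ + 1) * ∫ x in cube d, ‖(u x : ℂ) - h x‖ ^ 2 := by
          rw [integral_add (hf.integrable.const_mul δ) (hwi.const_mul _), integral_const_mul,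
            integral_const_mul, hf.integral_eq_one, mul_one]
      _ ≤ δ + (1 / δ + 1) * δ ^ 2 := by gcongr
      _ ≤ 3 * δ := by
          have : (1 / δ + 1) * δ ^ 2 = δ + δ ^ 2 := by field_simp
          rw [this]; nlinarith
  set Z := ∫ x in cube d, ‖h x‖ ^ 2 with hZ
  have hZ1 : |1 - Z| ≤ 3 * δ := by
    refine le_trans ?_ hbase
    rw [hZ, ← hf.integral_eq_one, ← integral_sub hf.integrable hhi]
    exact abs_integral_le_integral_abs
  have hZpos : 0 < Z := by
    have := (abs_le.1 hZ1).2
    linarith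
  obtain ⟨S, a, hS⟩ := exists_isTrigDensity_normSq s b hZpos
  refine ⟨_, S, a, hS, ?_⟩
  have hlast : ∫ x in cube d, |‖h x‖ ^ 2 - ‖h x‖ ^ 2 / Z| = |1 - Z| := by
    have e : ∀ x, |‖h x‖ ^ 2 - ‖h x‖ ^ 2 / Z| = ‖h x‖ ^ 2 * (|1 - Z| / Z) := fun x => by
      have : ‖h x‖ ^ 2 - ‖h x‖ ^ 2 / Z = ‖h x‖ ^ 2 * (-(1 - Z) / Z) := by field_simp; ring
      rw [this, abs_mul, abs_of_nonneg (by positivity), abs_div, abs_neg, abs_of_pos hZpos]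
    simp_rw [e]
    rw [integral_mul_const, ← hZ]
    field_simp
  calc ∫ x in cube d, |f x - ‖h x‖ ^ 2 / Z|
      ≤ ∫ x in cube d, (|f x - ‖h x‖ ^ 2| + |‖h x‖ ^ 2 - ‖h x‖ ^ 2 / Z|) :=
        integral_mono (hf.integrable.sub (hhi.div_const Z)).abs
          ((hf.integrable.sub hhi).abs.add (hhi.sub (hhi.div_const Z)).abs)
          fun x => abs_sub_le _ _ _
    _ = (∫ x in cube d, |f x - ‖h x‖ ^ 2|) + |1 - Z| := by
        rw [← hlast]
        exact integral_add (f := fun x => |f x - ‖h x‖ ^ 2|) (hf.integrable.sub hhi).abs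
          (hhi.sub (hhi.div_const Z)).abs
    _ ≤ ε := by linarith

end Trigonometric

end FoldVandermonde
end

noncomputable section

namespace FoldVandermonde

open Matrix

/-! ### Asymptotic count of lattice points with prescribed linear constraints -/

section LatticeCount

variable {κ : Type*} [Fintype κ] [DecidableEq κ]

/-- The number of lattice points `ℓ ∈ {0, …, n-1}^κ` with `(T ℓ)_b = c_b` outside of `Fr`. -/
def latticeCount (T : Matrix κ κ ℤ) (Fr : Finset κ) (n : ℕ) (c : κ → ℤ) : ℕ :=
  Fintype.card {ℓ : κ → Fin n // ∀ b, b ∉ Fr → (T *ᵥ fun i => ((ℓ i : ℕ) : ℤ)) b = c b}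

/-- Extension by zero of a vector indexed by `Fr`. -/
def extendZero (Fr : Finset κ) (w : Fr → ℝ) : κ → ℝ := fun j => if h : j ∈ Fr then w ⟨j, h⟩ else 0

/-- The open polytope of the free coordinates `w` for which `S w` has coordinates in `(0, 1)`. -/
def latticePolytope (S : Matrix κ κ ℤ) (Fr : Finset κ) : Set (Fr → ℝ) :=
  {w | ∀ i, (∑ j, (S i j : ℝ) * extendZero Fr w j) ∈ Set.Ioo (0 : ℝ) 1}

/-- A unimodular change of coordinates on `ℤ^κ`, which keeps the coordinates in `Fr` and maps the
all-ones vector to the indicator of `Fr`. -/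
structure IsCycleFrame (T S : Matrix κ κ ℤ) (Fr : Finset κ) : Prop where
  mul_inv : T * S = 1
  inv_mul : S * T = 1
  free_row : ∀ j ∈ Fr, ∀ x : κ → ℤ, (T *ᵥ x) j = x j
  ones : T *ᵥ 1 = fun j => if j ∈ Fr then 1 else 0

variable {T S : Matrix κ κ ℤ} {Fr : Finset κ}

lemma floor_fiber_eq {n : ℕ} (hn : 0 < n) (k : ℕ) :
    {y : ℝ | ⌊(n : ℝ) * y⌋ = (k : ℤ)} = Set.Ico ((k : ℝ) / n) ((k : ℝ) / n + 1 / n) := by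
  have hn' : (0 : ℝ) < n := by exact_mod_cast hn
  ext y
  rw [Set.mem_ofPred_eq, Int.floor_eq_iff, Set.mem_Ico, div_le_iff₀ hn', ← add_div, lt_div_iff₀ hn',
    mul_comm y]
  push_cast
  rfl

lemma IsCycleFrame.free_inv (h : IsCycleFrame T S Fr) {j : κ} (hj : j ∈ Fr) (x : κ → ℤ) :
    (S *ᵥ x) j = x j := by
  have := h.free_row j hj (S *ᵥ x)
  rw [mulVec_mulVec, h.mul_inv, one_mulVec] at this
  exact this.symm

lemma IsCycleFrame.inv_ones (h : IsCycleFrame T S Fr) :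
    S *ᵥ (fun j => if j ∈ Fr then 1 else 0) = 1 := by
  rw [← h.ones, mulVec_mulVec, h.inv_mul, one_mulVec]

/-- Free and prescribed coordinates together are `T ℓ`, which determines `ℓ` because `T` is
invertible. So the free coordinates alone determine the point. -/
lemma latticeCount_le (h : IsCycleFrame T S Fr) (n : ℕ) (c : κ → ℤ) :
    latticeCount T Fr n c ≤ n ^ Fr.card := by
  have : n ^ Fr.card = Fintype.card (Fr → Fin n) := by simp
  rw [this, latticeCount]
  refine Fintype.card_le_of_injective (fun ℓ j => ℓ.1 j) fun ℓ ℓ' hl => ?_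
  have hT : (T *ᵥ fun i => ((ℓ.1 i : ℕ) : ℤ)) = (T *ᵥ fun i => ((ℓ'.1 i : ℕ) : ℤ)) := by
    funext j
    by_cases hj : j ∈ Fr
    · rw [h.free_row j hj, h.free_row j hj]
      have := congrFun hl ⟨j, hj⟩
      simp only at this
      rw [this]
    · rw [ℓ.2 j hj, ℓ'.2 j hj]
  have hS := congrArg (S *ᵥ ·) hT
  simp only [mulVec_mulVec, h.inv_mul, one_mulVec] at hS
  refine Subtype.ext (funext fun i => Fin.ext ?_)
  exact_mod_cast congrFun hS i

/-- The integer vector with given free coordinates and prescribed bound coordinates. -/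
def joinCoords (Fr : Finset κ) (z : Fr → ℤ) (c : κ → ℤ) : κ → ℤ :=
  fun j => if h : j ∈ Fr then z ⟨j, h⟩ else c j

-- In the unimodular coordinates every integer choice of free coordinates gives exactly one integer
-- vector meeting the constraints. The remaining condition is that its image under `S` lies in the
-- box.
open Classical in
lemma latticeCount_eq_sum (h : IsCycleFrame T S Fr) (n : ℕ) (c : κ → ℤ) :
    (latticeCount T Fr n c : ℝ) = ∑ z : Fr → Fin n,
      if ∀ i, (S *ᵥ joinCoords Fr (fun j => ((z j : ℕ) : ℤ)) c) i ∈ Set.Ico (0 : ℤ) n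
      then 1 else 0 := by
  rw [Finset.sum_boole, latticeCount, Fintype.card_subtype]
  congr 1
  refine Finset.card_bij (fun ℓ _ j => ℓ j) ?_ ?_ ?_
  · intro ℓ hl
    simp only [Finset.mem_filter, Finset.mem_univ, true_and] at hl ⊢
    have : joinCoords Fr (fun j : Fr => ((ℓ j : ℕ) : ℤ)) c = T *ᵥ fun i => ((ℓ i : ℕ) : ℤ) := by
      funext j
      unfold joinCoords
      split_ifs with hj
      · rw [h.free_row j hj]
      · rw [hl j hj]
    rw [this, mulVec_mulVec, h.inv_mul, one_mulVec]
    exact fun i => ⟨by positivity, by exact_mod_cast (ℓ i).2⟩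
  · intro ℓ hl ℓ' hl' he
    simp only [Finset.mem_filter, Finset.mem_univ, true_and] at hl hl'
    have hT : (T *ᵥ fun i => ((ℓ i : ℕ) : ℤ)) = (T *ᵥ fun i => ((ℓ' i : ℕ) : ℤ)) := by
      funext j
      by_cases hj : j ∈ Fr
      · rw [h.free_row j hj, h.free_row j hj]
        have := congrFun he ⟨j, hj⟩
        simp only at this
        rw [this]
      · rw [hl j hj, hl' j hj]
    have hS := congrArg (S *ᵥ ·) hT
    simp only [mulVec_mulVec, h.inv_mul, one_mulVec] at hS
    refine funext fun i => Fin.ext ?_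
    exact_mod_cast congrFun hS i
  · intro z hz
    simp only [Finset.mem_filter, Finset.mem_univ, true_and] at hz
    have hlt : ∀ i, ((S *ᵥ joinCoords Fr (fun j => ((z j : ℕ) : ℤ)) c) i).toNat < n := fun i => by
      have h1 := (hz i).1
      have h2 := (hz i).2
      omega
    have hval : (fun i => ((((S *ᵥ joinCoords Fr (fun j => ((z j : ℕ) : ℤ)) c) i).toNat : ℕ) : ℤ)) =
        S *ᵥ joinCoords Fr (fun j => ((z j : ℕ) : ℤ)) c := by
      funext i
      exact Int.toNat_of_nonneg (hz i).1
    refine ⟨fun i => ⟨_, hlt i⟩, ?_, ?_⟩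
    · simp only [Finset.mem_filter, Finset.mem_univ, true_and]
      rw [hval, mulVec_mulVec, h.mul_inv, one_mulVec]
      intro b hb
      simp [joinCoords, hb]
    · funext j
      refine Fin.ext ?_
      simp only
      rw [h.free_inv j.2]
      simp [joinCoords]

open Classical in
/-- The rescaled lattice count as an integral of an indicator of rounded coordinates. -/
lemma latticeCount_div_eq_integral (h : IsCycleFrame T S Fr) {n : ℕ} (hn : 0 < n) (c : κ → ℤ) :
    (latticeCount T Fr n c : ℝ) / (n : ℝ) ^ Fr.card = ∫ w : Fr → ℝ,
      if ∀ i, (S *ᵥ joinCoords Fr (fun j => ⌊(n : ℝ) * w j⌋) c) i ∈ Set.Ico (0 : ℤ) n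
      then (1 : ℝ) else 0 := by
  have hn' : (0 : ℝ) < n := by exact_mod_cast hn
  -- Grid cells of side `1/n`, the fibres of the rounding map. A sum over grid points divided by `n
  -- ^ Fr.card` is the integral of a step function on them.
  let box : (Fr → Fin n) → Set (Fr → ℝ) := fun z =>
    Set.univ.pi fun j => Set.Ico (((z j : ℕ) : ℝ) / n) (((z j : ℕ) : ℝ) / n + 1 / n)
  have hbox : ∀ z w, w ∈ box z ↔ ∀ j, ⌊(n : ℝ) * w j⌋ = ((z j : ℕ) : ℤ) := fun z w => by
    simp only [box, Set.mem_univ_pi, ← floor_fiber_eq hn, Set.mem_ofPred_eq]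
  have hvol : ∀ z, volume.real (box z) = ((n : ℝ) ^ Fr.card)⁻¹ := fun z => by
    simp only [box, Measure.real]
    rw [Real.volume_pi_Ico_toReal fun j => by
      simp only [le_add_iff_nonneg_right]; positivity]
    simp
  have hpt : ∀ w : Fr → ℝ,
      (if ∀ i, (S *ᵥ joinCoords Fr (fun j => ⌊(n : ℝ) * w j⌋) c) i ∈ Set.Ico (0 : ℤ) n
        then (1 : ℝ) else 0) =
      ∑ z : Fr → Fin n, (box z).indicator (fun _ =>
        if ∀ i, (S *ᵥ joinCoords Fr (fun j => ((z j : ℕ) : ℤ)) c) i ∈ Set.Ico (0 : ℤ) n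
        then (1 : ℝ) else 0) w := by
    intro w
    by_cases hw : ∀ j, ⌊(n : ℝ) * w j⌋ ∈ Set.Ico (0 : ℤ) n
    · have hlt : ∀ j, ⌊(n : ℝ) * w j⌋.toNat < n := fun j => by
        have h1 := (hw j).1
        have h2 := (hw j).2
        omega
      let z0 : Fr → Fin n := fun j => ⟨_, hlt j⟩
      have hz0 : ∀ j, ((z0 j : ℕ) : ℤ) = ⌊(n : ℝ) * w j⌋ := fun j =>
        Int.toNat_of_nonneg (hw j).1
      rw [Finset.sum_eq_single z0]
      · rw [Set.indicator_of_mem ((hbox z0 w).2 fun j => (hz0 j).symm)]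
        simp only [hz0]
      · intro z _ hz
        refine Set.indicator_of_notMem (fun hm => hz ?_) _
        funext j
        have := (hbox z w).1 hm j
        rw [← hz0] at this
        exact Fin.ext (by exact_mod_cast this.symm)
      · simp
    · rw [if_neg, Finset.sum_eq_zero]
      · intro z _
        refine Set.indicator_of_notMem (fun hm => hw fun j => ?_) _
        rw [(hbox z w).1 hm j]
        exact ⟨by positivity, by exact_mod_cast (z j).2⟩
      · intro hall
        refine hw fun j => ?_
        have := hall j
        rw [h.free_inv j.2] at this
        simpa [joinCoords] using this
  have hmeas : ∀ z, MeasurableSet (box z) := fun z => MeasurableSet.univ_pi fun _ => measurableSet_Ico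
  have hfin : ∀ z, volume (box z) ≠ ⊤ := fun z => by
    intro htop
    have := hvol z
    rw [Measure.real, htop, ENNReal.toReal_top] at this
    have h2 : (0 : ℝ) < ((n : ℝ) ^ Fr.card)⁻¹ := by positivity
    linarith
  simp_rw [hpt]
  rw [integral_finsetSum _ fun z _ => (integrable_indicator_iff (hmeas z)).2
    (integrableOn_const (hfin z)), latticeCount_eq_sum h, Finset.sum_div]
  refine Finset.sum_congr rfl fun z _ => ?_
  rw [integral_indicator (hmeas z), setIntegral_const, hvol, smul_eq_mul, div_eq_mul_inv, mul_comm]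

/-- This is where the condition on the all-ones vector is used: no coordinate functional of the free
variables can vanish identically, so the boundary of the polytope will be null. -/
lemma IsCycleFrame.sum_free (h : IsCycleFrame T S Fr) (i : κ) :
    ∑ j : Fr, (S i j : ℝ) = 1 := by
  have := congrFun h.inv_ones i
  simp only [mulVec, dotProduct, mul_ite, mul_one, mul_zero, Finset.sum_ite_mem,
    Finset.univ_inter, Pi.one_apply] at this
  rw [Finset.sum_coe_sort Fr (fun j => (S i j : ℝ))]
  exact_mod_cast this

lemma sum_extendZero (S : Matrix κ κ ℤ) (Fr : Finset κ) (w : Fr → ℝ) (i : κ) :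
    ∑ j, (S i j : ℝ) * extendZero Fr w j = ∑ j : Fr, (S i j : ℝ) * w j := by
  rw [← Finset.sum_subset (Finset.subset_univ Fr), ← Finset.sum_coe_sort]
  · exact Finset.sum_congr rfl fun j _ => by simp [extendZero]
  · intro j _ hj
    simp [extendZero, hj]

/-- Level sets of the coordinates of `S` are null. -/
lemma IsCycleFrame.volume_level (h : IsCycleFrame T S Fr) (i : κ) (t : ℝ) :
    volume {w : Fr → ℝ | ∑ j, (S i j : ℝ) * extendZero Fr w j = t} = 0 := by
  let L : (Fr → ℝ) →ₗ[ℝ] ℝ := ∑ j : Fr, (S i j : ℝ) • LinearMap.proj j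
  have hL : ∀ w, L w = ∑ j, (S i j : ℝ) * extendZero Fr w j := fun w => by
    rw [sum_extendZero]
    simp [L]
  by_cases hne : ∃ w0, L w0 = t
  · obtain ⟨w0, hw0⟩ := hne
    have hset : {w : Fr → ℝ | ∑ j, (S i j : ℝ) * extendZero Fr w j = t} =
        (AffineSubspace.mk' w0 (LinearMap.ker L) : Set (Fr → ℝ)) := by
      ext w
      rw [Set.mem_ofPred_eq, ← hL, SetLike.mem_coe, AffineSubspace.mem_mk', LinearMap.mem_ker,
        vsub_eq_sub, map_sub, hw0, sub_eq_zero]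
    rw [hset]
    refine Measure.addHaar_affineSubspace volume _ fun htop => ?_
    have hd := congrArg AffineSubspace.direction htop
    rw [AffineSubspace.direction_mk', AffineSubspace.direction_top] at hd
    -- The level set could fill the space only if `L` were zero, but `L` takes the value 1 on the
    -- constant vector 1.
    have h1 : L (fun _ => 1) = 0 := by
      rw [← LinearMap.mem_ker, hd]; trivial
    rw [hL, sum_extendZero] at h1
    simp only [mul_one] at h1
    rw [h.sum_free] at h1
    exact one_ne_zero h1
  · have : {w : Fr → ℝ | ∑ j, (S i j : ℝ) * extendZero Fr w j = t} = ∅ := by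
      ext w
      simp only [Set.mem_ofPred_eq, Set.mem_empty_iff_false, iff_false]
      exact fun hw => hne ⟨w, by rw [hL, hw]⟩
    rw [this, measure_empty]

lemma tendsto_floor_mul_div (y : ℝ) :
    Tendsto (fun n : ℕ => (⌊(n : ℝ) * y⌋ : ℝ) / n) atTop (𝓝 y) := by
  have h1 : Tendsto (fun n : ℕ => y - 1 / (n : ℝ)) atTop (𝓝 y) := by
    simpa using (tendsto_const_nhds (x := y)).sub (tendsto_one_div_atTop_nhds_zero_nat (𝕜 := ℝ))
  refine tendsto_of_tendsto_of_tendsto_of_le_of_le' h1 tendsto_const_nhds ?_ ?_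
  · filter_upwards [eventually_gt_atTop 0] with n hn
    have hn' : (0 : ℝ) < n := by exact_mod_cast hn
    rw [le_div_iff₀ hn', sub_mul, div_mul_cancel₀ _ hn'.ne', mul_comm y]
    exact (Int.sub_one_lt_floor _).le
  · filter_upwards [eventually_gt_atTop 0] with n hn
    have hn' : (0 : ℝ) < n := by exact_mod_cast hn
    rw [div_le_iff₀ hn', mul_comm y]
    exact Int.floor_le _

/-- The prescribed coordinates are fixed while the scale grows, so they disappear in the limit. This
is why the asymptotic count does not depend on `c`. -/
lemma tendsto_joinCoords_div (S : Matrix κ κ ℤ) (Fr : Finset κ) (c : κ → ℤ) (w : Fr → ℝ) (i : κ) :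
    Tendsto (fun n : ℕ => ((S *ᵥ joinCoords Fr (fun j => ⌊(n : ℝ) * w j⌋) c) i : ℝ) / n) atTop
      (𝓝 (∑ j, (S i j : ℝ) * extendZero Fr w j)) := by
  have h : ∀ n : ℕ, ((S *ᵥ joinCoords Fr (fun j => ⌊(n : ℝ) * w j⌋) c) i : ℝ) / n =
      ∑ j, (S i j : ℝ) * ((joinCoords Fr (fun j => ⌊(n : ℝ) * w j⌋) c j : ℝ) / n) := fun n => by
    rw [mulVec, dotProduct]
    push_cast
    rw [Finset.sum_div]
    exact Finset.sum_congr rfl fun j _ => by ring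
  simp_rw [h]
  refine tendsto_finsetSum _ fun j _ => Tendsto.const_mul _ ?_
  unfold joinCoords extendZero
  split_ifs with hj
  · exact tendsto_floor_mul_div _
  · exact tendsto_const_div_atTop_nhds_zero_nat _

open Classical in
/-- Asymptotics of the lattice count: the limit does not depend on the right-hand side. -/
theorem tendsto_latticeCount_div (h : IsCycleFrame T S Fr) (c : κ → ℤ) :
    Tendsto (fun n : ℕ => (latticeCount T Fr n c : ℝ) / (n : ℝ) ^ Fr.card) atTop
      (𝓝 (volume.real (latticePolytope S Fr))) := by
  have hmeas : MeasurableSet (latticePolytope S Fr) := by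
    have : latticePolytope S Fr = ⋂ i, {w | (∑ j : Fr, (S i j : ℝ) * w j) ∈ Set.Ioo (0 : ℝ) 1} := by
      ext w
      simp only [latticePolytope, sum_extendZero, Set.mem_ofPred_eq, Set.mem_iInter]
    rw [this]
    refine MeasurableSet.iInter fun i => ?_
    exact measurableSet_Ioo.preimage (by fun_prop)
  rw [← integral_indicator_one hmeas]
  have hev : (fun n : ℕ => ∫ w : Fr → ℝ,
      if ∀ i, (S *ᵥ joinCoords Fr (fun j => ⌊(n : ℝ) * w j⌋) c) i ∈ Set.Ico (0 : ℤ) n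
      then (1 : ℝ) else 0) =ᶠ[atTop]
      fun n : ℕ => (latticeCount T Fr n c : ℝ) / (n : ℝ) ^ Fr.card := by
    filter_upwards [eventually_gt_atTop 0] with n hn
    rw [latticeCount_div_eq_integral h hn]
  refine Tendsto.congr' hev ?_
  -- The free coordinates are themselves among the coordinates of `S`, so the integrands vanish off
  -- the unit cube, whose indicator dominates them.
  refine tendsto_integral_filter_of_dominated_convergence
    ((Set.univ.pi fun _ : Fr => Set.Ico (0 : ℝ) 1).indicator fun _ => 1) ?_ ?_ ?_ ?_
  · refine Eventually.of_forall fun n => Measurable.aestronglyMeasurable ?_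
    refine Measurable.ite ?_ measurable_const measurable_const
    have : {w : Fr → ℝ | ∀ i, (S *ᵥ joinCoords Fr (fun j => ⌊(n : ℝ) * w j⌋) c) i ∈
        Set.Ico (0 : ℤ) n} = ⋂ i, (fun w : Fr → ℝ =>
          (S *ᵥ joinCoords Fr (fun j => ⌊(n : ℝ) * w j⌋) c) i) ⁻¹' Set.Ico (0 : ℤ) n := by
      ext w; simp
    rw [this]
    refine MeasurableSet.iInter fun i => measurableSet_Ico.preimage ?_
    simp only [mulVec, dotProduct]
    refine Finset.measurable_fun_sum _ fun j _ => Measurable.const_mul ?_ _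
    unfold joinCoords
    split_ifs with hj
    · exact Int.measurable_floor.comp ((measurable_pi_apply _).const_mul _)
    · exact measurable_const
  · filter_upwards [eventually_gt_atTop 0] with n hn
    have hn' : (0 : ℝ) < n := by exact_mod_cast hn
    refine ae_of_all _ fun w => ?_
    split_ifs with hw
    · rw [Set.indicator_of_mem, norm_one]
      rw [Set.mem_univ_pi]
      intro j
      have := hw j
      rw [h.free_inv j.2] at this
      simp only [joinCoords, Finset.coe_mem, dite_true, Subtype.coe_eta] at this
      obtain ⟨h1, h2⟩ := this
      rw [Int.floor_nonneg] at h1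
      rw [Int.floor_lt] at h2
      push_cast at h2
      exact ⟨nonneg_of_mul_nonneg_right h1 hn', by nlinarith⟩
    · rw [norm_zero]
      exact Set.indicator_nonneg (fun _ _ => zero_le_one) _
  · refine (integrable_indicator_iff (MeasurableSet.univ_pi fun _ => measurableSet_Ico)).2
      (integrableOn_const ?_)
    rw [Real.volume_pi_Ico]
    simp
  -- Off the null set where some coordinate equals 0 or 1, the rescaled point ends up either inside
  -- the open polytope or outside the closed one, so the indicators converge.
  · have hnull : ∀ᵐ w : Fr → ℝ, ∀ i, (∑ j, (S i j : ℝ) * extendZero Fr w j) ≠ 0 ∧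
        (∑ j, (S i j : ℝ) * extendZero Fr w j) ≠ 1 := by
      rw [ae_all_iff]
      intro i
      refine Filter.Eventually.and ?_ ?_
      · exact measure_eq_zero_iff_ae_notMem.1 (h.volume_level i 0)
      · exact measure_eq_zero_iff_ae_notMem.1 (h.volume_level i 1)
    filter_upwards [hnull] with w hw
    have hlim := tendsto_joinCoords_div S Fr c w
    by_cases hin : w ∈ latticePolytope S Fr
    · rw [Set.indicator_of_mem hin]
      refine tendsto_const_nhds.congr' ?_
      have hev2 : ∀ᶠ n : ℕ in atTop, ∀ i,
          ((S *ᵥ joinCoords Fr (fun j => ⌊(n : ℝ) * w j⌋) c) i : ℝ) / n ∈ Set.Ioo (0 : ℝ) 1 :=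
        eventually_all.2 fun i => (hlim i).eventually (isOpen_Ioo.mem_nhds (hin i))
      filter_upwards [hev2, eventually_gt_atTop 0] with n hn hn0
      have hn' : (0 : ℝ) < n := by exact_mod_cast hn0
      rw [if_pos]
      · rfl
      intro i
      obtain ⟨h1, h2⟩ := hn i
      rw [lt_div_iff₀ hn', zero_mul] at h1
      rw [div_lt_one hn'] at h2
      exact ⟨by exact_mod_cast h1.le, by exact_mod_cast h2⟩
    · rw [Set.indicator_of_notMem hin]
      refine tendsto_const_nhds.congr' ?_
      simp only [latticePolytope, Set.mem_ofPred_eq, not_forall] at hin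
      obtain ⟨i, hi⟩ := hin
      have hout : (∑ j, (S i j : ℝ) * extendZero Fr w j) ∈ (Set.Icc (0 : ℝ) 1)ᶜ := by
        intro hmem
        exact hi ⟨lt_of_le_of_ne hmem.1 (hw i).1.symm, lt_of_le_of_ne hmem.2 (hw i).2⟩
      filter_upwards [(hlim i).eventually (isClosed_Icc.isOpen_compl.mem_nhds hout),
        eventually_gt_atTop 0] with n hn hn0
      have hn' : (0 : ℝ) < n := by exact_mod_cast hn0
      rw [if_neg]
      intro hall
      refine hn ⟨div_nonneg (by exact_mod_cast (hall i).1) hn'.le, ?_⟩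
      rw [div_le_one hn']
      exact_mod_cast (hall i).2.le

end LatticeCount

end FoldVandermonde
end

noncomputable section

namespace FoldVandermonde

open Matrix

/-! ### Closed walks labelled by sampling points, and their weights -/

section CyclicWalk

variable {p : ℕ}

/-- The net increment of the cyclic walk `ℓ` over the steps carrying the label `a`. -/
def blockSum {α M : Type*} [DecidableEq α] [AddCommGroup M] (q : Fin (p + 1) → α)
    (ℓ : Fin (p + 1) → M) (a : α) : M :=
  ∑ j with q j = a, (ℓ j - ℓ (j + 1))

/-- The increments of a closed walk cancel. One block sum is therefore redundant, which is why
vertex 0 counts as free although it represents a block. -/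
lemma sum_blockSum {α M : Type*} [Fintype α] [DecidableEq α] [AddCommGroup M]
    (q : Fin (p + 1) → α) (ℓ : Fin (p + 1) → M) : ∑ a, blockSum q ℓ a = 0 := by
  simp only [blockSum]
  rw [Finset.sum_fiberwise, Finset.sum_sub_distrib, sub_eq_zero]
  exact (Equiv.sum_comp (Equiv.addRight (1 : Fin (p + 1))) ℓ).symm

/-- A labelling in which every step is labelled by the first step with the same label. -/
structure IsCanonical (r : Fin (p + 1) → Fin (p + 1)) : Prop where
  le : ∀ j, r j ≤ j
  idem : ∀ j, r (r j) = r j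

/-- Coordinates of a cyclic walk which may be chosen freely when the block sums are prescribed. -/
def freeSet (r : Fin (p + 1) → Fin (p + 1)) : Finset (Fin (p + 1)) :=
  Finset.univ.filter fun j => j = 0 ∨ r j ≠ j

lemma notMem_freeSet {r : Fin (p + 1) → Fin (p + 1)} {j : Fin (p + 1)} :
    j ∉ freeSet r ↔ j ≠ 0 ∧ r j = j := by
  simp [freeSet]

/-- The change of coordinates from a cyclic walk to its free coordinates and its block sums. -/
def frameMatrix (r : Fin (p + 1) → Fin (p + 1)) : Matrix (Fin (p + 1)) (Fin (p + 1)) ℤ :=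
  Matrix.of fun j i => if j ∈ freeSet r then (if j = i then 1 else 0) else
    (if r i = j then 1 else 0) - (if r (i - 1) = j then 1 else 0)

lemma frameMatrix_mulVec_of_mem {r : Fin (p + 1) → Fin (p + 1)} {j : Fin (p + 1)}
    (hj : j ∈ freeSet r) (x : Fin (p + 1) → ℤ) : (frameMatrix r *ᵥ x) j = x j := by
  simp [mulVec, dotProduct, frameMatrix, hj]

lemma frameMatrix_mulVec_of_notMem {r : Fin (p + 1) → Fin (p + 1)} {j : Fin (p + 1)}
    (hj : j ∉ freeSet r) (x : Fin (p + 1) → ℤ) : (frameMatrix r *ᵥ x) j = blockSum r x j := by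
  simp only [mulVec, dotProduct, frameMatrix, of_apply, hj, if_false, sub_mul, ite_mul, one_mul,
    zero_mul, Finset.sum_sub_distrib, blockSum, Finset.sum_filter]
  congr 1
  rw [← (Equiv.subRight (1 : Fin (p + 1))).sum_comp (fun i => if r i = j then x (i + 1) else 0)]
  simp

lemma Fin.val_sub_one_lt {j : Fin (p + 1)} (hj : j ≠ 0) : j - 1 < j := by
  rw [Fin.lt_def, Fin.val_sub_one_of_ne_zero hj]
  have : (j : ℕ) ≠ 0 := fun h => hj (Fin.ext h)
  omega

/-- Listing the bound indices in increasing order and then the free ones as a single block makes the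
matrix triangular with identity diagonal blocks. A bound `i` cannot occur in a column `j < i`, since
`r j` and `r (j - 1)` are then smaller than `i`. -/
lemma frameMatrix_det {r : Fin (p + 1) → Fin (p + 1)} (hr : IsCanonical r) :
    (frameMatrix r).det = 1 := by
  let ρ : Fin (p + 1) → ℕ := fun j => if j ∈ freeSet r then p + 1 else j
  have hρ1 : ∀ j, j ∈ freeSet r → ρ j = p + 1 := fun j hj => if_pos hj
  have hρ2 : ∀ j, j ∉ freeSet r → ρ j = j := fun j hj => if_neg hj
  have hlt : ∀ i j : Fin (p + 1), i ∉ freeSet r → j ∉ freeSet r → j < i → frameMatrix r i j = 0 := by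
    intro i j hi hj hji
    have hj' := notMem_freeSet.1 hj
    simp only [frameMatrix, of_apply, hi, if_false]
    rw [if_neg (by rw [hj'.2]; exact hji.ne), if_neg, sub_zero]
    intro h
    have h1 := hr.le (j - 1)
    rw [h] at h1
    exact absurd (h1.trans_lt (Fin.val_sub_one_lt hj'.1)) (not_lt.2 hji.le)
  have hself : ∀ i, frameMatrix r i i = 1 := by
    intro i
    by_cases hi : i ∈ freeSet r
    · simp [frameMatrix, hi]
    · have hi' := notMem_freeSet.1 hi
      simp only [frameMatrix, of_apply, hi, if_false]
      rw [if_pos hi'.2, if_neg, sub_zero]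
      intro h
      have h1 := hr.le (i - 1)
      rw [h] at h1
      exact absurd h1 (not_le.2 (Fin.val_sub_one_lt hi'.1))
  have hfree : ∀ i j, i ∈ freeSet r → i ≠ j → frameMatrix r i j = 0 := by
    intro i j hi hij
    simp [frameMatrix, hi, hij]
  have htri : (frameMatrix r).BlockTriangular ρ := by
    intro i j hij
    by_cases hj : j ∈ freeSet r
    · rw [hρ1 j hj] at hij
      exfalso
      by_cases hi : i ∈ freeSet r
      · rw [hρ1 i hi] at hij; omega
      · rw [hρ2 i hi] at hij; have := i.2; omega
    · by_cases hi : i ∈ freeSet r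
      · exact hfree i j hi fun h => hj (h ▸ hi)
      · rw [hρ2 i hi, hρ2 j hj] at hij
        exact hlt i j hi hj hij
  rw [htri.det]
  refine Finset.prod_eq_one fun a _ => ?_
  have : (frameMatrix r).toSquareBlock ρ a = 1 := by
    ext ⟨i, hi⟩ ⟨j, hj⟩
    rw [toSquareBlock_def, of_apply, one_apply]
    split_ifs with h
    · rw [Subtype.mk_eq_mk] at h
      subst h
      exact hself i
    · have hij : i ≠ j := fun e => h (Subtype.ext e)
      by_cases hi' : i ∈ freeSet r
      · exact hfree i j hi' hij
      · exfalso
        have hρ : ρ i = ρ j := hi.trans hj.symm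
        rw [hρ2 i hi'] at hρ
        by_cases hj' : j ∈ freeSet r
        · rw [hρ1 j hj'] at hρ
          have := i.2
          omega
        · rw [hρ2 j hj'] at hρ
          exact hij (Fin.ext hρ)
  rw [this, det_one]

lemma IsCanonical.isCycleFrame {r : Fin (p + 1) → Fin (p + 1)} (hr : IsCanonical r) :
    IsCycleFrame (frameMatrix r) (frameMatrix r)⁻¹ (freeSet r) := by
  have hu : IsUnit (frameMatrix r).det := by rw [frameMatrix_det hr]; exact isUnit_one
  refine ⟨mul_nonsing_inv _ hu, nonsing_inv_mul _ hu, fun j hj x => frameMatrix_mulVec_of_mem hj x,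
    ?_⟩
  funext j
  by_cases hj : j ∈ freeSet r
  · rw [frameMatrix_mulVec_of_mem hj, if_pos hj, Pi.one_apply]
  · rw [frameMatrix_mulVec_of_notMem hj, if_neg hj]
    simp [blockSum]

variable {d : ℕ}

/-- The sum over all cyclic walks in the grid of the product of the Fourier coefficients of the
block sums. -/
def walkWeight {α : Type*} [Fintype α] [DecidableEq α] (coef : (Fin d → ℤ) → ℂ) (n : ℕ)
    (q : Fin (p + 1) → α) : ℂ :=
  ∑ ℓ : Fin (p + 1) → Fin d → Fin n, ∏ a, coef (blockSum q (fun j => rowIndex (ℓ j)) a)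

lemma blockSum_eq_zero {α M : Type*} [DecidableEq α] [AddCommGroup M] {q : Fin (p + 1) → α}
    (ℓ : Fin (p + 1) → M) {a : α} (ha : ∀ j, q j ≠ a) : blockSum q ℓ a = 0 := by
  rw [blockSum, Finset.filter_false_of_mem fun j _ => ha j, Finset.sum_empty]

/-- The weight of a labelling only depends on its kernel. -/
lemma walkWeight_congr {α : Type*} [Fintype α] [DecidableEq α] {coef : (Fin d → ℤ) → ℂ}
    (h0 : coef 0 = 1) (n : ℕ) {q : Fin (p + 1) → α} {r : Fin (p + 1) → Fin (p + 1)}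
    (hr : IsCanonical r) (hqr : ∀ i j, r i = r j ↔ q i = q j) :
    walkWeight coef n q = walkWeight coef n r := by
  refine Finset.sum_congr rfl fun ℓ _ => ?_
  set x := fun j => rowIndex (ℓ j)
  -- Labels that are never used have an empty block sum and contribute `coef 0 = 1`, so both
  -- products reduce to the blocks of the common partition.
  have hq : ∏ a, coef (blockSum q x a) =
      ∏ a ∈ (Finset.univ.filter fun b => r b = b).image q, coef (blockSum q x a) := by
    refine (Finset.prod_subset (Finset.subset_univ _) fun a _ ha => ?_).symm
    rw [blockSum_eq_zero, h0]
    intro j hj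
    refine ha (Finset.mem_image.2 ⟨r j, by simp [hr.idem], ?_⟩)
    rw [← hj, ← hqr, hr.idem]
  have hr' : ∏ b, coef (blockSum r x b) =
      ∏ b with r b = b, coef (blockSum r x b) := by
    refine (Finset.prod_subset (Finset.subset_univ _) fun b _ hb => ?_).symm
    rw [blockSum_eq_zero, h0]
    intro j hj
    refine hb ?_
    rw [Finset.mem_filter, ← hj]
    exact ⟨Finset.mem_univ _, hr.idem j⟩
  rw [hq, hr', Finset.prod_image]
  · refine Finset.prod_congr rfl fun b hb => ?_
    rw [Finset.mem_filter] at hb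
    simp only [blockSum]
    congr 2
    ext j
    simp only [Finset.mem_filter, Finset.mem_univ, true_and]
    rw [← hqr, hb.2]
  · intro b hb b' hb' h
    simp only [Finset.coe_filter, Finset.mem_univ, true_and, Set.mem_ofPred_eq] at hb hb'
    rw [← hqr, hb, hb'] at h
    exact h

/-- The weight of a prescribed family of block sums. -/
def blockCoef (coef : (Fin d → ℤ) → ℂ) (Fr : Finset (Fin (p + 1)))
    (c : Fin (p + 1) → Fin d → ℤ) : ℂ :=
  (∏ b, if b ∈ Fr then 1 else coef (c b)) * coef (-∑ b, if b ∈ Fr then 0 else c b)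

/-- The families of block sums with a nonzero weight. -/
def blockRange (S : Finset (Fin d → ℤ)) (Fr : Finset (Fin (p + 1))) :
    Finset (Fin (p + 1) → Fin d → ℤ) :=
  Fintype.piFinset fun b => if b ∈ Fr then {0} else S

lemma zero_mem_freeSet (r : Fin (p + 1) → Fin (p + 1)) : 0 ∈ freeSet r := by simp [freeSet]

/-- Free indices other than 0 are labels that do not occur and give the factor 1. The block sum of 0
is minus the sum of the others, which accounts for the last factor of `blockCoef`. -/
lemma prod_coef_blockSum {coef : (Fin d → ℤ) → ℂ} (h0 : coef 0 = 1)
    {r : Fin (p + 1) → Fin (p + 1)} (hr : IsCanonical r) (x : Fin (p + 1) → Fin d → ℤ) :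
    ∏ a, coef (blockSum r x a) = blockCoef coef (freeSet r) (blockSum r x) := by
  have hz : ∀ b, b ∈ freeSet r → b ≠ 0 → blockSum r x b = 0 := by
    intro b hb hb0
    refine blockSum_eq_zero x fun j hj => ?_
    simp only [freeSet, Finset.mem_filter, Finset.mem_univ, true_and, hb0, false_or] at hb
    exact hb (by rw [← hj, hr.idem])
  have hsum : -∑ b, (if b ∈ freeSet r then 0 else blockSum r x b) = blockSum r x 0 := by
    have h1 : ∑ b, (if b ∈ freeSet r then 0 else blockSum r x b) =
        ∑ b ∈ Finset.univ.erase 0, blockSum r x b := by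
      rw [← Finset.add_sum_erase _ _ (Finset.mem_univ 0), if_pos (zero_mem_freeSet r), zero_add]
      refine Finset.sum_congr rfl fun b hb => ?_
      split_ifs with h
      · rw [hz b h (Finset.ne_of_mem_erase hb)]
      · rfl
    rw [neg_eq_iff_add_eq_zero, h1, Finset.sum_erase_add _ _ (Finset.mem_univ 0), sum_blockSum]
  rw [blockCoef, hsum, ← Finset.mul_prod_erase _ _ (Finset.mem_univ 0), mul_comm,
    ← Finset.mul_prod_erase _ (fun b => if b ∈ freeSet r then 1 else coef (blockSum r x b))
      (Finset.mem_univ 0), if_pos (zero_mem_freeSet r), one_mul]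
  congr 1
  refine Finset.prod_congr rfl fun b hb => ?_
  split_ifs with h
  · rw [hz b h (Finset.ne_of_mem_erase hb), h0]
  · rfl

/-- Walks with prescribed block sums are counted coordinatewise. -/
lemma card_walks {r : Fin (p + 1) → Fin (p + 1)} (n : ℕ) (c : Fin (p + 1) → Fin d → ℤ) :
    Fintype.card {ℓ : Fin (p + 1) → Fin d → Fin n // ∀ b, b ∉ freeSet r →
      blockSum r (fun j => rowIndex (ℓ j)) b = c b} =
      ∏ i, latticeCount (frameMatrix r) (freeSet r) n fun b => c b i := by
  simp only [latticeCount]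
  have hb : ∀ (ℓ : Fin (p + 1) → Fin d → Fin n) (b : Fin (p + 1)) (i : Fin d), b ∉ freeSet r →
      (frameMatrix r *ᵥ fun j => ((ℓ j i : ℕ) : ℤ)) b =
        blockSum r (fun j => rowIndex (ℓ j)) b i := by
    intro ℓ b i hb
    rw [frameMatrix_mulVec_of_notMem hb]
    simp only [blockSum, Finset.sum_apply, Pi.sub_apply, rowIndex]
  let e : {ℓ : Fin (p + 1) → Fin d → Fin n // ∀ b, b ∉ freeSet r →
      blockSum r (fun j => rowIndex (ℓ j)) b = c b} ≃
      ((i : Fin d) → {ℓ : Fin (p + 1) → Fin n // ∀ b, b ∉ freeSet r →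
        (frameMatrix r *ᵥ fun i => ((ℓ i : ℕ) : ℤ)) b = c b i}) :=
    { toFun := fun ℓ i => ⟨fun j => ℓ.1 j i, fun b hbf => by rw [hb ℓ.1 b i hbf, ℓ.2 b hbf]⟩
      invFun := fun ℓ => ⟨fun j i => (ℓ i).1 j, fun b hbf => by
        funext i
        rw [← hb (fun j i => (ℓ i).1 j) b i hbf]
        exact (ℓ i).2 b hbf⟩
      left_inv := fun ℓ => rfl
      right_inv := fun ℓ => rfl }
  rw [Fintype.card_congr e, Fintype.card_pi]
  congr!

/-- Walks are grouped by their block sums. As `coef` has finite support, the resulting index set is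
finite and does not depend on `n`, so limits can be taken term by term. -/
lemma walkWeight_eq_sum {coef : (Fin d → ℤ) → ℂ} {S : Finset (Fin d → ℤ)} (h0 : coef 0 = 1)
    (hS : ∀ c, c ∉ S → coef c = 0) (n : ℕ) {r : Fin (p + 1) → Fin (p + 1)} (hr : IsCanonical r) :
    walkWeight coef n r = ∑ c ∈ blockRange S (freeSet r), blockCoef coef (freeSet r) c *
      ((∏ i, latticeCount (frameMatrix r) (freeSet r) n fun b => c b i : ℕ) : ℂ) := by
  classical
  let cc : (Fin (p + 1) → Fin d → Fin n) → Fin (p + 1) → Fin d → ℤ := fun ℓ b =>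
    if b ∈ freeSet r then 0 else blockSum r (fun j => rowIndex (ℓ j)) b
  have hw : ∀ ℓ : Fin (p + 1) → Fin d → Fin n,
      ∏ a, coef (blockSum r (fun j => rowIndex (ℓ j)) a) =
      ∑ c ∈ blockRange S (freeSet r), if cc ℓ = c then blockCoef coef (freeSet r) c else 0 := by
    intro ℓ
    rw [prod_coef_blockSum h0 hr, Finset.sum_ite_eq]
    have hcc : blockCoef coef (freeSet r) (blockSum r fun j => rowIndex (ℓ j)) =
        blockCoef coef (freeSet r) (cc ℓ) := by
      unfold blockCoef
      congr 1
      · refine Finset.prod_congr rfl fun b _ => ?_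
        by_cases hb : b ∈ freeSet r <;> simp [cc, hb]
      · congr 2
        refine Finset.sum_congr rfl fun b _ => ?_
        by_cases hb : b ∈ freeSet r <;> simp [cc, hb]
    rw [hcc]
    split_ifs with hmem
    · rfl
    · simp only [blockRange, Fintype.mem_piFinset, not_forall] at hmem
      obtain ⟨b, hb⟩ := hmem
      by_cases hbf : b ∈ freeSet r
      · simp [cc, hbf] at hb
      · rw [if_neg hbf] at hb
        rw [blockCoef, Finset.prod_eq_zero (Finset.mem_univ b), zero_mul]
        rw [if_neg hbf, hS _ hb]
  rw [walkWeight, Finset.sum_congr rfl fun ℓ _ => hw ℓ, Finset.sum_comm]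
  refine Finset.sum_congr rfl fun c hc => ?_
  rw [← card_walks, Fintype.card_subtype, Finset.card_eq_sum_ones, Nat.cast_sum, Finset.sum_filter,
    Finset.mul_sum]
  refine Finset.sum_congr rfl fun ℓ _ => ?_
  have hiff : cc ℓ = c ↔ ∀ b, b ∉ freeSet r → blockSum r (fun j => rowIndex (ℓ j)) b = c b := by
    rw [funext_iff]
    refine forall_congr' fun b => ?_
    by_cases hbf : b ∈ freeSet r
    · simp only [blockRange, Fintype.mem_piFinset] at hc
      have := hc b
      rw [if_pos hbf, Finset.mem_singleton] at this
      simp [cc, hbf, this]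
    · simp [cc, hbf]
  by_cases h : cc ℓ = c
  · rw [if_pos h, if_pos (hiff.1 h)]; simp
  · rw [if_neg h, if_neg (mt hiff.2 h)]; simp

/-- The limit of the normalised weight of a canonical labelling. -/
def limitWeight (coef : (Fin d → ℤ) → ℂ) (S : Finset (Fin d → ℤ))
    (r : Fin (p + 1) → Fin (p + 1)) : ℂ :=
  ∑ c ∈ blockRange S (freeSet r), blockCoef coef (freeSet r) c *
    ((volume.real (latticePolytope (frameMatrix r)⁻¹ (freeSet r)) : ℝ) : ℂ) ^ d

lemma tendsto_walkWeight_div {coef : (Fin d → ℤ) → ℂ} {S : Finset (Fin d → ℤ)} (h0 : coef 0 = 1)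
    (hS : ∀ c, c ∉ S → coef c = 0) {r : Fin (p + 1) → Fin (p + 1)} (hr : IsCanonical r) :
    Tendsto (fun n : ℕ => walkWeight coef n r / ((n : ℂ) ^ d) ^ (freeSet r).card) atTop
      (𝓝 (limitWeight coef S r)) := by
  have h : ∀ n : ℕ, walkWeight coef n r / ((n : ℂ) ^ d) ^ (freeSet r).card =
      ∑ c ∈ blockRange S (freeSet r), blockCoef coef (freeSet r) c *
        ∏ i : Fin d, (((latticeCount (frameMatrix r) (freeSet r) n fun b => c b i : ℕ) : ℝ) /
          (n : ℝ) ^ (freeSet r).card : ℝ) := fun n => by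
    rw [walkWeight_eq_sum h0 hS n hr, Finset.sum_div]
    refine Finset.sum_congr rfl fun c _ => ?_
    rw [mul_div_assoc]
    congr 1
    push_cast
    rw [Finset.prod_div_distrib, Finset.prod_const, Finset.card_univ, Fintype.card_fin, ← pow_mul,
      ← pow_mul, mul_comm d]
  simp_rw [h]
  refine tendsto_finsetSum _ fun c _ => Tendsto.const_mul _ ?_
  have := tendsto_finsetProd (Finset.univ : Finset (Fin d)) fun i _ =>
    (Complex.continuous_ofReal.tendsto _).comp
      (tendsto_latticeCount_div hr.isCycleFrame fun b => c b i)
  simpa using this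

/-- A bound geometric in the length of the walk, as required by the exponential series. Each bound
index costs at most `∑ ‖coef c‖`, each free index 1, which is no larger, and the redundant
coefficient is at most 1. -/
lemma norm_walkWeight_le {coef : (Fin d → ℤ) → ℂ} {S : Finset (Fin d → ℤ)} (h0 : coef 0 = 1)
    (hS : ∀ c, c ∉ S → coef c = 0) (h1 : ∀ c, ‖coef c‖ ≤ 1) (n : ℕ)
    {r : Fin (p + 1) → Fin (p + 1)} (hr : IsCanonical r) :
    ‖walkWeight coef n r‖ ≤ ((n : ℝ) ^ d) ^ (freeSet r).card * (∑ c ∈ S, ‖coef c‖) ^ (p + 1) := by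
  have hA : 1 ≤ ∑ c ∈ S, ‖coef c‖ := by
    have h0S : (0 : Fin d → ℤ) ∈ S := by
      by_contra h
      rw [hS 0 h] at h0
      exact zero_ne_one h0
    calc (1 : ℝ) = ‖coef 0‖ := by rw [h0, norm_one]
      _ ≤ _ := Finset.single_le_sum (f := fun c => ‖coef c‖) (fun c _ => norm_nonneg _) h0S
  rw [walkWeight_eq_sum h0 hS n hr]
  calc ‖∑ c ∈ blockRange S (freeSet r), blockCoef coef (freeSet r) c *
        ((∏ i, latticeCount (frameMatrix r) (freeSet r) n fun b => c b i : ℕ) : ℂ)‖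
      ≤ ∑ c ∈ blockRange S (freeSet r), (∏ b, if b ∈ freeSet r then 1 else ‖coef (c b)‖) *
        ((n : ℝ) ^ d) ^ (freeSet r).card := by
        refine (norm_sum_le _ _).trans (Finset.sum_le_sum fun c _ => ?_)
        rw [norm_mul, Complex.norm_natCast]
        refine mul_le_mul ?_ ?_ (Nat.cast_nonneg _) ?_
        · rw [blockCoef, norm_mul, norm_prod]
          refine (mul_le_of_le_one_right (by positivity) (h1 _)).trans (le_of_eq ?_)
          refine Finset.prod_congr rfl fun b _ => ?_
          split_ifs <;> simp
        · have : ∏ i, (latticeCount (frameMatrix r) (freeSet r) n fun b => c b i) ≤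
              ∏ _i : Fin d, n ^ (freeSet r).card :=
            Finset.prod_le_prod' fun i _ => latticeCount_le hr.isCycleFrame n _
          rw [Finset.prod_const, Finset.card_univ, Fintype.card_fin, ← pow_mul, mul_comm,
            pow_mul] at this
          exact_mod_cast this
        · refine Finset.prod_nonneg fun b _ => ?_
          split_ifs <;> positivity
    _ = ((n : ℝ) ^ d) ^ (freeSet r).card *
        ∏ b : Fin (p + 1), ∑ c ∈ (if b ∈ freeSet r then {0} else S),
          if b ∈ freeSet r then 1 else ‖coef c‖ := by
        rw [← Finset.sum_mul, mul_comm, Finset.prod_univ_sum]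
        rfl
    _ ≤ _ := by
        refine mul_le_mul_of_nonneg_left ?_ (by positivity)
        have hconst : (∑ c ∈ S, ‖coef c‖) ^ (p + 1) = ∏ _b : Fin (p + 1), ∑ c ∈ S, ‖coef c‖ := by
          simp
        rw [hconst]
        refine Finset.prod_le_prod (fun b _ => Finset.sum_nonneg fun c _ => ?_) fun b _ => ?_
        · split_ifs <;> positivity
        · split_ifs with hb
          · simpa using hA
          · exact le_rfl

end CyclicWalk

end FoldVandermonde
end

noncomputable section

namespace FoldVandermonde

open Matrix

/-! ### Mean moments as sums over partitions of the steps -/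

section Moments

/-- The arbitrary `G` leaves both endpoints open, so the induction can detach the first vertex and
absorb its step into `G`. -/
lemma sum_path_prod {ι R : Type*} [Fintype ι] [DecidableEq ι] [CommSemiring R]
    (A : Matrix ι ι R) (p : ℕ) (G : ι → ι → R) :
    ∑ ℓ : Fin (p + 1) → ι, (∏ j : Fin p, A (ℓ j.castSucc) (ℓ j.succ)) * G (ℓ (Fin.last p)) (ℓ 0) =
      ∑ a, ∑ b, (A ^ p) a b * G b a := by
  induction p generalizing G with
  | zero =>
    simp only [Finset.univ_eq_empty, Finset.prod_empty, one_mul, pow_zero, one_apply, ite_mul,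
      zero_mul, Finset.sum_ite_eq, Finset.mem_univ, if_true]
    exact (Equiv.funUnique (Fin 1) ι).sum_comp (fun a => G a a)
  | succ p ih =>
    rw [← (Fin.consEquiv fun _ : Fin (p + 2) => ι).sum_comp, Fintype.sum_prod_type]
    have h : ∀ (x : ι) (ℓ : Fin (p + 1) → ι),
        (∏ j : Fin (p + 1), A ((Fin.consEquiv fun _ : Fin (p + 2) => ι) (x, ℓ) j.castSucc)
          ((Fin.consEquiv fun _ : Fin (p + 2) => ι) (x, ℓ) j.succ)) *
          G ((Fin.consEquiv fun _ : Fin (p + 2) => ι) (x, ℓ) (Fin.last (p + 1)))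
            ((Fin.consEquiv fun _ : Fin (p + 2) => ι) (x, ℓ) 0) =
        (∏ j : Fin p, A (ℓ j.castSucc) (ℓ j.succ)) * (A x (ℓ 0) * G (ℓ (Fin.last p)) x) := by
      intro x ℓ
      rw [Fin.prod_univ_succ, ← Fin.succ_last]
      simp only [Fin.consEquiv, Equiv.coe_fn_mk, Fin.castSucc_zero, Fin.cons_zero, Fin.cons_succ,
        ← Fin.succ_castSucc]
      ring
    simp_rw [h]
    rw [Finset.sum_comm]
    simp_rw [← Finset.mul_sum]
    rw [ih fun b a => ∑ x, A x a * G b x]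
    simp_rw [pow_succ', mul_apply, Finset.sum_mul, Finset.mul_sum]
    rw [Finset.sum_comm]
    calc _ = ∑ b, ∑ x, ∑ a, (A ^ p) a b * (A x a * G b x) := by
          refine Finset.sum_congr rfl fun b _ => Finset.sum_comm
      _ = _ := by
          rw [Finset.sum_comm]
          refine Finset.sum_congr rfl fun x _ => Finset.sum_congr rfl fun b _ =>
            Finset.sum_congr rfl fun a _ => by ring

/-- The trace of a power as a sum over closed walks. -/
theorem trace_pow_succ {ι R : Type*} [Fintype ι] [DecidableEq ι] [CommSemiring R]
    (A : Matrix ι ι R) (p : ℕ) :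
    (A ^ (p + 1)).trace = ∑ ℓ : Fin (p + 1) → ι, ∏ j, A (ℓ j) (ℓ (j + 1)) := by
  have h : ∀ ℓ : Fin (p + 1) → ι, ∏ j, A (ℓ j) (ℓ (j + 1)) =
      (∏ j : Fin p, A (ℓ j.castSucc) (ℓ j.succ)) * A (ℓ (Fin.last p)) (ℓ 0) := fun ℓ => by
    rw [Fin.prod_univ_castSucc]
    simp [Fin.coeSucc_eq_succ, Fin.last_add_one]
  rw [Finset.sum_congr rfl fun ℓ _ => h ℓ]
  refine Eq.trans ?_ (sum_path_prod A p fun a b => A a b).symm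
  rw [pow_succ, trace]
  simp only [diag, mul_apply]

variable {d p : ℕ}

/-- Choosing a sampling point in each Gram factor labels the steps of the walk. Phases evaluated at
the same point multiply to the character of its net increment. -/
lemma trace_gram_pow {m : ℕ} (n : ℕ) (x : Fin m → Fin d → ℝ) :
    (gram n x ^ (p + 1)).trace = ((m : ℂ)⁻¹) ^ (p + 1) * ∑ q : Fin (p + 1) → Fin m,
      ∑ ℓ : Fin (p + 1) → Fin d → Fin n,
        ∏ a, phase (blockSum q (fun j => rowIndex (ℓ j)) a) (x a) := by
  rw [trace_pow_succ, Finset.sum_comm, Finset.mul_sum]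
  refine Finset.sum_congr rfl fun ℓ _ => ?_
  simp only [gram_eq_sum, Matrix.sum_apply, rankOne, of_apply]
  rw [Finset.prod_univ_sum, Fintype.piFinset_univ, Finset.mul_sum]
  refine Finset.sum_congr rfl fun q _ => ?_
  rw [Finset.prod_mul_distrib, Finset.prod_const, Finset.card_univ, Fintype.card_fin]
  congr 1
  rw [← Finset.prod_fiberwise (s := Finset.univ) (g := q)]
  refine Finset.prod_congr rfl fun a _ => ?_
  rw [blockSum, phase_sum]
  refine Finset.prod_congr rfl fun j hj => ?_
  rw [(Finset.mem_filter.1 hj).2]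

variable {g : (Fin d → ℝ) → ℝ} {S : Finset (Fin d → ℤ)} {coef : (Fin d → ℤ) → ℂ}

/-- Independence factors the expectation over the points, and each factor is a Fourier coefficient
of the density. -/
lemma integral_trace_gram_pow (hg : IsTrigDensity d g S coef) (n m : ℕ) :
    ∫ x, (gram n x ^ (p + 1)).trace ∂(sampleLaw d g m) =
      ((m : ℂ)⁻¹) ^ (p + 1) * ∑ q : Fin (p + 1) → Fin m, walkWeight coef n q := by
  have := hg.density.isProbabilityMeasure_sampleLaw m
  have := hg.density.isProbabilityMeasure_pointLaw
  simp_rw [trace_gram_pow]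
  have hint : ∀ (q : Fin (p + 1) → Fin m) (ℓ : Fin (p + 1) → Fin d → Fin n),
      Integrable (fun x : Fin m → Fin d → ℝ =>
        ∏ a, phase (blockSum q (fun j => rowIndex (ℓ j)) a) (x a)) (sampleLaw d g m) := by
    intro q ℓ
    refine Integrable.of_bound (C := 1) (Continuous.aestronglyMeasurable (by fun_prop))
      (ae_of_all _ fun x => ?_)
    rw [norm_prod, Finset.prod_eq_one fun a _ => norm_phase _ _]
  rw [integral_const_mul, integral_finsetSum _ fun q _ => integrable_finsetSum _ fun ℓ _ => hint q ℓ]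
  congr 1
  refine Finset.sum_congr rfl fun q _ => ?_
  rw [integral_finsetSum _ fun ℓ _ => hint q ℓ, walkWeight]
  refine Finset.sum_congr rfl fun ℓ _ => ?_
  rw [sampleLaw, integral_fintype_prod_eq_prod
    (f := fun a => phase (blockSum q (fun j => rowIndex (ℓ j)) a))]
  exact Finset.prod_congr rfl fun a _ => hg.integral_phase_pointLaw _

/-- The first step carrying the same label. -/
def firstOcc {α : Type*} [DecidableEq α] (q : Fin (p + 1) → α) (j : Fin (p + 1)) : Fin (p + 1) :=
  (Finset.univ.filter fun i => q i = q j).min' ⟨j, by simp⟩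

lemma apply_firstOcc {α : Type*} [DecidableEq α] (q : Fin (p + 1) → α) (j : Fin (p + 1)) :
    q (firstOcc q j) = q j := by
  have := Finset.min'_mem (Finset.univ.filter fun i => q i = q j) ⟨j, by simp⟩
  exact (Finset.mem_filter.1 this).2

lemma firstOcc_le {α : Type*} [DecidableEq α] (q : Fin (p + 1) → α) {i j : Fin (p + 1)}
    (h : q i = q j) : firstOcc q j ≤ i :=
  Finset.min'_le _ _ (by simpa using h)

lemma firstOcc_eq_iff {α : Type*} [DecidableEq α] (q : Fin (p + 1) → α) (i j : Fin (p + 1)) :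
    firstOcc q i = firstOcc q j ↔ q i = q j := by
  constructor
  · intro h
    rw [← apply_firstOcc q i, h, apply_firstOcc q j]
  · intro h
    simp only [firstOcc, h]

lemma isCanonical_firstOcc {α : Type*} [DecidableEq α] (q : Fin (p + 1) → α) :
    IsCanonical (firstOcc q) :=
  ⟨fun _ => firstOcc_le q rfl, fun j => (firstOcc_eq_iff q _ _).2 (apply_firstOcc q j)⟩

lemma IsCanonical.firstOcc_eq {α : Type*} [DecidableEq α] {q : Fin (p + 1) → α}
    {r : Fin (p + 1) → Fin (p + 1)} (hr : IsCanonical r) (h : ∀ i j, r i = r j ↔ q i = q j) :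
    firstOcc q = r := by
  funext j
  refine le_antisymm (firstOcc_le q ((h _ _).1 (hr.idem j))) ?_
  have := (h (firstOcc q j) j).2 (apply_firstOcc q j)
  rw [← this]
  exact hr.le _

/-- A labelling with a given kernel is the same as an injection of the blocks into the sampling
points. -/
lemma card_firstOcc_eq (m : ℕ) {r : Fin (p + 1) → Fin (p + 1)} (hr : IsCanonical r) :
    (Finset.univ.filter fun q : Fin (p + 1) → Fin m => firstOcc q = r).card =
      m.descFactorial (Fintype.card {b // r b = b}) := by
  rw [← Fintype.card_subtype]
  let e : {q : Fin (p + 1) → Fin m // firstOcc q = r} ≃ ({b // r b = b} ↪ Fin m) :=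
    { toFun := fun q => ⟨fun b => q.1 b, fun b b' hbb => by
        have h := (firstOcc_eq_iff q.1 b b').2 hbb
        rw [q.2, b.2, b'.2] at h
        exact Subtype.ext h⟩
      invFun := fun e => ⟨fun j => e ⟨r j, hr.idem j⟩, hr.firstOcc_eq fun i j => by
        rw [e.injective.eq_iff, Subtype.mk_eq_mk]⟩
      left_inv := fun q => by
        refine Subtype.ext (funext fun j => ?_)
        have := apply_firstOcc q.1 j
        rw [q.2] at this
        exact this
      right_inv := fun e => by
        ext b
        exact congrArg (fun b => ((e b : Fin m) : ℕ)) (Subtype.ext b.2) }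
  rw [Fintype.card_congr e, Fintype.card_embedding_eq, Fintype.card_fin]

open Classical in
/-- The finite set of canonical labellings. -/
def canonicalSet (p : ℕ) : Finset (Fin (p + 1) → Fin (p + 1)) :=
  Finset.univ.filter IsCanonical

lemma mem_canonicalSet {r : Fin (p + 1) → Fin (p + 1)} : r ∈ canonicalSet p ↔ IsCanonical r := by
  simp [canonicalSet]

lemma sum_walkWeight_eq (h0 : coef 0 = 1) (n m : ℕ) :
    ∑ q : Fin (p + 1) → Fin m, walkWeight coef n q =
      ∑ r ∈ canonicalSet p,
        (m.descFactorial (Fintype.card {b // r b = b}) : ℂ) * walkWeight coef n r := by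
  rw [← Finset.sum_fiberwise_of_maps_to (t := canonicalSet p) (g := fun q => firstOcc q)
    fun q _ => mem_canonicalSet.2 (isCanonical_firstOcc q)]
  refine Finset.sum_congr rfl fun r hr => ?_
  have hr' := mem_canonicalSet.1 hr
  rw [← card_firstOcc_eq m hr', ← nsmul_eq_mul, ← Finset.sum_const]
  refine Finset.sum_congr rfl fun q hq => ?_
  have hq' := (Finset.mem_filter.1 hq).2
  exact walkWeight_congr h0 n hr' fun i j => by rw [← hq', firstOcc_eq_iff]

/-- Index 0 is counted twice, as a free vertex and as a block representative; every other index is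
counted once. -/
lemma IsCanonical.card_add_card {r : Fin (p + 1) → Fin (p + 1)} (hr : IsCanonical r) :
    (freeSet r).card + Fintype.card {b // r b = b} = p + 2 := by
  have hr0 : r 0 = 0 := le_antisymm (hr.le 0) (Fin.zero_le _)
  have h1 : Finset.univ.filter (fun b => r b = b) = insert 0 (freeSet r)ᶜ := by
    ext b
    rw [Finset.mem_insert, Finset.mem_compl, notMem_freeSet, Finset.mem_filter]
    by_cases hb : b = 0
    · subst hb; simp [hr0]
    · simp [hb]
  rw [Fintype.card_subtype, h1, Finset.card_insert_of_notMem (by simp [zero_mem_freeSet]),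
    ← add_assoc, Finset.card_add_card_compl, Fintype.card_fin]

lemma freeSet_card_pos (r : Fin (p + 1) → Fin (p + 1)) : 0 < (freeSet r).card :=
  Finset.card_pos.2 ⟨0, zero_mem_freeSet r⟩

/-- The normalised mean moments of the spectrum. -/
def meanMoment (g : (Fin d → ℝ) → ℝ) (n m p : ℕ) : ℂ :=
  ((n : ℂ) ^ d)⁻¹ * ∫ x, (gram n x ^ p).trace ∂(sampleLaw d g m)

/-- With `f` free vertices and `k` blocks, `n^{-d} m^{-(p+1)}` meets `m^k` labellings and `n^{d f}`
walks. Since `f + k = p + 2`, what remains is `(n^d/m)^(f-1)`. -/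
lemma meanMoment_succ (hg : IsTrigDensity d g S coef) {n m : ℕ} (hn : 0 < n) (hm : 0 < m) :
    meanMoment g n m (p + 1) = ∑ r ∈ canonicalSet p,
      ((m.descFactorial (Fintype.card {b // r b = b}) : ℂ) / (m : ℂ) ^ Fintype.card {b // r b = b}) *
      ((n : ℂ) ^ d / m) ^ ((freeSet r).card - 1) *
      (walkWeight coef n r / ((n : ℂ) ^ d) ^ (freeSet r).card) := by
  rw [meanMoment, integral_trace_gram_pow hg, sum_walkWeight_eq hg.coeff_zero, Finset.mul_sum,
    Finset.mul_sum]
  refine Finset.sum_congr rfl fun r hr => ?_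
  have hc := (mem_canonicalSet.1 hr).card_add_card
  obtain ⟨f, hf⟩ : ∃ f, (freeSet r).card = f + 1 := ⟨_, (Nat.sub_add_cancel (freeSet_card_pos r)).symm⟩
  obtain ⟨k, hk⟩ : ∃ k, Fintype.card {b // r b = b} = k := ⟨_, rfl⟩
  rw [hk, hf] at hc
  have hp : p + 1 = f + k := by omega
  rw [hk, hf, Nat.add_sub_cancel]
  generalize walkWeight coef n r = w
  rw [hp]
  have hm' : (m : ℂ) ≠ 0 := by exact_mod_cast hm.ne'
  have hn' : (n : ℂ) ^ d ≠ 0 := pow_ne_zero _ (by exact_mod_cast hn.ne')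
  rw [div_pow, pow_add, pow_succ, inv_pow, inv_pow]
  field_simp

end Moments

end FoldVandermonde
end

noncomputable section

namespace FoldVandermonde

open Matrix

/-! ### Convergence of moments and of characteristic functions for trigonometric densities -/

section Limits

variable {d p : ℕ} {g : (Fin d → ℝ) → ℝ} {S : Finset (Fin d → ℤ)} {coef : (Fin d → ℤ) → ℂ}

lemma tendsto_descFactorial_div (k : ℕ) :
    Tendsto (fun m : ℕ => (m.descFactorial k : ℂ) / (m : ℂ) ^ k) atTop (𝓝 1) := by
  have h : ∀ i : ℕ, Tendsto (fun m : ℕ => (((m - i : ℕ) : ℝ) / m)) atTop (𝓝 1) := by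
    intro i
    have h1 : Tendsto (fun m : ℕ => 1 - (i : ℝ) / m) atTop (𝓝 1) := by
      simpa using tendsto_const_nhds.sub (tendsto_const_div_atTop_nhds_zero_nat (i : ℝ))
    refine h1.congr' ?_
    filter_upwards [eventually_gt_atTop i] with m hm
    have hm' : (m : ℝ) ≠ 0 := by
      have : 0 < m := by omega
      positivity
    rw [Nat.cast_sub hm.le, sub_div, div_self hm']
  have h2 := tendsto_finsetProd (Finset.range k) fun i _ =>
    (Complex.continuous_ofReal.tendsto _).comp (h i)
  simp only [Complex.ofReal_one, Finset.prod_const_one] at h2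
  refine h2.congr fun m => ?_
  simp only [Function.comp_apply]
  rw [Nat.descFactorial_eq_prod_range]
  push_cast
  rw [Finset.prod_div_distrib, Finset.prod_const, Finset.card_range]

lemma descFactorial_div_le (m k : ℕ) : ‖(m.descFactorial k : ℂ) / (m : ℂ) ^ k‖ ≤ 1 := by
  rw [norm_div, norm_pow, Complex.norm_natCast, Complex.norm_natCast]
  refine div_le_one_of_le₀ ?_ (by positivity)
  exact_mod_cast Nat.descFactorial_le_pow m k

/-- A canonical labelling is idempotent: choose its set of fixed points, then send every other index
into that set. The condition `r j ≤ j` is simply dropped. -/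
lemma card_canonicalSet_le_sum (p : ℕ) :
    (canonicalSet p).card ≤ ∑ k ∈ Finset.range (p + 2), (p + 1).choose k * k ^ (p + 1 - k) := by
  let F : Finset (Fin (p + 1)) → Finset (Fin (p + 1) → Fin (p + 1)) := fun T =>
    Fintype.piFinset fun j => if j ∈ T then {j} else T
  have hsub : canonicalSet p ⊆ (Finset.univ : Finset (Fin (p + 1))).powerset.biUnion F := by
    intro r hr
    have hr' := mem_canonicalSet.1 hr
    refine Finset.mem_biUnion.2 ⟨Finset.univ.filter fun b => r b = b, by simp, ?_⟩
    refine Fintype.mem_piFinset.2 fun j => ?_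
    by_cases hj : r j = j
    · simp [hj]
    · simp [hj, hr'.idem]
  have hcard : ∀ T, (F T).card = T.card ^ (p + 1 - T.card) := by
    intro T
    rw [Fintype.card_piFinset, ← Finset.prod_mul_prod_compl T]
    rw [Finset.prod_eq_one fun j hj => by rw [if_pos hj, Finset.card_singleton], one_mul,
      Finset.prod_congr rfl fun j hj => by rw [if_neg (Finset.mem_compl.1 hj)], Finset.prod_const,
      Finset.card_compl, Fintype.card_fin]
  refine (Finset.card_le_card hsub).trans (Finset.card_biUnion_le.trans ?_)
  simp_rw [hcard]
  rw [Finset.sum_powerset_apply_card (fun k => k ^ (p + 1 - k))]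
  simp

/-- The number of canonical labellings of a closed walk of length `p`. -/
def labelCount : ℕ → ℝ
  | 0 => 1
  | p + 1 => (canonicalSet p).card

/-- The number of labellings is dominated by `p! a^{-p}` for every `a`. -/
lemma labelCount_le (p : ℕ) {a : ℝ} (ha : 0 < a) :
    labelCount p ≤ p.factorial / a ^ p * Real.exp (a * Real.exp a) := by
  cases p with
  | zero =>
    simp only [labelCount, Nat.factorial_zero, Nat.cast_one, pow_zero, div_one, one_mul]
    exact Real.one_le_exp (by positivity)
  | succ p =>
    have h1 : labelCount (p + 1) ≤
        ∑ k ∈ Finset.range (p + 2), ((p + 1).choose k : ℝ) * (k : ℝ) ^ (p + 1 - k) := by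
      simp only [labelCount]
      exact_mod_cast card_canonicalSet_le_sum p
    have h2 : ∀ k ∈ Finset.range (p + 2), ((p + 1).choose k : ℝ) * (k : ℝ) ^ (p + 1 - k) ≤
        (p + 1).factorial / a ^ (p + 1) * ((a * Real.exp a) ^ k / k.factorial) := by
      intro k hk
      have hk' : k ≤ p + 1 := by have := Finset.mem_range.1 hk; omega
      obtain ⟨j, hj⟩ := Nat.exists_eq_add_of_le hk'
      rw [hj, Nat.add_sub_cancel_left]
      have hc : (((k + j).choose k : ℕ) : ℝ) =
          ((k + j).factorial : ℝ) / (k.factorial * j.factorial) := by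
        rw [Nat.cast_choose ℝ (Nat.le_add_right k j), Nat.add_sub_cancel_left]
      -- Bounding `(a k)^j / j!` by `exp a ^ k` decouples `j` from `k`, and the sum over `k` becomes
      -- a partial sum of the exponential of `a exp a`.
      have he := Real.pow_div_factorial_le_exp (a * k) (by positivity) j
      rw [hc]
      have hkf : (0 : ℝ) < k.factorial := by positivity
      have hjf : (0 : ℝ) < j.factorial := by positivity
      have e1 : Real.exp (a * k) = Real.exp a ^ k := by
        rw [mul_comm, ← Real.exp_nat_mul]
      rw [e1] at he
      have e2 : ((k + j).factorial : ℝ) / (k.factorial * j.factorial) * (k : ℝ) ^ j =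
          ((k + j).factorial : ℝ) / (k.factorial * a ^ j) * ((a * k) ^ j / j.factorial) := by
        rw [mul_pow]; field_simp
      rw [e2]
      calc _ ≤ ((k + j).factorial : ℝ) / (k.factorial * a ^ j) * Real.exp a ^ k := by gcongr
        _ = _ := by
          rw [pow_add, mul_pow]
          field_simp
    refine h1.trans ((Finset.sum_le_sum h2).trans ?_)
    rw [← Finset.mul_sum]
    refine mul_le_mul_of_nonneg_left ?_ (by positivity)
    exact Real.sum_le_exp_of_nonneg (by positivity) _

lemma labelCount_nonneg (p : ℕ) : 0 ≤ labelCount p := by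
  cases p with
  | zero => exact zero_le_one
  | succ p => exact Nat.cast_nonneg _

/-- The exponential generating function of the label counts is entire. -/
lemma summable_labelCount {x : ℝ} (hx : 0 ≤ x) :
    Summable fun p : ℕ => x ^ p / p.factorial * labelCount p := by
  -- The free parameter of `labelCount_le` is taken to be `2 * x + 1`, which leaves a geometric
  -- series of ratio below 1/2.
  have ha : (0 : ℝ) < 2 * x + 1 := by positivity
  have hr0 : 0 ≤ x / (2 * x + 1) := by positivity
  have hr : x / (2 * x + 1) < 1 := by rw [div_lt_one ha]; linarith
  refine Summable.of_nonneg_of_le (fun p => mul_nonneg (by positivity) (labelCount_nonneg p))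
    (fun p => ?_) ((summable_geometric_of_lt_one hr0 hr).mul_right
      (Real.exp ((2 * x + 1) * Real.exp (2 * x + 1))))
  calc x ^ p / p.factorial * labelCount p
      ≤ x ^ p / p.factorial * (p.factorial / (2 * x + 1) ^ p *
          Real.exp ((2 * x + 1) * Real.exp (2 * x + 1))) := by
        gcongr
        exact labelCount_le p ha
    _ = _ := by
        rw [div_pow]
        field_simp

/-- The limits of the mean moments. -/
def limitMoment (coef : (Fin d → ℤ) → ℂ) (S : Finset (Fin d → ℤ)) (β : ℝ) : ℕ → ℂ
  | 0 => 1
  | p + 1 => ∑ r ∈ canonicalSet p, (β : ℂ) ^ ((freeSet r).card - 1) * limitWeight coef S r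

lemma meanMoment_zero (hg : IsTrigDensity d g S coef) {n m : ℕ} (hn : 0 < n) :
    meanMoment g n m 0 = 1 := by
  have := hg.density.isProbabilityMeasure_sampleLaw m
  have hn' : (n : ℂ) ^ d ≠ 0 := pow_ne_zero _ (by exact_mod_cast hn.ne')
  simp [meanMoment, hn']

lemma tendsto_meanMoment (hg : IsTrigDensity d g S coef) {ι : Type*} {l : Filter ι} {n m : ι → ℕ}
    (hn : Tendsto n l atTop) (hm : Tendsto m l atTop) {β : ℝ}
    (hβ : Tendsto (fun k => (n k : ℝ) ^ d / (m k : ℝ)) l (𝓝 β)) (p : ℕ) :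
    Tendsto (fun k => meanMoment g (n k) (m k) p) l (𝓝 (limitMoment coef S β p)) := by
  cases p with
  | zero =>
    refine tendsto_const_nhds.congr' ?_
    filter_upwards [hn.eventually_gt_atTop 0] with k hk
    rw [meanMoment_zero hg hk]
    rfl
  | succ p =>
    have hβ' : Tendsto (fun k => (n k : ℂ) ^ d / (m k : ℂ)) l (𝓝 (β : ℂ)) := by
      have := (Complex.continuous_ofReal.tendsto _).comp hβ
      refine this.congr fun k => ?_
      simp
    have : Tendsto (fun k => ∑ r ∈ canonicalSet p,
        (((m k).descFactorial (Fintype.card {b // r b = b}) : ℂ) /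
          (m k : ℂ) ^ Fintype.card {b // r b = b}) *
        ((n k : ℂ) ^ d / m k) ^ ((freeSet r).card - 1) *
        (walkWeight coef (n k) r / ((n k : ℂ) ^ d) ^ (freeSet r).card)) l
        (𝓝 (limitMoment coef S β (p + 1))) := by
      refine tendsto_finsetSum _ fun r hr => ?_
      have h1 := (tendsto_descFactorial_div (Fintype.card {b // r b = b})).comp hm
      have h2 := hβ'.pow ((freeSet r).card - 1)
      have h3 := (tendsto_walkWeight_div hg.coeff_zero hg.support (mem_canonicalSet.1 hr)).comp hn
      have h4 := (h1.mul h2).mul h3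
      rw [one_mul] at h4
      exact h4
    refine this.congr' ?_
    filter_upwards [hn.eventually_gt_atTop 0, hm.eventually_gt_atTop 0] with k hk hk'
    rw [meanMoment_succ hg hk hk']

lemma IsTrigDensity.one_le_sum_norm (hg : IsTrigDensity d g S coef) :
    1 ≤ ∑ c ∈ S, ‖coef c‖ := by
  have h0S : (0 : Fin d → ℤ) ∈ S := by
    by_contra h
    have h0 := hg.coeff_zero
    rw [hg.support 0 h] at h0
    exact zero_ne_one h0
  calc (1 : ℝ) = ‖coef 0‖ := by rw [hg.coeff_zero, norm_one]
    _ ≤ _ := Finset.single_le_sum (f := fun c => ‖coef c‖) (fun c _ => norm_nonneg _) h0S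

lemma norm_walkWeight_div_le (hg : IsTrigDensity d g S coef) {n : ℕ} (hn : 0 < n)
    {r : Fin (p + 1) → Fin (p + 1)} (hr : IsCanonical r) :
    ‖walkWeight coef n r / ((n : ℂ) ^ d) ^ (freeSet r).card‖ ≤ (∑ c ∈ S, ‖coef c‖) ^ (p + 1) := by
  have hN : (0 : ℝ) < ((n : ℝ) ^ d) ^ (freeSet r).card := by positivity
  rw [norm_div, norm_pow, norm_pow, Complex.norm_natCast, div_le_iff₀ hN, mul_comm]
  exact norm_walkWeight_le hg.coeff_zero hg.support hg.norm_coeff_le n hr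

lemma norm_limitWeight_le (hg : IsTrigDensity d g S coef) {r : Fin (p + 1) → Fin (p + 1)}
    (hr : IsCanonical r) : ‖limitWeight coef S r‖ ≤ (∑ c ∈ S, ‖coef c‖) ^ (p + 1) := by
  refine le_of_tendsto (tendsto_walkWeight_div hg.coeff_zero hg.support hr).norm ?_
  filter_upwards [eventually_gt_atTop 0] with n hn
  exact norm_walkWeight_div_le hg hn hr

lemma pow_card_sub_one_le {B x : ℝ} (hB : 1 ≤ B) (hx0 : 0 ≤ x) (hx : x ≤ B)
    (r : Fin (p + 1) → Fin (p + 1)) : x ^ ((freeSet r).card - 1) ≤ B ^ (p + 1) := by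
  have h : (freeSet r).card ≤ p + 1 := by
    simpa using Finset.card_le_univ (freeSet r)
  exact (pow_le_pow_left₀ hx0 hx _).trans (pow_le_pow_right₀ hB (by omega))

/-- The bound depends on `n` and `m` only through an upper bound for their ratio, so it dominates
the exponential series uniformly along the limit. -/
lemma norm_meanMoment_le (hg : IsTrigDensity d g S coef) {n m : ℕ} (hn : 0 < n) (hm : 0 < m)
    {B : ℝ} (hB : 1 ≤ B) (hnm : (n : ℝ) ^ d / m ≤ B) (p : ℕ) :
    ‖meanMoment g n m p‖ ≤ labelCount p * (B * ∑ c ∈ S, ‖coef c‖) ^ p := by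
  cases p with
  | zero => rw [meanMoment_zero hg hn]; simp [labelCount]
  | succ p =>
    rw [meanMoment_succ hg hn hm]
    simp only [labelCount]
    rw [← nsmul_eq_mul, ← Finset.sum_const]
    refine (norm_sum_le _ _).trans (Finset.sum_le_sum fun r hr => ?_)
    rw [norm_mul, norm_mul, mul_pow, norm_pow]
    refine mul_le_mul ?_ (norm_walkWeight_div_le hg hn (mem_canonicalSet.1 hr)) (norm_nonneg _)
      (by positivity)
    have : ‖(n : ℂ) ^ d / m‖ = (n : ℝ) ^ d / m := by simp
    rw [this]
    exact (mul_le_of_le_one_left (by positivity) (descFactorial_div_le _ _)).trans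
      (pow_card_sub_one_le hB (by positivity) hnm r)

lemma norm_limitMoment_le (hg : IsTrigDensity d g S coef) {B β : ℝ} (hB : 1 ≤ B) (hβ0 : 0 ≤ β)
    (hβ : β ≤ B) (p : ℕ) :
    ‖limitMoment coef S β p‖ ≤ labelCount p * (B * ∑ c ∈ S, ‖coef c‖) ^ p := by
  cases p with
  | zero => simp [limitMoment, labelCount]
  | succ p =>
    simp only [labelCount, limitMoment]
    rw [← nsmul_eq_mul, ← Finset.sum_const]
    refine (norm_sum_le _ _).trans (Finset.sum_le_sum fun r hr => ?_)
    rw [norm_mul, mul_pow, norm_pow, Complex.norm_real, Real.norm_of_nonneg hβ0]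
    exact mul_le_mul (pow_card_sub_one_le hB hβ0 hβ r)
      (norm_limitWeight_le hg (mem_canonicalSet.1 hr)) (norm_nonneg _) (by positivity)

lemma hasSum_exp_series (z : ℂ) : HasSum (fun p : ℕ => z ^ p / p.factorial) (Complex.exp z) := by
  have := NormedSpace.expSeries_div_hasSum_exp (𝔸 := ℂ) z
  rwa [← Complex.exp_eq_exp_ℂ] at this

lemma norm_trace_gram_pow_le {n m : ℕ} (hm : 0 < m) (x : Fin m → Fin d → ℝ) (p : ℕ) :
    ‖(gram n x ^ p).trace‖ ≤ (n : ℝ) ^ d * ((n : ℝ) ^ d) ^ p := by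
  rw [← sum_eigenvalues_pow (gram_isHermitian n x), Complex.norm_real]
  refine (norm_sum_le _ _).trans ?_
  refine (Finset.sum_le_sum (g := fun _ => ((n : ℝ) ^ d) ^ p) fun ℓ _ => ?_).trans (le_of_eq ?_)
  · rw [norm_pow]
    refine pow_le_pow_left₀ (norm_nonneg _) ?_ p
    rw [← gramEigenvalues_eq, Real.norm_of_nonneg (gramEigenvalues_nonneg n x ℓ)]
    exact gramEigenvalues_le hm n x ℓ
  · simp

lemma hasSum_expStat {m : ℕ} (n : ℕ) (t : ℝ) (x : Fin m → Fin d → ℝ) :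
    HasSum (fun p : ℕ => (t * Complex.I) ^ p / p.factorial *
      (((n : ℂ) ^ d)⁻¹ * (gram n x ^ p).trace)) (expStat n t x) := by
  have h1 := (hasSum_sum (s := Finset.univ) fun (ℓ : Fin d → Fin n) _ =>
    hasSum_exp_series (t * gramEigenvalues n x ℓ * Complex.I)).mul_left (((n : ℂ) ^ d)⁻¹)
  have h2 : ∀ p : ℕ, (t * Complex.I) ^ p / p.factorial *
      (((n : ℂ) ^ d)⁻¹ * (gram n x ^ p).trace) = ((n : ℂ) ^ d)⁻¹ * ∑ ℓ,
        (t * gramEigenvalues n x ℓ * Complex.I) ^ p / p.factorial := fun p => by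
    rw [← sum_eigenvalues_pow (gram_isHermitian n x)]
    push_cast
    rw [mul_left_comm, Finset.mul_sum]
    congr 1
    refine Finset.sum_congr rfl fun ℓ _ => ?_
    rw [← gramEigenvalues_eq, mul_right_comm, mul_pow _ ((gramEigenvalues n x ℓ : ℝ) : ℂ)]
    ring
  simp_rw [h2]
  exact h1

lemma integral_mul_trace (t : ℝ) (n m p : ℕ) :
    ∫ x, (t * Complex.I) ^ p / p.factorial * (((n : ℂ) ^ d)⁻¹ * (gram n x ^ p).trace)
      ∂(sampleLaw d g m) = (t * Complex.I) ^ p / p.factorial * meanMoment g n m p := by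
  rw [integral_const_mul, integral_const_mul, meanMoment]

/-- Expansion of the characteristic function of the mean spectral measure into moments. -/
lemma hasSum_charFun_meanMeasure (hg : IsTrigDensity d g S coef) {n m : ℕ} (hn : 0 < n)
    (hm : 0 < m) (t : ℝ) :
    HasSum (fun p : ℕ => (t * Complex.I) ^ p / p.factorial * meanMoment g n m p)
      (charFun (meanMeasure n (sampleLaw d g m)) t) := by
  have := hg.density.isProbabilityMeasure_sampleLaw m
  rw [charFun_meanMeasure hn]
  have hN : 0 < (n : ℝ) ^ d := by positivity
  -- For fixed `n` all eigenvalues are at most `n^d`, which justifies exchanging sum and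
  -- expectation. This bound degenerates as `n` grows; uniformity comes from `norm_meanMoment_le`.
  have key := hasSum_integral_of_dominated_convergence (μ := sampleLaw d g m)
    (F := fun (p : ℕ) x => (t * Complex.I) ^ p / p.factorial *
      (((n : ℂ) ^ d)⁻¹ * (gram n x ^ p).trace)) (f := expStat n t)
    (fun p _ => (|t| * (n : ℝ) ^ d) ^ p / p.factorial) (fun p => ?_)
    (fun p => ae_of_all _ fun x => ?_)
    (ae_of_all _ fun _ => Real.summable_pow_div_factorial _)
    (integrable_const _) (ae_of_all _ fun x => hasSum_expStat n t x)
  · simpa only [integral_mul_trace] using key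
  · have h : Continuous fun x : Fin m → Fin d → ℝ => (gram n x ^ p).trace :=
      ((continuous_gram n).pow p).matrix_trace
    exact (continuous_const.mul (continuous_const.mul h)).aestronglyMeasurable
  · have h1 := norm_trace_gram_pow_le (n := n) hm x p
    rw [norm_mul, norm_div, norm_pow, norm_mul, Complex.norm_I, mul_one, Complex.norm_real,
      Complex.norm_natCast, norm_mul, norm_inv, norm_pow, Complex.norm_natCast, Real.norm_eq_abs]
    calc |t| ^ p / p.factorial * (((n : ℝ) ^ d)⁻¹ * ‖(gram n x ^ p).trace‖)
        ≤ |t| ^ p / p.factorial * (((n : ℝ) ^ d)⁻¹ * ((n : ℝ) ^ d * ((n : ℝ) ^ d) ^ p)) := by gcongr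
      _ = _ := by rw [inv_mul_cancel_left₀ hN.ne', mul_pow]; ring

/-- The limiting characteristic function. -/
def limitChar (coef : (Fin d → ℤ) → ℂ) (S : Finset (Fin d → ℤ)) (β t : ℝ) : ℂ :=
  ∑' p : ℕ, (t * Complex.I) ^ p / p.factorial * limitMoment coef S β p

lemma norm_coeff_series (t : ℝ) (p : ℕ) (z : ℂ) :
    ‖(t * Complex.I) ^ p / p.factorial * z‖ = |t| ^ p / p.factorial * ‖z‖ := by
  rw [norm_mul, norm_div, norm_pow, norm_mul, Complex.norm_I, mul_one, Complex.norm_real,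
    Complex.norm_natCast, Real.norm_eq_abs]

lemma norm_series_le {t C : ℝ} {p : ℕ} {z : ℂ} (hz : ‖z‖ ≤ labelCount p * C ^ p) :
    ‖(t * Complex.I) ^ p / p.factorial * z‖ ≤ (|t| * C) ^ p / p.factorial * labelCount p := by
  rw [norm_coeff_series]
  calc |t| ^ p / p.factorial * ‖z‖ ≤ |t| ^ p / p.factorial * (labelCount p * C ^ p) := by gcongr
    _ = _ := by rw [mul_pow]; ring

/-- Convergence of the characteristic functions for trigonometric densities. -/
theorem tendsto_charFun_of_isTrigDensity (hg : IsTrigDensity d g S coef) {ι : Type*}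
    {l : Filter ι} {n m : ι → ℕ} (hn : Tendsto n l atTop) (hm : Tendsto m l atTop) {β : ℝ}
    (hβ : Tendsto (fun k => (n k : ℝ) ^ d / (m k : ℝ)) l (𝓝 β)) (t : ℝ) :
    Tendsto (fun k => charFun (meanMeasure (n k) (sampleLaw d g (m k))) t) l
      (𝓝 (limitChar coef S β t)) := by
  have hA := hg.one_le_sum_norm
  -- Along the limit the ratio is eventually at most `β + 1`; the maximum with 1 makes powers of the
  -- bound increasing in the exponent.
  have hB : 1 ≤ max 1 (β + 1) := le_max_left _ _
  have hlim : Tendsto (fun k => ∑' p : ℕ, (t * Complex.I) ^ p / p.factorial *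
      meanMoment g (n k) (m k) p) l (𝓝 (limitChar coef S β t)) := by
    refine tendsto_tsum_of_dominated_convergence
      (summable_labelCount (x := |t| * (max 1 (β + 1) * ∑ c ∈ S, ‖coef c‖)) (by positivity))
      (fun p => (tendsto_meanMoment hg hn hm hβ p).const_mul _) ?_
    filter_upwards [hn.eventually_gt_atTop 0, hm.eventually_gt_atTop 0,
      hβ.eventually_le_const (lt_add_one β)] with k hk hk' hkβ p
    exact norm_series_le (norm_meanMoment_le hg hk hk' hB (hkβ.trans (le_max_right _ _)) p)
  refine hlim.congr' ?_
  filter_upwards [hn.eventually_gt_atTop 0, hm.eventually_gt_atTop 0] with k hk hk'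
  exact (hasSum_charFun_meanMeasure hg hk hk' t).tsum_eq

lemma freeSet_id : freeSet (id : Fin (p + 1) → Fin (p + 1)) = {0} := by
  ext j; simp [freeSet]

lemma isCanonical_id : IsCanonical (id : Fin (p + 1) → Fin (p + 1)) :=
  ⟨fun _ => le_rfl, fun _ => rfl⟩

/-- Identifies the only partition whose contribution carries no factor `β`, the one into singletons.
-/
lemma IsCanonical.eq_id {r : Fin (p + 1) → Fin (p + 1)} (hr : IsCanonical r)
    (h : (freeSet r).card = 1) : r = id := by
  obtain ⟨a, ha⟩ := Finset.card_eq_one.1 h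
  have h0 := zero_mem_freeSet r
  rw [ha, Finset.mem_singleton] at h0
  subst h0
  funext j
  by_cases hj : j = 0
  · subst hj
    exact le_antisymm (hr.le 0) (Fin.zero_le _)
  · have : j ∉ freeSet r := by rw [ha]; simpa using hj
    exact (notMem_freeSet.1 this).2

/-- Vertex 0 is the only free coordinate, and each row of the inverse frame has sum one on it. All
coordinates thus equal that one, and the polytope is an open unit interval. -/
lemma volume_latticePolytope_id :
    volume.real (latticePolytope (frameMatrix (id : Fin (p + 1) → Fin (p + 1)))⁻¹
      (freeSet (id : Fin (p + 1) → Fin (p + 1)))) = 1 := by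
  have hF := (isCanonical_id (p := p)).isCycleFrame
  set Fr := freeSet (id : Fin (p + 1) → Fin (p + 1)) with hFr
  set T' := (frameMatrix (id : Fin (p + 1) → Fin (p + 1)))⁻¹
  have huniq : ∀ j : Fr, j = ⟨0, zero_mem_freeSet _⟩ := fun j => by
    have h2 : (j : Fin (p + 1)) ∈ ({0} : Finset (Fin (p + 1))) := by
      rw [← freeSet_id]; exact j.2
    exact Subtype.ext (Finset.mem_singleton.1 h2)
  have hset : latticePolytope T' Fr = Set.univ.pi fun _ => Set.Ioo (0 : ℝ) 1 := by
    ext w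
    have hw : ∀ i, ∑ j, (T' i j : ℝ) * extendZero Fr w j = w ⟨0, zero_mem_freeSet _⟩ := fun i => by
      rw [sum_extendZero, Finset.sum_congr rfl fun j _ => by rw [show w j = w ⟨0, zero_mem_freeSet _⟩
        from congrArg w (huniq j)], ← Finset.sum_mul, hF.sum_free, one_mul]
    simp only [latticePolytope, Set.mem_ofPred_eq, hw, Set.mem_univ_pi]
    exact ⟨fun h j => by rw [huniq j]; exact h 0, fun h _ => h _⟩
  rw [hset, Measure.real, Real.volume_pi_Ioo]
  simp

/-- A sum of products of `p + 1` coefficients with frequencies summing to zero is a zeroth Fourier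
coefficient. Index 0 is free, so the other `p` factors build `g ^ p`, and the redundant coefficient
integrates it against the law of density `g`. -/
lemma sum_blockCoef_id (hg : IsTrigDensity d g S coef) :
    ∑ c ∈ blockRange S (freeSet (id : Fin (p + 1) → Fin (p + 1))),
      blockCoef coef (freeSet (id : Fin (p + 1) → Fin (p + 1))) c =
      ∫ x in cube d, (g x : ℂ) ^ (p + 1) := by
  have := hg.density.isProbabilityMeasure_pointLaw
  set Fr := freeSet (id : Fin (p + 1) → Fin (p + 1)) with hFr
  have hpow : ∀ x, (g x : ℂ) ^ p = ∑ c ∈ blockRange S Fr,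
      (∏ b, if b ∈ Fr then 1 else coef (c b)) * phase (-∑ b, if b ∈ Fr then 0 else c b) x := by
    intro x
    have h1 : (g x : ℂ) ^ p = ∏ b : Fin (p + 1), ∑ c ∈ (if b ∈ Fr then {0} else S),
        if b ∈ Fr then 1 else coef c * phase (-c) x := by
      rw [Fin.prod_univ_succ, hFr, freeSet_id]
      simp [← hg.expansion]
    rw [h1, Finset.prod_univ_sum]
    refine Finset.sum_congr rfl fun c _ => ?_
    rw [← Finset.sum_neg_distrib, phase_sum, ← Finset.prod_mul_distrib]
    refine Finset.prod_congr rfl fun b _ => ?_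
    split_ifs
    · simp [phase_zero]
    · rfl
  have h2 : ∫ x in cube d, (g x : ℂ) ^ (p + 1) = ∫ x, (g x : ℂ) ^ p ∂(pointLaw d g) := by
    rw [integral_pointLaw hg.density]
    simp only [pow_succ']
  rw [h2]
  simp_rw [hpow]
  rw [integral_finsetSum]
  · refine Finset.sum_congr rfl fun c _ => ?_
    rw [integral_const_mul, hg.integral_phase_pointLaw, blockCoef]
  · intro c _
    refine Integrable.const_mul ?_ _
    exact Integrable.of_bound (continuous_phase _).aestronglyMeasurable 1
      (ae_of_all _ fun x => (norm_phase _ x).le)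

lemma limitWeight_id (hg : IsTrigDensity d g S coef) :
    limitWeight coef S (id : Fin (p + 1) → Fin (p + 1)) = ∫ x in cube d, (g x : ℂ) ^ (p + 1) := by
  rw [limitWeight, volume_latticePolytope_id, ← sum_blockCoef_id hg]
  simp

/-- The limit moment of positive order is a polynomial in `β` whose constant term comes from the
singleton partition alone. -/
lemma tendsto_limitMoment_zero (hg : IsTrigDensity d g S coef) (p : ℕ) :
    Tendsto (fun β => limitMoment coef S β p) (𝓝[>] 0) (𝓝 (∫ x in cube d, (g x : ℂ) ^ p)) := by
  cases p with
  | zero => simp [limitMoment, Measure.real]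
  | succ p =>
    have h : Tendsto (fun β : ℝ => limitMoment coef S β (p + 1)) (𝓝 0)
        (𝓝 (limitMoment coef S 0 (p + 1))) := by
      refine Continuous.tendsto ?_ 0
      simp only [limitMoment]
      fun_prop
    have h0 : limitMoment coef S 0 (p + 1) = ∫ x in cube d, (g x : ℂ) ^ (p + 1) := by
      rw [← limitWeight_id hg, limitMoment, Finset.sum_eq_single id]
      · simp [freeSet_id]
      · intro r hr hne
        have h1 : (freeSet r).card - 1 ≠ 0 := by
          have := freeSet_card_pos r
          have h2 : (freeSet r).card ≠ 1 := fun h => hne ((mem_canonicalSet.1 hr).eq_id h)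
          omega
        rw [Complex.ofReal_zero, zero_pow h1, zero_mul]
      · exact fun h => absurd (mem_canonicalSet.2 isCanonical_id) h
    rw [← h0]
    exact h.mono_left nhdsWithin_le_nhds

lemma hasSum_integral_exp (hg : IsTrigDensity d g S coef) (t : ℝ) :
    HasSum (fun p : ℕ => (t * Complex.I) ^ p / p.factorial * ∫ x in cube d, (g x : ℂ) ^ p)
      (∫ x in cube d, Complex.exp (t * g x * Complex.I)) := by
  set A := ∑ c ∈ S, ‖coef c‖
  have hgA : ∀ x, ‖(g x : ℂ)‖ ≤ A := fun x => by
    rw [hg.expansion]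
    refine (norm_sum_le _ _).trans (Finset.sum_le_sum fun c _ => ?_)
    rw [norm_mul, norm_phase, mul_one]
  have key := hasSum_integral_of_dominated_convergence (μ := volume.restrict (cube d))
    (F := fun (p : ℕ) x => (t * Complex.I) ^ p / p.factorial * (g x : ℂ) ^ p)
    (f := fun x => Complex.exp (t * g x * Complex.I))
    (fun p _ => (|t| * A) ^ p / p.factorial) (fun p => ?_) (fun p => ae_of_all _ fun x => ?_)
    (ae_of_all _ fun _ => Real.summable_pow_div_factorial _)
    (integrable_const _) (ae_of_all _ fun x => ?_)
  · simpa only [integral_const_mul] using key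
  · exact (((Complex.measurable_ofReal.comp hg.density.measurable).pow_const p).const_mul
      _).aestronglyMeasurable
  · rw [norm_coeff_series, norm_pow, mul_pow, mul_div_right_comm]
    gcongr
    exact hgA x
  · have h2 : ∀ p : ℕ, (t * Complex.I) ^ p / p.factorial * (g x : ℂ) ^ p =
        (t * g x * Complex.I) ^ p / p.factorial := fun p => by
      rw [mul_right_comm, mul_pow _ ((g x : ℝ) : ℂ)]
      ring
    simp_rw [h2]
    exact hasSum_exp_series _

/-- For trigonometric densities the limiting characteristic function converges, as the ratio
vanishes, to that of the law of the values of the density. -/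
theorem tendsto_limitChar_zero (hg : IsTrigDensity d g S coef) (t : ℝ) :
    Tendsto (fun β => limitChar coef S β t) (𝓝[>] 0)
      (𝓝 (∫ x in cube d, Complex.exp (t * g x * Complex.I))) := by
  rw [← (hasSum_integral_exp hg t).tsum_eq]
  have hA := hg.one_le_sum_norm
  refine tendsto_tsum_of_dominated_convergence
    (summable_labelCount (x := |t| * (1 * ∑ c ∈ S, ‖coef c‖)) (by positivity))
    (fun p => (tendsto_limitMoment_zero hg p).const_mul _) ?_
  filter_upwards [Ioc_mem_nhdsGT (zero_lt_one' ℝ)] with β hβ p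
  exact norm_series_le (norm_limitMoment_le hg le_rfl hβ.1.le hβ.2 p)

end Limits

end FoldVandermonde
end

noncomputable section

namespace FoldVandermonde

/-! ### Existence of the limiting distribution and its limit at vanishing ratio -/

section Existence

variable {d : ℕ} {f : (Fin d → ℝ) → ℝ}

/-- The filter describing `n, m → ∞` with `n^d / m → β`. -/
def ratioFilter (d : ℕ) (β : ℝ) : Filter (ℕ × ℕ) :=
  (atTop ×ˢ atTop) ⊓ comap (fun k => (k.1 : ℝ) ^ d / (k.2 : ℝ)) (𝓝 β)

lemma tendsto_ratioFilter_iff {ι : Type*} {l : Filter ι} {n m : ι → ℕ} {β : ℝ} :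
    Tendsto (fun k => (n k, m k)) l (ratioFilter d β) ↔
      Tendsto n l atTop ∧ Tendsto m l atTop ∧
        Tendsto (fun k => (n k : ℝ) ^ d / (m k : ℝ)) l (𝓝 β) := by
  rw [ratioFilter, tendsto_inf, tendsto_prod_iff', tendsto_comap_iff, and_assoc]
  rfl

lemma tendsto_fst_ratioFilter (d : ℕ) (β : ℝ) : Tendsto Prod.fst (ratioFilter d β) atTop :=
  (tendsto_ratioFilter_iff.1 (tendsto_id : Tendsto _ (ratioFilter d β) _)).1

lemma tendsto_snd_ratioFilter (d : ℕ) (β : ℝ) : Tendsto Prod.snd (ratioFilter d β) atTop :=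
  (tendsto_ratioFilter_iff.1 (tendsto_id : Tendsto _ (ratioFilter d β) _)).2.1

lemma tendsto_ratio_ratioFilter (d : ℕ) (β : ℝ) :
    Tendsto (fun k : ℕ × ℕ => (k.1 : ℝ) ^ d / (k.2 : ℝ)) (ratioFilter d β) (𝓝 β) :=
  (tendsto_ratioFilter_iff.1 (tendsto_id : Tendsto _ (ratioFilter d β) _)).2.2

/-- An explicit sequence in the asymptotic regime, which makes the filter nontrivial and gives a
sequence for Lévy's theorem. `1 ≤ d` ensures that the second component tends to infinity. -/
lemma tendsto_ceil_ratio (hd : 1 ≤ d) {β : ℝ} (hβ : 0 < β) :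
    Tendsto (fun k : ℕ => (k, ⌈(k : ℝ) ^ d / β⌉₊)) atTop (ratioFilter d β) := by
  have hpow : Tendsto (fun k : ℕ => (k : ℝ) ^ d / β) atTop atTop :=
    ((tendsto_pow_atTop (by omega)).comp tendsto_natCast_atTop_atTop).atTop_div_const hβ
  refine tendsto_ratioFilter_iff.2 ⟨tendsto_id, tendsto_nat_ceil_atTop.comp hpow, ?_⟩
  have h1 : Tendsto (fun k : ℕ => (⌈(k : ℝ) ^ d / β⌉₊ : ℝ) / ((k : ℝ) ^ d / β)) atTop (𝓝 1) :=
    (tendsto_nat_ceil_div_atTop (R := ℝ)).comp hpow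
  have h2 := (h1.inv₀ one_ne_zero).const_mul β
  rw [inv_one, mul_one] at h2
  refine h2.congr fun k => ?_
  rw [inv_div, ← mul_div_assoc, mul_div_cancel₀ _ hβ.ne']

lemma ratioFilter_neBot (hd : 1 ≤ d) {β : ℝ} (hβ : 0 < β) : (ratioFilter d β).NeBot :=
  (tendsto_ceil_ratio hd hβ).neBot

/-- The characteristic functions of the mean spectral measures converge. -/
theorem exists_tendsto_charFun (hd : 1 ≤ d) (hf : IsPhaseDensity d f) {β : ℝ} (hβ : 0 < β)
    (t : ℝ) : ∃ c : ℂ, Tendsto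
      (fun k : ℕ × ℕ => charFun (meanMeasure k.1 (sampleLaw d f k.2)) t) (ratioFilter d β)
      (𝓝 c) := by
  have := ratioFilter_neBot hd hβ
  rw [← cauchy_map_iff_exists_tendsto, Metric.cauchy_iff]
  refine ⟨inferInstance, fun ε hε => ?_⟩
  -- The choice makes the Lipschitz error at most `ε / 4`, with `|t| + 1` avoiding a division by
  -- zero. The limit for `g` then serves as the centre of a small ball for the Cauchy criterion.
  obtain ⟨g, S, a, hg, hfg⟩ := exists_isTrigDensity_near hf
    (ε := ε / (4 * (|t| + 1))) (by positivity)
  have hlim := tendsto_charFun_of_isTrigDensity hg (tendsto_fst_ratioFilter d β)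
    (tendsto_snd_ratioFilter d β) (tendsto_ratio_ratioFilter d β) t
  have hδ : |t| * ∫ x in cube d, |f x - g x| ≤ ε / 4 := by
    calc |t| * ∫ x in cube d, |f x - g x| ≤ (|t| + 1) * (ε / (4 * (|t| + 1))) := by
          gcongr
          linarith
      _ = ε / 4 := by field_simp
  have hev : ∀ᶠ k in ratioFilter d β,
      dist (charFun (meanMeasure k.1 (sampleLaw d f k.2)) t) (limitChar a S β t) < ε / 2 := by
    filter_upwards [(tendsto_fst_ratioFilter d β).eventually_gt_atTop 0,
      (tendsto_snd_ratioFilter d β).eventually_gt_atTop 0,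
      hlim.eventually (Metric.ball_mem_nhds _ (show 0 < ε / 4 by positivity))] with k h1 h2 h3
    have h4 := norm_charFun_meanMeasure_sub_le hf hg.density h1 h2 t
    rw [← dist_eq_norm] at h4
    have h5 := dist_triangle (charFun (meanMeasure k.1 (sampleLaw d f k.2)) t)
      (charFun (meanMeasure k.1 (sampleLaw d g k.2)) t) (limitChar a S β t)
    linarith
  refine ⟨_, image_mem_map hev, ?_⟩
  rintro _ ⟨x, hx, rfl⟩ _ ⟨y, hy, rfl⟩
  have h1 := dist_triangle_right (charFun (meanMeasure x.1 (sampleLaw d f x.2)) t)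
    (charFun (meanMeasure y.1 (sampleLaw d f y.2)) t) (limitChar a S β t)
  rw [Set.mem_ofPred_eq] at hx hy
  linarith

/-- The mean spectral measure as a probability measure, with a dummy value for `n = 0`. -/
def meanProb (hf : IsPhaseDensity d f) (n m : ℕ) : ProbabilityMeasure ℝ :=
  if h : 0 < n then
    ⟨meanMeasure n (sampleLaw d f m), by
      have := hf.isProbabilityMeasure_sampleLaw m
      exact isProbabilityMeasure_meanMeasure h _⟩
  else ⟨Measure.dirac 0, inferInstance⟩

lemma coe_meanProb (hf : IsPhaseDensity d f) {n : ℕ} (hn : 0 < n) (m : ℕ) :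
    (meanProb hf n m : Measure ℝ) = meanMeasure n (sampleLaw d f m) := by
  have h : meanProb hf n m = ⟨meanMeasure n (sampleLaw d f m), by
      have := hf.isProbabilityMeasure_sampleLaw m
      exact isProbabilityMeasure_meanMeasure hn _⟩ := dif_pos hn
  rw [h]
  rfl

lemma tendsto_charFun_meanProb (hf : IsPhaseDensity d f) {β : ℝ} {t : ℝ} {c : ℂ}
    (h : Tendsto (fun k : ℕ × ℕ => charFun (meanMeasure k.1 (sampleLaw d f k.2)) t)
      (ratioFilter d β) (𝓝 c)) {ι : Type*} {l : Filter ι} {n m : ι → ℕ}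
    (hnm : Tendsto (fun k => (n k, m k)) l (ratioFilter d β)) :
    Tendsto (fun k => charFun (meanProb hf (n k) (m k) : Measure ℝ) t) l (𝓝 c) := by
  refine (h.comp hnm).congr' ?_
  filter_upwards [(tendsto_ratioFilter_iff.1 hnm).1.eventually_gt_atTop 0] with k hk
  rw [coe_meanProb hf hk]
  rfl

lemma norm_charFun_meanMeasure_sub_one_le (hf : IsPhaseDensity d f) {n m : ℕ} (hn : 0 < n)
    (hm : 0 < m) (t : ℝ) : ‖charFun (meanMeasure n (sampleLaw d f m)) t - 1‖ ≤ |t| := by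
  have := hf.isProbabilityMeasure_sampleLaw m
  have h1 : charFun (meanMeasure n (sampleLaw d f m)) t - 1 =
      ∫ x, (expStat n t x - 1) ∂(sampleLaw d f m) := by
    rw [integral_sub _ (integrable_const _), charFun_meanMeasure hn]
    · simp
    · exact Integrable.of_bound (continuous_expStat n t).aestronglyMeasurable 1
        (ae_of_all _ (norm_expStat_le n t))
  rw [h1]
  have := norm_integral_le_of_norm_le_const (μ := sampleLaw d f m) (C := |t|)
    (f := fun x => expStat n t x - 1) (ae_of_all _ fun x => norm_expStat_sub_one_le hn hm t x)
  simpa using this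

/-- The limiting spectral distribution exists, together with its characteristic function. -/
theorem exists_lsd (hd : 1 ≤ d) (hf : IsPhaseDensity d f) {β : ℝ} (hβ : 0 < β) :
    ∃ Λ : ProbabilityMeasure ℝ, IsLSD d f β Λ ∧ ∀ t, Tendsto
      (fun k : ℕ × ℕ => charFun (meanMeasure k.1 (sampleLaw d f k.2)) t) (ratioFilter d β)
      (𝓝 (charFun (Λ : Measure ℝ) t)) := by
  have hne := ratioFilter_neBot hd hβ
  choose Φ hΦ using fun t => exists_tendsto_charFun hd hf hβ t
  -- The mean-one bound passes to the pointwise limit and gives continuity at the origin, the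
  -- hypothesis of Lévy's criterion for tightness.
  have hΦ1 : ∀ t, ‖Φ t - 1‖ ≤ |t| := fun t => by
    refine le_of_tendsto ((hΦ t).sub_const 1).norm ?_
    filter_upwards [(tendsto_fst_ratioFilter d β).eventually_gt_atTop 0,
      (tendsto_snd_ratioFilter d β).eventually_gt_atTop 0] with k h1 h2
    exact norm_charFun_meanMeasure_sub_one_le hf h1 h2 t
  have hΦ0 : Φ 0 = 1 := by
    have := hΦ1 0
    rw [abs_zero] at this
    exact sub_eq_zero.1 (norm_le_zero_iff.1 this)
  have hcont : ContinuousAt Φ 0 := by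
    rw [ContinuousAt, hΦ0, tendsto_iff_norm_sub_tendsto_zero]
    refine squeeze_zero (fun _ => norm_nonneg _) hΦ1 ?_
    exact (continuous_abs.tendsto' 0 0 abs_zero)
  let μ : ℕ → ProbabilityMeasure ℝ := fun k => meanProb hf k ⌈(k : ℝ) ^ d / β⌉₊
  have hμ : ∀ t, Tendsto (fun k => charFun (μ k : Measure ℝ) t) atTop (𝓝 (Φ t)) := fun t =>
    tendsto_charFun_meanProb hf (hΦ t) (tendsto_ceil_ratio hd hβ)
  have htight : IsTightMeasureSet (Set.range fun k => (μ k : Measure ℝ)) :=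
    isTightMeasureSet_of_tendsto_charFun hcont hμ
  have hcompact : IsCompact (closure (Set.range μ)) := by
    refine isCompact_closure_of_isTightMeasureSet ?_
    convert htight using 1
    ext ν
    simp
  -- Compactness provides a limit measure along an ultrafilter. Its characteristic function is `Φ`,
  -- which then forces convergence along every admissible sequence.
  let U : Ultrafilter ℕ := hyperfilter ℕ
  have hU : (U : Filter ℕ) ≤ atTop := by
    rw [← Nat.cofinite_eq_atTop]
    exact hyperfilter_le_cofinite
  obtain ⟨Λ, -, hΛ⟩ := hcompact.ultrafilter_le_nhds (U.map μ)
    (.trans (by simp) (principal_mono.2 subset_closure))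
  have hΛ' : Tendsto μ U (𝓝 Λ) := hΛ
  have hchar : ∀ t, charFun (Λ : Measure ℝ) t = Φ t := fun t => by
    rw [ProbabilityMeasure.tendsto_iff_forall_integral_rclike_tendsto ℂ] at hΛ'
    have h1 := hΛ' (BoundedContinuousFunction.innerProbChar t)
    simp_rw [← charFun_eq_integral_innerProbChar] at h1
    exact tendsto_nhds_unique h1 ((hμ t).mono_left hU)
  refine ⟨Λ, fun n m hn hm hr z hz => ?_, fun t => by rw [hchar]; exact hΦ t⟩
  have hnm := (tendsto_ratioFilter_iff (d := d)).2 ⟨hn, hm, hr⟩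
  have hweak : Tendsto (fun k => meanProb hf (n k) (m k)) atTop (𝓝 Λ) := by
    refine ProbabilityMeasure.tendsto_of_tendsto_charFun fun t => ?_
    rw [hchar]
    exact tendsto_charFun_meanProb hf (hΦ t) hnm
  have hz' : (Λ : Measure ℝ) (frontier (Set.Iic z)) = 0 := by rwa [frontier_Iic]
  have h2 := ProbabilityMeasure.tendsto_measure_of_null_frontier_of_tendsto' hweak hz'
  have h3 := (ENNReal.tendsto_toReal (measure_ne_top _ _)).comp h2
  refine h3.congr' ?_
  filter_upwards [hn.eventually_gt_atTop 0] with k hk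
  rw [meanESD_eq hf hk, Measure.real, ← coe_meanProb hf hk]
  rfl

/-- The law of `f z` for `z` uniform on the cube. -/
def uniformValueLaw (f : (Fin d → ℝ) → ℝ) (hf : Measurable f) : ProbabilityMeasure ℝ :=
  ⟨(volume.restrict (cube d)).map f, Measure.isProbabilityMeasure_map hf.aemeasurable⟩

lemma charFun_uniformValueLaw (hf : Measurable f) (t : ℝ) :
    charFun (uniformValueLaw f hf : Measure ℝ) t =
      ∫ x in cube d, Complex.exp (t * f x * Complex.I) := by
  rw [charFun_apply_real]
  exact integral_map hf.aemeasurable (by fun_prop)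

/-- The target law satisfies the same Lipschitz bound in the density as the spectral measures, so
one trigonometric approximation serves on both sides. -/
lemma norm_integral_exp_sub_le {g : (Fin d → ℝ) → ℝ} (hf : IsPhaseDensity d f)
    (hg : IsPhaseDensity d g) (t : ℝ) :
    ‖(∫ x in cube d, Complex.exp (t * f x * Complex.I)) -
      ∫ x in cube d, Complex.exp (t * g x * Complex.I)‖ ≤ |t| * ∫ x in cube d, |f x - g x| := by
  have hint : ∀ h : (Fin d → ℝ) → ℝ, Measurable h →
      Integrable (fun x => Complex.exp (t * h x * Complex.I)) (volume.restrict (cube d)) := by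
    intro h hh
    refine Integrable.of_bound (C := 1) (Measurable.aestronglyMeasurable (by fun_prop))
      (ae_of_all _ fun x => ?_)
    rw [← Complex.ofReal_mul, Complex.norm_exp_ofReal_mul_I]
  rw [← integral_sub (hint f hf.measurable) (hint g hg.measurable), ← integral_const_mul]
  refine norm_integral_le_of_norm_le ((hf.integrable.sub hg.integrable).abs.const_mul _)
    (ae_of_all _ fun x => ?_)
  have e : Complex.exp (t * f x * Complex.I) - Complex.exp (t * g x * Complex.I) =
      Complex.exp ((t * g x : ℝ) * Complex.I) *
        (Complex.exp ((t * (f x - g x) : ℝ) * Complex.I) - 1) := by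
    rw [mul_sub, ← Complex.exp_add]
    push_cast
    ring_nf
  rw [e, norm_mul, Complex.norm_exp_ofReal_mul_I, one_mul, ← abs_mul]
  exact norm_exp_I_sub_one_le _

/-- As the ratio vanishes, the limiting spectral distributions converge weakly to the law of the
values of the density. -/
theorem tendsto_lsd (hd : 1 ≤ d) (hf : IsPhaseDensity d f) (Λ : ℝ → ProbabilityMeasure ℝ)
    (hΛ : ∀ β : ℝ, 0 < β → ∀ t, Tendsto
      (fun k : ℕ × ℕ => charFun (meanMeasure k.1 (sampleLaw d f k.2)) t) (ratioFilter d β)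
      (𝓝 (charFun (Λ β : Measure ℝ) t))) :
    Tendsto Λ (𝓝[>] 0) (𝓝 (uniformValueLaw f hf.measurable)) := by
  have hchar : ∀ t, Tendsto (fun β => charFun (Λ β : Measure ℝ) t) (𝓝[>] 0)
      (𝓝 (charFun (uniformValueLaw f hf.measurable : Measure ℝ) t)) := by
    intro t
    rw [Metric.tendsto_nhds]
    intro ε hε
    obtain ⟨g, S, a, hg, hfg⟩ := exists_isTrigDensity_near hf
      (ε := ε / (4 * (|t| + 1))) (by positivity)
    have hδ : |t| * ∫ x in cube d, |f x - g x| ≤ ε / 4 := by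
      calc |t| * ∫ x in cube d, |f x - g x| ≤ (|t| + 1) * (ε / (4 * (|t| + 1))) := by
            gcongr
            linarith
        _ = ε / 4 := by field_simp
    filter_upwards [self_mem_nhdsWithin,
      (tendsto_limitChar_zero hg t).eventually
        (Metric.ball_mem_nhds _ (show 0 < ε / 4 by positivity))] with β hβ h1
    have hβ' : 0 < β := hβ
    have := ratioFilter_neBot hd hβ'
    -- The bound uniform in `n` and `m` passes to the limit for each `β`, so the approximating
    -- density can be chosen before `β`.
    have h2 : dist (charFun (Λ β : Measure ℝ) t) (limitChar a S β t) ≤ ε / 4 := by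
      refine le_of_tendsto ((hΛ β hβ' t).dist (tendsto_charFun_of_isTrigDensity hg
        (tendsto_fst_ratioFilter d β) (tendsto_snd_ratioFilter d β)
        (tendsto_ratio_ratioFilter d β) t)) ?_
      filter_upwards [(tendsto_fst_ratioFilter d β).eventually_gt_atTop 0,
        (tendsto_snd_ratioFilter d β).eventually_gt_atTop 0] with k hk1 hk2
      rw [dist_eq_norm]
      exact (norm_charFun_meanMeasure_sub_le hf hg.density hk1 hk2 t).trans hδ
    have h3 := (norm_integral_exp_sub_le hg.density hf t).trans
      (le_of_eq (by simp_rw [abs_sub_comm (g _) (f _)]) |>.trans hδ)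
    rw [← dist_eq_norm] at h3
    rw [charFun_uniformValueLaw]
    have h4 := dist_triangle4 (charFun (Λ β : Measure ℝ) t) (limitChar a S β t)
      (∫ x in cube d, Complex.exp (t * g x * Complex.I))
      (∫ x in cube d, Complex.exp (t * f x * Complex.I))
    linarith
  -- The continuity theorem is applied along sequences; these suffice because the one-sided
  -- neighbourhood filter is countably generated.
  refine tendsto_of_seq_tendsto fun u hu => ?_
  exact ProbabilityMeasure.tendsto_of_tendsto_charFun fun t => (hchar t).comp hu

/-- Existence of the limiting spectral distributions and their limit as the ratio vanishes. -/
theorem exists_lsd_family (hd : 1 ≤ d) (hf : IsPhaseDensity d f) :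
    ∃ Λ : ℝ → ProbabilityMeasure ℝ, (∀ β : ℝ, 0 < β → IsLSD d f β (Λ β)) ∧
      Tendsto Λ (𝓝[>] 0) (𝓝 (uniformValueLaw f hf.measurable)) := by
  choose! Λ hΛ hΛ' using fun (β : ℝ) (hβ : 0 < β) => exists_lsd hd hf hβ
  exact ⟨Λ, hΛ, tendsto_lsd hd hf Λ hΛ'⟩

/-- On the cube, the density vanishes outside its positivity set, which produces the atom at 0. The
positivity set is not null because the total mass is one, so multiplying by its volume undoes the
conditioning in `valueLaw`. -/
lemma map_restrict_cube_eq (hf : IsPhaseDensity d f) :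
    (volume.restrict (cube d)).map f =
      (1 - volume (positivitySet d f)) • Measure.dirac (0 : ℝ) +
        volume (positivitySet d f) • valueLaw d f := by
  have hA : MeasurableSet (positivitySet d f) :=
    (measurableSet_cube d).inter (measurableSet_lt measurable_const hf.measurable)
  have hsub : positivitySet d f ⊆ cube d := fun z hz => hz.1
  have hle : volume (positivitySet d f) ≤ 1 := (measure_mono hsub).trans (volume_cube d).le
  have htop : volume (positivitySet d f) ≠ ⊤ := ne_top_of_le_ne_top ENNReal.one_ne_top hle
  have hzero : ∀ z ∈ cube d \ positivitySet d f, f z = 0 := fun z hz =>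
    le_antisymm (not_lt.1 fun h => hz.2 ⟨hz.1, h⟩) (hf.nonneg z hz.1)
  have hpos : volume (positivitySet d f) ≠ 0 := by
    intro h0
    have h1 : ∫⁻ z in cube d, ENNReal.ofReal (f z) = 0 := by
      rw [lintegral_eq_zero_iff hf.measurable.ennreal_ofReal,
        EventuallyEq, ae_restrict_iff' (measurableSet_cube d)]
      filter_upwards [measure_eq_zero_iff_ae_notMem.1 h0] with z hz hzc
      simp [hzero z ⟨hzc, hz⟩]
    rw [hf.lintegral_eq_one] at h1
    exact one_ne_zero h1
  have hsplit : volume.restrict (cube d) = volume.restrict (cube d \ positivitySet d f) +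
      volume.restrict (positivitySet d f) := by
    rw [← Measure.restrict_union Set.disjoint_sdiff_left hA, Set.sdiff_union_of_subset hsub]
  rw [hsplit, Measure.map_add _ _ hf.measurable]
  congr 1
  · have hc : (volume.restrict (cube d \ positivitySet d f)).map f =
        (volume.restrict (cube d \ positivitySet d f)).map fun _ => (0 : ℝ) := by
      refine Measure.map_congr ?_
      filter_upwards [ae_restrict_mem ((measurableSet_cube d).diff hA)] with z hz
      exact hzero z hz
    rw [hc, Measure.map_const, Measure.restrict_apply_univ, measure_sdiff hsub hA.nullMeasurableSet htop,
      volume_cube]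
  · rw [valueLaw, ProbabilityTheory.cond, Measure.map_smul, smul_smul,
      ENNReal.mul_inv_cancel hpos htop, one_smul]

lemma isPhaseDensity_one (d : ℕ) : IsPhaseDensity d fun _ => 1 :=
  ⟨measurable_const, fun _ _ => zero_le_one, by simp⟩

end Existence

end FoldVandermonde

end

/-! ### The theorem, with the uniform density as a special case -/

theorem corollary3 (d : ℕ) (hd : 1 ≤ d) (f : (Fin d → ℝ) → ℝ)
    (hf : FoldVandermonde.IsPhaseDensity d f) :
    (∃ (Λ : ℝ → ProbabilityMeasure ℝ) (ν : ProbabilityMeasure ℝ),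
      (∀ β : ℝ, 0 < β → FoldVandermonde.IsLSD d f β (Λ β)) ∧
      (ν : Measure ℝ) =
        (1 - volume (FoldVandermonde.positivitySet d f)) • Measure.dirac (0 : ℝ) +
          volume (FoldVandermonde.positivitySet d f) • FoldVandermonde.valueLaw d f ∧
      (ν : Measure ℝ) = (volume.restrict (FoldVandermonde.cube d)).map f ∧
      Tendsto Λ (𝓝[>] 0) (𝓝 ν)) ∧
    (∃ (Λ : ℝ → ProbabilityMeasure ℝ) (ν : ProbabilityMeasure ℝ),
      (∀ β : ℝ, 0 < β → FoldVandermonde.IsLSD d (fun _ => 1) β (Λ β)) ∧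
      (ν : Measure ℝ) = Measure.dirac (1 : ℝ) ∧
      Tendsto Λ (𝓝[>] 0) (𝓝 ν)) := by
  have h1 := FoldVandermonde.isPhaseDensity_one d
  obtain ⟨Λ, hΛ, hlim⟩ := FoldVandermonde.exists_lsd_family hd hf
  obtain ⟨Λ₁, hΛ₁, hlim₁⟩ := FoldVandermonde.exists_lsd_family hd h1
  refine ⟨⟨Λ, FoldVandermonde.uniformValueLaw f hf.measurable, hΛ,
      FoldVandermonde.map_restrict_cube_eq hf, rfl, hlim⟩,
    ⟨Λ₁, FoldVandermonde.uniformValueLaw _ h1.measurable, hΛ₁, ?_, hlim₁⟩⟩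
  change (volume.restrict (FoldVandermonde.cube d)).map (fun _ => (1 : ℝ)) = _
  rw [Measure.map_const, Measure.restrict_apply_univ, FoldVandermonde.volume_cube, one_smul]
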